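/- **Theorem (Eilenberg–Moore spectral sequence).** Let $k$ be a finite product of fields (equivalently, a commutative semisimple ring). Chain complexes are non-negatively graded complexes of $k$-modules, with tensor product over $k$ and the Koszul sign rule. Let $C$ be a cocommutative dg-coalgebra over $k$ (a cocommutative comonoid in non-negative chain complexes) which is simply connected, that is, $C_0=k$ and $C_1=0$. Comodules over $C$ are comodules in non-negative chain complexes. Let $X$ be a $C$-comodule which is fibrant in the model structure on $C$-comodules whose weak equivalences are the quasi-isomorphisms and whose cofibrations are the monomorphisms, or, equivalently, which is coflat, that is, the functor $X\square_C-$ is exact on $C$-comodules; here $X\square_C Y$ is the equalizer of the two maps $X\otimes Y\rightrightarrows X\otimes C\otimes Y$ induced by the coactions. Let $Y$ be any $C$-comodule. Regard $H_*(C)$ as a dg-coalgebra with zero differential and $H_*(X)$, $H_*(Y)$ as $H_*(C)$-comodules through the Künneth isomorphism, and let $\mathrm{CoTor}^q_{H_*(C)}(H_*(X),-)$ be the $q$-th right derived functor of $H_*(X)\square_{H_*(C)}-$ on $H_*(C)$-comodules. Then there is a spectral sequence of $k$-modules $(E^r_{p,q},d^r)$, $r\ge 2$, $p,q\ge 0$,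 with differentials $d^r\colon E^r_{p,q}\to E^r_{p+r-1,q+r}$ and $$E^2_{p,q}\cong \mathrm{CoTor}^q_{H_*(C)}\bigl(H_*(X),H_*(Y)\bigr)_p ,$$ where the subscript $p$ denotes the part of internal degree $p$, which converges to $H_*(X\square_C Y)$: for all $p,q$ the differentials into and out of $E^r_{p,q}$ vanish for all large $r$, and each $H_n(X\square_C Y)$ has a finite decreasing filtration $H_n=F^0H_n\supseteq F^1H_n\supseteq\cdots\supseteq 0$ such that, for all $p, q$, $E^\infty_{p,q}\cong F^qH_{p-q}(X\square_C Y)/F^{q+1}H_{p-q}(X\square_C Y)$ if $p\ge q$ and $E^\infty_{p,q}=0$ if $p<q$. -/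

import Mathlib

universe u

open TensorProduct CategoryTheory

namespace EilenbergMoore

/-! ### Non-negatively graded chain complexes

A non-negative chain complex of `k`-modules is encoded by its total module: a `k`-module
`M = ⨁ₙ Mₙ` (internal direct sum over `n : ℕ`) with a square-zero endomorphism of degree `-1`. -/

/-- A non-negatively graded chain complex of `k`-modules (differential graded `k`-module). -/
structure DGModule (k : Type u) [CommRing k] where
  /-- the total module `⨁ₙ Mₙ` -/
  carrier : Type u
  [addCommGroup : AddCommGroup carrier]
  [module : Module k carrier]
  /-- the submodule of elements of degree `n` -/
  gr : ℕ → Submodule k carrier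
  isInternal : DirectSum.IsInternal gr
  /-- the differential -/
  d : carrier →ₗ[k] carrier
  d_mem : ∀ n x, x ∈ gr (n + 1) → d x ∈ gr n
  d_zero : ∀ x, x ∈ gr 0 → d x = 0
  d_d : ∀ x, d (d x) = 0

attribute [instance] DGModule.addCommGroup DGModule.module

instance (k : Type u) [CommRing k] : CoeSort (DGModule k) (Type u) := ⟨DGModule.carrier⟩

section General

variable {k : Type u} [CommRing k]

theorem isInternal_of_proj {V : Type u} [AddCommGroup V] [Module k V] (gr : ℕ → Submodule k V)
    (p : ℕ → V →ₗ[k] V) (h1 : ∀ n x, x ∈ gr n → p n x = x)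
    (h2 : ∀ m n x, x ∈ gr n → n ≠ m → p m x = 0) (htop : ⨆ n, gr n = ⊤) :
    DirectSum.IsInternal gr := by
  refine DirectSum.isInternal_submodule_of_iSupIndep_of_iSup_eq_top (fun n => ?_) htop
  rw [Submodule.disjoint_def]
  intro x hx hx'
  have : (⨆ j, ⨆ (_ : j ≠ n), gr j) ≤ LinearMap.ker (p n) :=
    iSup_le fun j => iSup_le fun hj => fun y hy => h2 n j y hy hj
  rw [← h1 n x hx]
  exact this hx'

namespace DGModule

variable (M N P : DGModule k)

theorem iSup_gr : ⨆ n, M.gr n = ⊤ := M.isInternal.submodule_iSup_eq_top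

variable {M} in
theorem induction {motive : M → Prop} (x : M) (mem : ∀ n, ∀ x ∈ M.gr n, motive x)
    (zero : motive 0) (add : ∀ x y, motive x → motive y → motive (x + y)) : motive x :=
  Submodule.iSup_induction M.gr (x := x) (by rw [M.iSup_gr]; trivial) mem zero add

variable {M} in
theorem lin_ext {V : Type u} [AddCommGroup V] [Module k V] {f g : M →ₗ[k] V}
    (h : ∀ n, ∀ x ∈ M.gr n, f x = g x) : f = g := by
  refine LinearMap.ext fun x => ?_
  induction x using DGModule.induction with
  | mem i x hx => exact h i x hx
  | zero => simp
  | add x y hx hy => simp [hx, hy]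

theorem coeLinearMap_bijective : Function.Bijective (DirectSum.coeLinearMap M.gr) := M.isInternal

/-- The linear map which is given by `f n` on the degree `n` part. -/
noncomputable def glue {V : Type u} [AddCommGroup V] [Module k V] (f : ℕ → M →ₗ[k] V) :
    M →ₗ[k] V :=
  DirectSum.toModule k ℕ V (fun n => f n ∘ₗ (M.gr n).subtype) ∘ₗ
    (LinearEquiv.ofBijective (DirectSum.coeLinearMap M.gr) M.coeLinearMap_bijective).symm.toLinearMap

variable {M} in
theorem glue_of_mem {V : Type u} [AddCommGroup V] [Module k V] (f : ℕ → M →ₗ[k] V) {n : ℕ} {x : M}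
    (hx : x ∈ M.gr n) : M.glue f x = f n x := by
  have : (LinearEquiv.ofBijective (DirectSum.coeLinearMap M.gr) M.coeLinearMap_bijective).symm x
      = DirectSum.lof k ℕ (fun n => M.gr n) n ⟨x, hx⟩ := by
    rw [LinearEquiv.symm_apply_eq, LinearEquiv.ofBijective_apply, DirectSum.coeLinearMap_lof]
  simp [glue, this]

/-- The projection onto the degree `n` part. -/
noncomputable def proj (n : ℕ) : M →ₗ[k] M :=
  M.glue fun m => if m = n then LinearMap.id else 0

/-- The sign involution, `x ↦ (-1)^|x| x`. -/
noncomputable def sgn : M →ₗ[k] M :=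
  M.glue fun n => (-1 : k) ^ n • LinearMap.id

variable {M N P}

theorem proj_same {n : ℕ} {x : M} (hx : x ∈ M.gr n) : M.proj n x = x := by
  simp [proj, glue_of_mem _ hx]

theorem proj_ne {m n : ℕ} {x : M} (hx : x ∈ M.gr n) (h : n ≠ m) : M.proj m x = 0 := by
  simp [proj, glue_of_mem _ hx, h]

theorem proj_of_mem {m n : ℕ} {x : M} (hx : x ∈ M.gr n) :
    M.proj m x = if n = m then x else 0 := by
  split_ifs with h
  · subst h; exact proj_same hx
  · exact proj_ne hx h

theorem sgn_of_mem {n : ℕ} {x : M} (hx : x ∈ M.gr n) : M.sgn x = (-1 : k) ^ n • x := by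
  simp [sgn, glue_of_mem _ hx]

theorem proj_mem (n : ℕ) (x : M) : M.proj n x ∈ M.gr n := by
  induction x using DGModule.induction with
  | mem i x hx =>
    rw [proj_of_mem hx]
    split_ifs with h
    · exact h ▸ hx
    · exact zero_mem _
  | zero => simp
  | add x y hx hy => rw [map_add]; exact add_mem hx hy

theorem sgn_mem {n : ℕ} {x : M} (hx : x ∈ M.gr n) : M.sgn x ∈ M.gr n := by
  rw [sgn_of_mem hx]; exact Submodule.smul_mem _ _ hx

theorem d_proj_succ (n : ℕ) (x : M) : M.d (M.proj (n + 1) x) = M.proj n (M.d x) := by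
  have : M.d ∘ₗ M.proj (n + 1) = M.proj n ∘ₗ M.d := by
    refine lin_ext fun m x hx => ?_
    rcases m with _ | m
    · simp [proj_of_mem hx, M.d_zero x hx]
    · simp only [LinearMap.comp_apply, proj_of_mem hx, proj_of_mem (M.d_mem m x hx), add_left_inj]
      split_ifs <;> simp
  exact LinearMap.congr_fun this x

theorem d_proj_zero (x : M) : M.d (M.proj 0 x) = 0 := M.d_zero _ (proj_mem 0 x)

theorem sgn_d (x : M) : M.sgn (M.d x) = - M.d (M.sgn x) := by
  have : M.sgn ∘ₗ M.d = - (M.d ∘ₗ M.sgn) := by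
    refine lin_ext fun m x hx => ?_
    rcases m with _ | m
    · simp [sgn_of_mem hx, M.d_zero x hx]
    · simp [sgn_of_mem hx, sgn_of_mem (M.d_mem m x hx), pow_succ]
  exact LinearMap.congr_fun this x

theorem exists_sum_proj (x : M) : ∃ n : ℕ, ∀ m, n ≤ m → ∑ i ∈ Finset.range m, M.proj i x = x := by
  induction x using DGModule.induction with
  | mem i x hx =>
    refine ⟨i + 1, fun m hm => ?_⟩
    rw [Finset.sum_eq_single i]
    · exact proj_same hx
    · exact fun j _ hj => proj_ne hx (Ne.symm hj)
    · intro h; exact absurd (Finset.mem_range.2 (by omega)) h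
  | zero => exact ⟨0, fun m _ => by simp⟩
  | add x y hx hy =>
    obtain ⟨a, ha⟩ := hx
    obtain ⟨b, hb⟩ := hy
    refine ⟨max a b, fun m hm => ?_⟩
    simp only [map_add, Finset.sum_add_distrib]
    rw [ha m (by omega), hb m (by omega)]

/-- Degree zero chain maps. -/
@[ext]
structure Hom (M N : DGModule k) where
  /-- the underlying linear map -/
  lin : M →ₗ[k] N
  map_mem : ∀ n x, x ∈ M.gr n → lin x ∈ N.gr n
  map_d : ∀ x, lin (M.d x) = N.d (lin x)

theorem Hom.map_proj (f : Hom M N) (n : ℕ) (x : M) : f.lin (M.proj n x) = N.proj n (f.lin x) := by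
  have : f.lin ∘ₗ M.proj n = N.proj n ∘ₗ f.lin := by
    refine lin_ext fun m x hx => ?_
    simp only [LinearMap.comp_apply, proj_of_mem hx, proj_of_mem (f.map_mem m x hx)]
    split_ifs <;> simp
  exact LinearMap.congr_fun this x

theorem Hom.map_sgn (f : Hom M N) (x : M) : f.lin (M.sgn x) = N.sgn (f.lin x) := by
  have : f.lin ∘ₗ M.sgn = N.sgn ∘ₗ f.lin := by
    refine lin_ext fun m x hx => ?_
    simp [sgn_of_mem hx, sgn_of_mem (f.map_mem m x hx)]
  exact LinearMap.congr_fun this x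

/-- The identity chain map. -/
def Hom.id (M : DGModule k) : Hom M M := ⟨LinearMap.id, fun _ _ h => h, fun _ => rfl⟩

/-- Composition of chain maps. -/
def Hom.comp (g : Hom N P) (f : Hom M N) : Hom M P :=
  ⟨g.lin ∘ₗ f.lin, fun n x hx => g.map_mem n _ (f.map_mem n x hx),
    fun x => by simp [f.map_d, g.map_d]⟩

/-! ### Subcomplexes, quotient complexes, homology -/

/-- The subcomplex on a graded submodule stable under the differential. -/
noncomputable abbrev sub (M : DGModule k) (S : Submodule k M)
    (hp : ∀ n x, x ∈ S → M.proj n x ∈ S) (hd : ∀ x ∈ S, M.d x ∈ S) : DGModule k where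
  carrier := S
  gr n := (M.gr n).comap S.subtype
  isInternal := by
    refine isInternal_of_proj _ (fun n => (M.proj n).restrict (hp n)) ?_ ?_ ?_
    · intro n x hx; exact Subtype.ext (proj_same hx)
    · intro m n x hx h; exact Subtype.ext (proj_ne hx h)
    · rw [eq_top_iff]
      intro x _
      obtain ⟨n, hn⟩ := exists_sum_proj (x : M)
      have : x = ∑ i ∈ Finset.range n, (M.proj i).restrict (hp i) x := by
        apply Subtype.ext
        rw [AddSubmonoidClass.coe_finsetSum]
        exact (hn n le_rfl).symm
      rw [this]
      refine Submodule.sum_mem _ fun i _ => Submodule.mem_iSup_of_mem i ?_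
      exact proj_mem i (x : M)
  d := M.d.restrict hd
  d_mem n x hx := M.d_mem n _ hx
  d_zero x hx := Subtype.ext (M.d_zero _ hx)
  d_d x := Subtype.ext (M.d_d _)

/-- The quotient complex by a graded submodule stable under the differential. -/
noncomputable abbrev quot (M : DGModule k) (S : Submodule k M)
    (hp : ∀ n x, x ∈ S → M.proj n x ∈ S) (hd : ∀ x ∈ S, M.d x ∈ S) : DGModule k where
  carrier := M ⧸ S
  gr n := (M.gr n).map S.mkQ
  isInternal := by
    refine isInternal_of_proj _ (fun n => S.mapQ S (M.proj n) (hp n)) ?_ ?_ ?_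
    · rintro n _ ⟨x, hx, rfl⟩; simp [proj_same hx]
    · rintro m n _ ⟨x, hx, rfl⟩ h; simp [proj_ne hx h]
    · rw [← Submodule.map_iSup, M.iSup_gr, Submodule.map_top, Submodule.range_mkQ]
  d := S.mapQ S M.d hd
  d_mem := by rintro n _ ⟨x, hx, rfl⟩; exact ⟨M.d x, M.d_mem n x hx, rfl⟩
  d_zero := by rintro _ ⟨x, hx, rfl⟩; simp [M.d_zero x hx]
  d_d x := by
    obtain ⟨x, rfl⟩ := S.mkQ_surjective x
    simp [M.d_d]

/-- The equalizer of two chain maps. -/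
noncomputable abbrev equalizer (f g : Hom M N) : DGModule k :=
  M.sub (LinearMap.eqLocus f.lin g.lin)
    (fun n x hx => by
      simp only [LinearMap.mem_eqLocus] at hx ⊢
      rw [f.map_proj, g.map_proj, hx])
    (fun x hx => by
      simp only [LinearMap.mem_eqLocus] at hx ⊢
      rw [f.map_d, g.map_d, hx])

theorem proj_mem_ker (M : DGModule k) (n : ℕ) (x : M) (hx : x ∈ LinearMap.ker M.d) :
    M.proj n x ∈ LinearMap.ker M.d := by
  rw [LinearMap.mem_ker] at hx ⊢
  rcases n with _ | n
  · exact d_proj_zero x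
  · rw [d_proj_succ, hx, map_zero]

/-- The boundaries, as a submodule of the cycles. -/
def boundaries (M : DGModule k) : Submodule k (LinearMap.ker M.d) :=
  (LinearMap.range M.d).comap (LinearMap.ker M.d).subtype

/-- The homology `H_*(M)`, cycles modulo boundaries, a complex with zero differential; its degree
`n` part consists of the classes of the cycles of degree `n`. -/
noncomputable def homology (M : DGModule k) : DGModule k where
  carrier := LinearMap.ker M.d ⧸ M.boundaries
  gr n := ((M.gr n).comap (LinearMap.ker M.d).subtype).map M.boundaries.mkQ
  isInternal := by
    have hb : ∀ n, M.boundaries ≤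
        M.boundaries.comap ((M.proj n).restrict (M.proj_mem_ker n)) := by
      rintro n x ⟨y, hy⟩
      refine ⟨M.proj (n + 1) y, ?_⟩
      rw [d_proj_succ, hy]
      rfl
    refine isInternal_of_proj _
      (fun n => M.boundaries.mapQ M.boundaries ((M.proj n).restrict (M.proj_mem_ker n)) (hb n))
      ?_ ?_ ?_
    · rintro n _ ⟨x, hx, rfl⟩
      exact congrArg M.boundaries.mkQ (Subtype.ext (proj_same hx))
    · rintro m n _ ⟨x, hx, rfl⟩ h
      exact (congrArg M.boundaries.mkQ (Subtype.ext (proj_ne hx h))).trans (map_zero _)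
    · have htop : ⨆ n, (M.gr n).comap (LinearMap.ker M.d).subtype = ⊤ :=
        (M.sub (LinearMap.ker M.d) M.proj_mem_ker (fun x _ => by simp [M.d_d])).iSup_gr
      rw [← Submodule.map_iSup, htop, Submodule.map_top, Submodule.range_mkQ]
  d := 0
  d_mem _ _ _ := zero_mem _
  d_zero _ _ := rfl
  d_d _ := rfl

/-- The homology class of a cycle. -/
noncomputable def cls (M : DGModule k) : LinearMap.ker M.d →ₗ[k] M.homology :=
  Submodule.mkQ M.boundaries

theorem cls_surjective (M : DGModule k) : Function.Surjective M.cls :=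
  Submodule.mkQ_surjective _

theorem cls_eq_zero_iff (z : LinearMap.ker M.d) : M.cls z = 0 ↔ ∃ y, M.d y = z.1 :=
  Submodule.Quotient.mk_eq_zero _

theorem cls_mem {n : ℕ} {z : LinearMap.ker M.d} (hz : z.1 ∈ M.gr n) : M.cls z ∈ M.homology.gr n :=
  ⟨z, hz, rfl⟩

theorem exists_cls_of_mem {n : ℕ} {x : M.homology} (hx : x ∈ M.homology.gr n) :
    ∃ z : LinearMap.ker M.d, z.1 ∈ M.gr n ∧ M.cls z = x := by
  obtain ⟨z, hz, rfl⟩ := hx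
  exact ⟨z, hz, rfl⟩

theorem homology_d (x : M.homology) : M.homology.d x = 0 := rfl

/-- Descend a linear map killing boundaries to homology. -/
noncomputable def homologyLift {V : Type u} [AddCommGroup V] [Module k V]
    (f : LinearMap.ker M.d →ₗ[k] V) (hf : ∀ z, (∃ y, M.d y = z.1) → f z = 0) :
    M.homology →ₗ[k] V :=
  Submodule.liftQ M.boundaries f fun z hz => hf z hz

@[simp]
theorem homologyLift_cls {V : Type u} [AddCommGroup V] [Module k V]
    (f : LinearMap.ker M.d →ₗ[k] V) (hf : ∀ z, (∃ y, M.d y = z.1) → f z = 0)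
    (z : LinearMap.ker M.d) : homologyLift f hf (M.cls z) = f z := rfl

/-- The restriction of a chain map to cycles. -/
noncomputable def Hom.cyclesMap (f : Hom M N) : LinearMap.ker M.d →ₗ[k] LinearMap.ker N.d :=
  f.lin.restrict fun x hx => by
    rw [LinearMap.mem_ker] at hx ⊢
    rw [← f.map_d, hx, map_zero]

/-- The map induced in homology by a chain map. -/
noncomputable def Hom.homologyMap (f : Hom M N) : Hom M.homology N.homology where
  lin := homologyLift (N.cls ∘ₗ f.cyclesMap) (by
    rintro z ⟨y, hy⟩
    rw [LinearMap.comp_apply, cls_eq_zero_iff]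
    exact ⟨f.lin y, by rw [← f.map_d, hy]; rfl⟩)
  map_mem n x hx := by
    obtain ⟨z, hz, rfl⟩ := exists_cls_of_mem hx
    exact cls_mem (f.map_mem n _ hz)
  map_d x := by rw [homology_d, homology_d, map_zero]

theorem Hom.homologyMap_cls (f : Hom M N) (z : LinearMap.ker M.d) :
    f.homologyMap.lin (M.cls z) = N.cls (f.cyclesMap z) := rfl

/-- A chain map inducing an isomorphism in homology. -/
def Hom.IsQuasiIso (f : Hom M N) : Prop := Function.Bijective f.homologyMap.lin

end DGModule

end General
section Tensor

variable {k : Type u} [CommRing k]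

namespace DGModule

variable {M N P Q : DGModule k}

/-! ### The tensor product of chain complexes -/

/-- The degree `n` part of `M ⊗ N`, spanned by the `x ⊗ y` with `|x| + |y| = n`. -/
def tensorGr (M N : DGModule k) (n : ℕ) : Submodule k (M ⊗[k] N) :=
  Submodule.span k {t | ∃ i j x y, i + j = n ∧ x ∈ M.gr i ∧ y ∈ N.gr j ∧ x ⊗ₜ[k] y = t}

theorem tmul_mem_tensorGr {i j n : ℕ} {x : M} {y : N} (hx : x ∈ M.gr i) (hy : y ∈ N.gr j)
    (h : i + j = n) : x ⊗ₜ[k] y ∈ tensorGr M N n :=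
  Submodule.subset_span ⟨i, j, x, y, h, hx, hy, rfl⟩

theorem tensorGr_le {n : ℕ} {S : Submodule k (M ⊗[k] N)}
    (h : ∀ i j x y, i + j = n → x ∈ M.gr i → y ∈ N.gr j → x ⊗ₜ[k] y ∈ S) : tensorGr M N n ≤ S := by
  refine Submodule.span_le.2 ?_
  rintro _ ⟨i, j, x, y, hn, hx, hy, rfl⟩
  exact h i j x y hn hx hy

theorem tensor_lin_ext {V : Type u} [AddCommGroup V] [Module k V] {f g : M ⊗[k] N →ₗ[k] V}
    (h : ∀ i j, ∀ x ∈ M.gr i, ∀ y ∈ N.gr j, f (x ⊗ₜ y) = g (x ⊗ₜ y)) : f = g := by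
  refine TensorProduct.ext (lin_ext fun i x hx => lin_ext fun j y hy => ?_)
  exact h i j x hx y hy

theorem iSup_tensorGr (M N : DGModule k) : ⨆ n, tensorGr M N n = ⊤ := by
  rw [eq_top_iff, ← TensorProduct.span_tmul_eq_top, Submodule.span_le]
  rintro _ ⟨x, y, rfl⟩
  induction x using DGModule.induction with
  | mem i x hx =>
    induction y using DGModule.induction with
    | mem j y hy => exact Submodule.mem_iSup_of_mem (i + j) (tmul_mem_tensorGr hx hy rfl)
    | zero => rw [TensorProduct.tmul_zero]; exact zero_mem _
    | add y y' hy hy' => rw [TensorProduct.tmul_add]; exact add_mem hy hy'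
  | zero => rw [TensorProduct.zero_tmul]; exact zero_mem _
  | add y y' hy hy' => rw [TensorProduct.add_tmul]; exact add_mem hy hy'

/-- The tensor product of chain complexes, with
`d (x ⊗ y) = d x ⊗ y + (-1)^|x| x ⊗ d y`. -/
noncomputable abbrev tensor (M N : DGModule k) : DGModule k where
  carrier := M ⊗[k] N
  gr := tensorGr M N
  isInternal := by
    have key : ∀ m i j x y, x ∈ M.gr i → y ∈ N.gr j →
        (∑ p ∈ Finset.HasAntidiagonal.antidiagonal m, TensorProduct.map (M.proj p.1) (N.proj p.2)) (x ⊗ₜ[k] y)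
          = if i + j = m then x ⊗ₜ[k] y else 0 := by
      intro m i j x y hx hy
      rw [LinearMap.sum_apply]
      split_ifs with h
      · rw [Finset.sum_eq_single (i, j)]
        · simp [proj_same hx, proj_same hy]
        · rintro ⟨a, b⟩ _ hne
          by_cases ha : i = a
          · have hb : j ≠ b := fun hb => hne (by rw [ha, hb])
            simp [proj_ne hy hb]
          · simp [proj_ne hx ha]
        · intro hn; exact absurd (Finset.HasAntidiagonal.mem_antidiagonal.2 h) hn
      · refine Finset.sum_eq_zero ?_
        rintro ⟨a, b⟩ hab
        rw [Finset.HasAntidiagonal.mem_antidiagonal] at hab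
        by_cases ha : i = a
        · have hb : j ≠ b := fun hb => h (by rw [ha, hb]; exact hab)
          simp [proj_ne hy hb]
        · simp [proj_ne hx ha]
    refine isInternal_of_proj _
      (fun m => ∑ p ∈ Finset.HasAntidiagonal.antidiagonal m, TensorProduct.map (M.proj p.1) (N.proj p.2)) ?_ ?_
      (iSup_tensorGr M N)
    · intro n t ht
      refine (tensorGr_le (S := LinearMap.eqLocus
        (∑ p ∈ Finset.HasAntidiagonal.antidiagonal n, TensorProduct.map (M.proj p.1) (N.proj p.2))
        LinearMap.id) ?_ ht :)
      intro i j x y h hx hy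
      rw [LinearMap.mem_eqLocus, key n i j x y hx hy, if_pos h]
      rfl
    · intro m n t ht hne
      refine (tensorGr_le (S := LinearMap.ker
        (∑ p ∈ Finset.HasAntidiagonal.antidiagonal m,
          TensorProduct.map (M.proj p.1) (N.proj p.2))) ?_ ht :)
      intro i j x y h hx hy
      rw [LinearMap.mem_ker, key m i j x y hx hy, if_neg (by omega)]
  d := TensorProduct.map M.d LinearMap.id + TensorProduct.map M.sgn N.d
  d_mem := by
    intro n t ht
    refine (tensorGr_le (S := (tensorGr M N n).comap _) ?_ ht :)
    intro i j x y h hx hy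
    rw [Submodule.mem_comap]
    simp only [LinearMap.add_apply, TensorProduct.map_tmul, LinearMap.id_apply]
    refine add_mem ?_ ?_
    · rcases i with _ | i
      · simp [M.d_zero x hx]
      · exact tmul_mem_tensorGr (M.d_mem i x hx) hy (by omega)
    · rcases j with _ | j
      · simp [N.d_zero y hy]
      · exact tmul_mem_tensorGr (sgn_mem hx) (N.d_mem j y hy) (by omega)
  d_zero := by
    intro t ht
    refine (tensorGr_le (S := LinearMap.ker
      (TensorProduct.map M.d LinearMap.id + TensorProduct.map M.sgn N.d)) ?_ ht :)
    intro i j x y h hx hy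
    obtain ⟨rfl, rfl⟩ : i = 0 ∧ j = 0 := by omega
    simp [M.d_zero x hx, N.d_zero y hy]
  d_d := by
    intro t
    induction t using TensorProduct.induction_on with
    | zero => simp
    | tmul x y => simp [M.d_d, N.d_d, sgn_d, TensorProduct.neg_tmul]
    | add a b ha hb => simp only [map_add, ha, hb, add_zero]

theorem tensor_d_tmul (x : M) (y : N) :
    (M.tensor N).d (x ⊗ₜ[k] y) = M.d x ⊗ₜ[k] y + M.sgn x ⊗ₜ[k] N.d y := rfl

theorem tensor_sgn_tmul (x : M) (y : N) :
    (M.tensor N).sgn (x ⊗ₜ[k] y) = M.sgn x ⊗ₜ[k] N.sgn y := by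
  have : (M.tensor N).sgn = TensorProduct.map M.sgn N.sgn := by
    refine tensor_lin_ext fun i j x hx y hy => ?_
    have h : x ⊗ₜ[k] y ∈ (M.tensor N).gr (i + j) := tmul_mem_tensorGr hx hy rfl
    refine (sgn_of_mem h).trans ?_
    rw [TensorProduct.map_tmul, sgn_of_mem hx, sgn_of_mem hy, TensorProduct.smul_tmul_smul, pow_add]
  exact LinearMap.congr_fun this _

/-- The tensor product of chain maps. -/
noncomputable def Hom.tensor (f : Hom M N) (g : Hom P Q) : Hom (M.tensor P) (N.tensor Q) where
  lin := TensorProduct.map f.lin g.lin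
  map_mem n t ht := by
    refine (tensorGr_le (S := (tensorGr N Q n).comap (TensorProduct.map f.lin g.lin)) ?_ ht :)
    intro i j x y h hx hy
    exact tmul_mem_tensorGr (f.map_mem i x hx) (g.map_mem j y hy) h
  map_d t := by
    induction t using TensorProduct.induction_on with
    | zero => simp
    | tmul x y => simp [f.map_d, g.map_d, f.map_sgn]
    | add a b ha hb => rw [map_add, map_add, map_add, map_add, ha, hb]

/-- The associativity isomorphism `(M ⊗ N) ⊗ P ⟶ M ⊗ (N ⊗ P)`. -/
noncomputable def assocHom (M N P : DGModule k) :
    Hom ((M.tensor N).tensor P) (M.tensor (N.tensor P)) where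
  lin := (TensorProduct.assoc k M N P).toLinearMap
  map_mem n t ht := by
    refine (tensorGr_le (M := M.tensor N) (N := P)
      (S := (tensorGr M (N.tensor P) n).comap (TensorProduct.assoc k M N P).toLinearMap) ?_ ht :)
    intro i j s z h hs hz
    refine (tensorGr_le (S := (tensorGr M (N.tensor P) n).comap
      ((TensorProduct.assoc k M N P).toLinearMap ∘ₗ
        (TensorProduct.mk k (M ⊗[k] N) P).flip z)) ?_ hs :)
    intro a b x y h' hx hy
    exact tmul_mem_tensorGr (M := M) (N := N.tensor P) hx
      (tmul_mem_tensorGr hy hz rfl) (by omega)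
  map_d t := by
    have : (TensorProduct.assoc k M N P).toLinearMap ∘ₗ ((M.tensor N).tensor P).d =
        (M.tensor (N.tensor P)).d ∘ₗ (TensorProduct.assoc k M N P).toLinearMap := by
      refine TensorProduct.ext_threefold fun x y z => ?_
      have h := tensor_sgn_tmul (M := M) (N := N) x y
      simp only [LinearMap.comp_apply, LinearMap.add_apply, TensorProduct.map_tmul,
        LinearMap.id_apply, TensorProduct.add_tmul, TensorProduct.tmul_add, map_add,
        LinearEquiv.coe_coe, TensorProduct.assoc_tmul, add_assoc, h]
    exact LinearMap.congr_fun this t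

/-- The inverse associativity isomorphism `M ⊗ (N ⊗ P) ⟶ (M ⊗ N) ⊗ P`. -/
noncomputable def assocInvHom (M N P : DGModule k) :
    Hom (M.tensor (N.tensor P)) ((M.tensor N).tensor P) where
  lin := (TensorProduct.assoc k M N P).symm.toLinearMap
  map_mem n t ht := by
    refine (tensorGr_le (M := M) (N := N.tensor P) (S := (tensorGr (M.tensor N) P n).comap
      (TensorProduct.assoc k M N P).symm.toLinearMap) ?_ ht :)
    intro i j x s h hx hs
    refine (tensorGr_le (S := (tensorGr (M.tensor N) P n).comap
      ((TensorProduct.assoc k M N P).symm.toLinearMap ∘ₗ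
        TensorProduct.mk k M (N ⊗[k] P) x)) ?_ hs :)
    intro a b y z h' hy hz
    exact tmul_mem_tensorGr (M := M.tensor N) (N := P)
      (tmul_mem_tensorGr hx hy rfl) hz (by omega)
  map_d t := by
    obtain ⟨s, rfl⟩ := (TensorProduct.assoc k M N P).surjective t
    have h := (assocHom M N P).map_d s
    change (TensorProduct.assoc k M N P) (((M.tensor N).tensor P).d s) =
      (M.tensor (N.tensor P)).d (TensorProduct.assoc k M N P s) at h
    rw [← h]
    simp only [LinearEquiv.coe_coe, LinearEquiv.symm_apply_apply]

/-- The linear map underlying the twist: `x ⊗ y ↦ (-1)^(|x||y|) y ⊗ x`. -/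
noncomputable def twist (M N : DGModule k) : M ⊗[k] N →ₗ[k] N ⊗[k] M :=
  TensorProduct.lift
    (M.glue fun i => (TensorProduct.mk k N M).flip.compl₂ (N.glue fun j =>
      (-1 : k) ^ (i * j) • LinearMap.id))

theorem twist_tmul {i j : ℕ} {x : M} {y : N} (hx : x ∈ M.gr i) (hy : y ∈ N.gr j) :
    twist M N (x ⊗ₜ y) = (-1 : k) ^ (i * j) • (y ⊗ₜ[k] x) := by
  simp [twist, glue_of_mem _ hx, glue_of_mem _ hy, TensorProduct.smul_tmul']

/-- The twist isomorphism of the symmetric monoidal category of chain complexes. -/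
noncomputable def twistHom (M N : DGModule k) : Hom (M.tensor N) (N.tensor M) where
  lin := twist M N
  map_mem n t ht := by
    refine (tensorGr_le (S := (tensorGr N M n).comap (twist M N)) ?_ ht :)
    intro i j x y h hx hy
    rw [Submodule.mem_comap, twist_tmul hx hy]
    exact Submodule.smul_mem _ _ (tmul_mem_tensorGr hy hx (by omega))
  map_d t := by
    have : twist M N ∘ₗ (M.tensor N).d = (N.tensor M).d ∘ₗ twist M N := by
      refine tensor_lin_ext fun i j x hx y hy => ?_
      simp only [LinearMap.comp_apply, LinearMap.add_apply, TensorProduct.map_tmul,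
        LinearMap.id_apply, map_add, twist_tmul hx hy, map_smul, sgn_of_mem hx, sgn_of_mem hy]
      have h1 : twist M N (M.d x ⊗ₜ[k] y)
          = (-1 : k) ^ (i * j) • (((-1 : k) ^ j • y) ⊗ₜ[k] M.d x) := by
        rcases i with _ | i
        · simp [M.d_zero x hx]
        · rw [twist_tmul (M.d_mem i x hx) hy, ← TensorProduct.smul_tmul', smul_smul, ← pow_add]
          congr 1
          rw [show (i + 1) * j + j = i * j + 2 * j by ring, pow_add, pow_mul]
          simp
      have h2 : twist M N (((-1 : k) ^ i • x) ⊗ₜ[k] N.d y)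
          = (-1 : k) ^ (i * j) • (N.d y ⊗ₜ[k] x) := by
        rcases j with _ | j
        · simp [N.d_zero y hy]
        · rw [← TensorProduct.smul_tmul', map_smul, twist_tmul hx (N.d_mem j y hy), smul_smul,
            ← pow_add, show i + i * j = i * (j + 1) by ring]
      rw [h1, h2, smul_add, add_comm]
    exact LinearMap.congr_fun this t

theorem twist_natural (f : Hom M N) (g : Hom P Q) :
    twist N Q ∘ₗ TensorProduct.map f.lin g.lin = TensorProduct.map g.lin f.lin ∘ₗ twist M P := by
  refine tensor_lin_ext fun i j x hx y hy => ?_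
  simp [twist_tmul hx hy, twist_tmul (f.map_mem i x hx) (g.map_mem j y hy)]

end DGModule

/-! ### Differential graded coalgebras and comodules -/

open DGModule

/-- A (connective) dg-coalgebra over `k`: a comonoid in non-negative chain complexes, i.e. a
coalgebra whose comultiplication and counit are chain maps of degree zero. -/
structure DGCoalgebra (k : Type u) [CommRing k] extends DGModule k where
  [coalgebra : Coalgebra k carrier]
  comul_mem : ∀ n x, x ∈ gr n →
    (Coalgebra.comul (R := k) x) ∈ DGModule.tensorGr toDGModule toDGModule n
  comul_d : ∀ x, Coalgebra.comul (R := k) (d x) =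
    (DGModule.tensor toDGModule toDGModule).d (Coalgebra.comul (R := k) x)
  counit_of_mem : ∀ n x, x ∈ gr (n + 1) → Coalgebra.counit (R := k) x = 0
  counit_d : ∀ x, Coalgebra.counit (R := k) (d x) = 0

attribute [instance] DGCoalgebra.coalgebra

instance (k : Type u) [CommRing k] : CoeSort (DGCoalgebra k) (Type u) :=
  ⟨fun C => C.toDGModule.carrier⟩

namespace DGCoalgebra

/-- The comultiplication as a chain map. -/
noncomputable def comulHom (C : DGCoalgebra k) :
    Hom C.toDGModule (C.toDGModule.tensor C.toDGModule) :=
  ⟨Coalgebra.comul, C.comul_mem, C.comul_d⟩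

/-- Graded cocommutativity: `τ ∘ Δ = Δ`. -/
def IsCocommutative (C : DGCoalgebra k) : Prop :=
  ∀ x : C, twist C.toDGModule C.toDGModule (Coalgebra.comul (R := k) x) =
    Coalgebra.comul (R := k) x

/-- `C` is simply connected: `C₀ = k` (through the counit) and `C₁ = 0`. -/
def IsSimplyConnected (C : DGCoalgebra k) : Prop :=
  Function.Bijective (fun x : C.gr 0 => Coalgebra.counit (R := k) (x : C)) ∧ C.gr 1 = ⊥

/-- The chain map `id ⊗ ε : M ⊗ C ⟶ M ⊗ k ≅ M`. -/
noncomputable def counitHom (M : DGModule k) (C : DGCoalgebra k) :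
    Hom (M.tensor C.toDGModule) M where
  lin := (TensorProduct.rid k M).toLinearMap ∘ₗ (Coalgebra.counit (R := k) (A := C)).lTensor M
  map_mem n t ht := by
    refine (tensorGr_le (S := (M.gr n).comap ((TensorProduct.rid k M).toLinearMap ∘ₗ
      (Coalgebra.counit (R := k) (A := C)).lTensor M)) ?_ ht :)
    intro i j x c hij hx hc
    have : ((TensorProduct.rid k M).toLinearMap ∘ₗ (Coalgebra.counit (R := k) (A := C)).lTensor M)
      (x ⊗ₜ c) = Coalgebra.counit (R := k) c • x := by simp
    rw [Submodule.mem_comap, this]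
    rcases j with _ | j
    · obtain rfl : i = n := by omega
      exact Submodule.smul_mem _ _ hx
    · rw [C.counit_of_mem j c hc, zero_smul]; exact zero_mem _
  map_d t := by
    induction t using TensorProduct.induction_on with
    | zero => simp
    | tmul x c => simp [C.counit_d]
    | add a b ha hb => rw [map_add, map_add, ha, hb, map_add, map_add]

theorem counitHom_tmul (M : DGModule k) (C : DGCoalgebra k) (x : M) (c : C) :
    (counitHom M C).lin (x ⊗ₜ c) = Coalgebra.counit (R := k) c • x := by simp [counitHom]

end DGCoalgebra

/-- A right dg-comodule over `C`: a chain complex with a coassociative and counital coaction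
`X ⟶ X ⊗ C` which is a chain map of degree zero. -/
structure DGComodule {k : Type u} [CommRing k] (C : DGCoalgebra k) extends DGModule k where
  /-- the coaction -/
  coact : carrier →ₗ[k] carrier ⊗[k] C
  coact_mem : ∀ n x, x ∈ gr n → coact x ∈ DGModule.tensorGr toDGModule C.toDGModule n
  coact_d : ∀ x, coact (d x) = (DGModule.tensor toDGModule C.toDGModule).d (coact x)
  coassoc : (TensorProduct.assoc k carrier C C).toLinearMap ∘ₗ coact.rTensor C ∘ₗ coact =
    (Coalgebra.comul (R := k) (A := C)).lTensor carrier ∘ₗ coact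
  counit_coact : (Coalgebra.counit (R := k) (A := C)).lTensor carrier ∘ₗ coact =
    (TensorProduct.mk k carrier k).flip 1

namespace DGComodule

variable {C : DGCoalgebra k}

instance : CoeSort (DGComodule C) (Type u) := ⟨fun X => X.toDGModule.carrier⟩

/-- The coaction as a chain map. -/
noncomputable def coactHom (X : DGComodule C) :
    DGModule.Hom X.toDGModule (X.toDGModule.tensor C.toDGModule) :=
  ⟨X.coact, X.coact_mem, X.coact_d⟩

/-- The left coaction `Y ⟶ Y ⊗ C ≅ C ⊗ Y` (a left comodule structure when `C` is
cocommutative). -/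
noncomputable def leftCoactHom (Y : DGComodule C) :
    DGModule.Hom Y.toDGModule (C.toDGModule.tensor Y.toDGModule) :=
  (twistHom Y.toDGModule C.toDGModule).comp Y.coactHom

/-- Maps of `C`-comodules: chain maps compatible with the coactions. -/
structure Hom (X Y : DGComodule C) extends DGModule.Hom X.toDGModule Y.toDGModule where
  map_coact : ∀ x, lin.rTensor C (X.coact x) = Y.coact (lin x)

/-- The cotensor product `X □_C Y`: the equalizer in chain complexes of the two maps
`X ⊗ Y ⟶ X ⊗ (C ⊗ Y)` given by the coactions of `X` and `Y`. -/
noncomputable abbrev cotensor (X Y : DGComodule C) : DGModule k :=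
  DGModule.equalizer
    ((assocHom X.toDGModule C.toDGModule Y.toDGModule).comp
      (X.coactHom.tensor (DGModule.Hom.id Y.toDGModule)))
    ((DGModule.Hom.id X.toDGModule).tensor Y.leftCoactHom)

theorem Hom.map_leftCoact {Y Y' : DGComodule C} (f : Hom Y Y') :
    TensorProduct.map LinearMap.id f.lin ∘ₗ Y.leftCoactHom.lin = Y'.leftCoactHom.lin ∘ₗ f.lin := by
  refine LinearMap.ext fun y => ?_
  have h1 := LinearMap.congr_fun (twist_natural f.toHom (DGModule.Hom.id C.toDGModule)) (Y.coact y)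
  have h2 := f.map_coact y
  change TensorProduct.map LinearMap.id f.lin (twist _ _ (Y.coact y)) = twist _ _ (Y'.coact (f.lin y))
  rw [← h2]
  exact h1.symm

/-- The map `X □_C Y ⟶ X □_C Y'` induced by a map of comodules `Y ⟶ Y'`. -/
noncomputable def cotensorMap (X : DGComodule C) {Y Y' : DGComodule C} (f : Hom Y Y') :
    DGModule.Hom (X.cotensor Y) (X.cotensor Y') where
  lin := (TensorProduct.map (LinearMap.id (R := k) (M := X)) f.lin).restrict (by
    intro w hw
    have hw' : (TensorProduct.assoc k X C Y) (TensorProduct.map X.coact LinearMap.id w) =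
      TensorProduct.map LinearMap.id Y.leftCoactHom.lin w := hw
    change (TensorProduct.assoc k X C Y') (TensorProduct.map X.coact LinearMap.id
      (TensorProduct.map LinearMap.id f.lin w)) =
      TensorProduct.map LinearMap.id Y'.leftCoactHom.lin (TensorProduct.map LinearMap.id f.lin w)
    have h1 : (TensorProduct.assoc k X C Y').toLinearMap ∘ₗ
        TensorProduct.map X.coact LinearMap.id ∘ₗ TensorProduct.map LinearMap.id f.lin =
        TensorProduct.map LinearMap.id (TensorProduct.map LinearMap.id f.lin) ∘ₗ
        (TensorProduct.assoc k X C Y).toLinearMap ∘ₗ TensorProduct.map X.coact LinearMap.id := by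
      refine TensorProduct.ext' fun x y => ?_
      simp only [LinearMap.comp_apply, TensorProduct.map_tmul, LinearMap.id_apply]
      induction X.coact x using TensorProduct.induction_on with
      | zero => simp
      | tmul a c => simp
      | add a b ha hb => simp only [TensorProduct.add_tmul, map_add, ha, hb]
    have h2 : TensorProduct.map LinearMap.id Y'.leftCoactHom.lin ∘ₗ
        TensorProduct.map (LinearMap.id (R := k) (M := X)) f.lin =
        TensorProduct.map LinearMap.id (TensorProduct.map LinearMap.id f.lin) ∘ₗ
        TensorProduct.map LinearMap.id Y.leftCoactHom.lin := by
      rw [← TensorProduct.map_comp, ← TensorProduct.map_comp, f.map_leftCoact]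
    have e1 := LinearMap.congr_fun h1 w
    have e2 := LinearMap.congr_fun h2 w
    simp only [LinearMap.comp_apply, LinearEquiv.coe_coe] at e1 e2
    rw [e1, e2, hw'])
  map_mem n w hw := ((DGModule.Hom.id X.toDGModule).tensor f.toHom).map_mem n w.1 hw
  map_d w := Subtype.ext (((DGModule.Hom.id X.toDGModule).tensor f.toHom).map_d w.1)

/-! ### Coflat, fibrant and injective comodules -/

/-- `X` is coflat: the functor `X □_C -` is exact (exactness is tested on chain complexes). -/
def IsCoflat (X : DGComodule C) : Prop :=
  ∀ (Y₁ Y₂ Y₃ : DGComodule C) (f : Hom Y₁ Y₂) (g : Hom Y₂ Y₃),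
    Function.Injective f.lin → Function.Exact f.lin g.lin → Function.Surjective g.lin →
      Function.Injective (X.cotensorMap f).lin ∧
      Function.Exact (X.cotensorMap f).lin (X.cotensorMap g).lin ∧
      Function.Surjective (X.cotensorMap g).lin

/-- `X` is fibrant in the model structure on `C`-comodules whose weak equivalences are the
quasi-isomorphisms and whose cofibrations are the monomorphisms: the map `X ⟶ 0` has the right
lifting property with respect to the monomorphisms which are quasi-isomorphisms. -/
def IsFibrant (X : DGComodule C) : Prop :=
  ∀ (A B : DGComodule C) (i : Hom A B), Function.Injective i.lin → i.toHom.IsQuasiIso →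
    ∀ f : Hom A X, ∃ g : Hom B X, ∀ a, g.lin (i.lin a) = f.lin a

/-- `X` is an injective object of the category of `C`-comodules. -/
def IsInjective (X : DGComodule C) : Prop :=
  ∀ (A B : DGComodule C) (i : Hom A B), Function.Injective i.lin →
    ∀ f : Hom A X, ∃ g : Hom B X, ∀ a, g.lin (i.lin a) = f.lin a

end DGComodule

end Tensor
section Kunneth

variable {k : Type u} [CommRing k]

namespace DGModule

variable {M N P Q : DGModule k}

/-! ### The Künneth isomorphism -/

theorem tmul_mem_ker (z : LinearMap.ker M.d) (w : LinearMap.ker N.d) :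
    (z.1 ⊗ₜ[k] w.1 : M ⊗[k] N) ∈ LinearMap.ker (M.tensor N).d := by
  have hz : M.d z.1 = 0 := z.2
  have hw : N.d w.1 = 0 := w.2
  simp [hz, hw]

/-- The exterior product of cycles, `(z, w) ↦ [z ⊗ w]`. -/
noncomputable def cyclesProduct (M N : DGModule k) :
    LinearMap.ker M.d →ₗ[k] LinearMap.ker N.d →ₗ[k] (M.tensor N).homology :=
  LinearMap.mk₂ k (fun z w => (M.tensor N).cls ⟨z.1 ⊗ₜ[k] w.1, tmul_mem_ker z w⟩)
    (fun z z' w => by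
      rw [← map_add]; congr 1; exact Subtype.ext (TensorProduct.add_tmul _ _ _))
    (fun c z w => by
      rw [← map_smul]; congr 1)
    (fun z w w' => by
      rw [← map_add]; congr 1; exact Subtype.ext (TensorProduct.tmul_add _ _ _))
    (fun c z w => by
      rw [← map_smul]; congr 1; exact Subtype.ext (TensorProduct.tmul_smul _ _ _))

theorem cyclesProduct_left (z : LinearMap.ker M.d) (hz : ∃ y, M.d y = z.1)
    (w : LinearMap.ker N.d) : cyclesProduct M N z w = 0 := by
  obtain ⟨y, hy⟩ := hz
  refine (cls_eq_zero_iff (M := M.tensor N) _).2 ⟨y ⊗ₜ[k] w.1, ?_⟩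
  have hw : N.d w.1 = 0 := w.2
  simp [hw, hy]

theorem cyclesProduct_right (z : LinearMap.ker M.d) (w : LinearMap.ker N.d)
    (hw : ∃ y, N.d y = w.1) : cyclesProduct M N z w = 0 := by
  obtain ⟨y, hy⟩ := hw
  refine (cls_eq_zero_iff (M := M.tensor N) _).2 ⟨M.sgn z.1 ⊗ₜ[k] y, ?_⟩
  have hz : M.d z.1 = 0 := z.2
  have h1 : M.d (M.sgn z.1) = 0 := by
    rw [← neg_eq_zero, ← sgn_d, hz, map_zero]
  have h2 : M.sgn (M.sgn z.1) = z.1 := by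
    have : M.sgn ∘ₗ M.sgn = LinearMap.id := by
      refine lin_ext fun n x hx => ?_
      simp [sgn_of_mem hx, smul_smul, ← pow_add, ← two_mul]
    exact LinearMap.congr_fun this z.1
  simp [h1, h2, hy]

/-- The Künneth map `H_*(M) ⊗ H_*(N) ⟶ H_*(M ⊗ N)`, `[z] ⊗ [w] ↦ [z ⊗ w]`. -/
noncomputable def kunnethMap (M N : DGModule k) :
    M.homology ⊗[k] N.homology →ₗ[k] (M.tensor N).homology :=
  TensorProduct.lift
    (homologyLift (homologyLift (cyclesProduct M N)
        (fun z hz => LinearMap.ext fun w => cyclesProduct_left z hz w)).flip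
      (fun w hw => LinearMap.ext fun x => by
        obtain ⟨z, rfl⟩ := M.cls_surjective x
        exact cyclesProduct_right z w hw)).flip

theorem kunnethMap_cls (z : LinearMap.ker M.d) (w : LinearMap.ker N.d) :
    kunnethMap M N (M.cls z ⊗ₜ N.cls w) =
      (M.tensor N).cls ⟨z.1 ⊗ₜ[k] w.1, tmul_mem_ker z w⟩ := rfl

theorem kunnethMap_mem (n : ℕ) (t : M.homology ⊗[k] N.homology)
    (ht : t ∈ tensorGr M.homology N.homology n) :
    kunnethMap M N t ∈ (M.tensor N).homology.gr n := by
  refine (tensorGr_le (S := ((M.tensor N).homology.gr n).comap (kunnethMap M N)) ?_ ht :)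
  intro i j x y h hx hy
  obtain ⟨z, hz, rfl⟩ := exists_cls_of_mem hx
  obtain ⟨w, hw, rfl⟩ := exists_cls_of_mem hy
  rw [Submodule.mem_comap, kunnethMap_cls]
  exact cls_mem (M := M.tensor N) (tmul_mem_tensorGr hz hw h)

theorem homology_tensor_ext {V : Type u} [AddCommGroup V] [Module k V]
    {f g : M.homology ⊗[k] N.homology →ₗ[k] V}
    (h : ∀ z w, f (M.cls z ⊗ₜ N.cls w) = g (M.cls z ⊗ₜ N.cls w)) : f = g := by
  refine TensorProduct.ext' fun x y => ?_
  obtain ⟨z, rfl⟩ := M.cls_surjective x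
  obtain ⟨w, rfl⟩ := N.cls_surjective y
  exact h z w

theorem kunnethMap_natural (f : Hom M N) (g : Hom P Q) :
    kunnethMap N Q ∘ₗ TensorProduct.map f.homologyMap.lin g.homologyMap.lin =
      (f.tensor g).homologyMap.lin ∘ₗ kunnethMap M P :=
  homology_tensor_ext fun _ _ => rfl

theorem kunnethMap_assoc (M N P : DGModule k) :
    (assocHom M N P).homologyMap.lin ∘ₗ kunnethMap (M.tensor N) P ∘ₗ
        (kunnethMap M N).rTensor P.homology =
      kunnethMap M (N.tensor P) ∘ₗ (kunnethMap N P).lTensor M.homology ∘ₗ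
        (TensorProduct.assoc k M.homology N.homology P.homology).toLinearMap := by
  refine TensorProduct.ext_threefold fun x y z => ?_
  obtain ⟨x, rfl⟩ := M.cls_surjective x
  obtain ⟨y, rfl⟩ := N.cls_surjective y
  obtain ⟨z, rfl⟩ := P.cls_surjective z
  rfl

theorem tensor_homology_d (t : M.homology ⊗[k] N.homology) :
    (M.homology.tensor N.homology).d t = 0 := by
  induction t using TensorProduct.induction_on with
  | zero => simp
  | tmul x y => simp [homology_d]
  | add a b ha hb => rw [map_add, ha, hb, add_zero]

section Semisimple

variable [IsSemisimpleRing k]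

theorem exists_homotopy (M : DGModule k) : ∃ h : M →ₗ[k] M,
    (∀ x, M.d (h (M.d x)) = M.d x) ∧ (∀ x, M.sgn (h x) = - h (M.sgn x)) := by
  obtain ⟨s, hs⟩ := IsSemisimpleModule.lifting_property M.d.rangeRestrict
    M.d.surjective_rangeRestrict LinearMap.id
  obtain ⟨h0, hh0⟩ := IsSemisimpleModule.extension_property (LinearMap.range M.d).subtype
    (Submodule.subtype_injective _) s
  have key : ∀ x, M.d (h0 (M.d x)) = M.d x := by
    intro x
    have e1 : h0 (M.d x) = s ⟨M.d x, ⟨x, rfl⟩⟩ := LinearMap.congr_fun hh0 ⟨M.d x, ⟨x, rfl⟩⟩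
    have e2 := congrArg Subtype.val (LinearMap.congr_fun hs ⟨M.d x, ⟨x, rfl⟩⟩)
    rw [e1]
    exact e2
  refine ⟨M.glue fun n => M.proj (n + 1) ∘ₗ h0, fun x => ?_, fun x => ?_⟩
  · have : M.d ∘ₗ (M.glue fun n => M.proj (n + 1) ∘ₗ h0) ∘ₗ M.d = M.d := by
      refine lin_ext fun n x hx => ?_
      rcases n with _ | n
      · simp [M.d_zero x hx]
      · have hd := M.d_mem n x hx
        simp only [LinearMap.comp_apply, glue_of_mem _ hd, d_proj_succ, key, proj_same hd]
    exact LinearMap.congr_fun this x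
  · have : M.sgn ∘ₗ (M.glue fun n => M.proj (n + 1) ∘ₗ h0) =
        - ((M.glue fun n => M.proj (n + 1) ∘ₗ h0) ∘ₗ M.sgn) := by
      refine lin_ext fun n x hx => ?_
      simp [sgn_of_mem hx, glue_of_mem _ hx, sgn_of_mem (proj_mem (n + 1) (h0 x)), pow_succ]
    exact LinearMap.congr_fun this x

theorem kunnethMap_bijective (M N : DGModule k) : Function.Bijective (kunnethMap M N) := by
  obtain ⟨h, hd, hs⟩ := exists_homotopy M
  obtain ⟨h', hd', -⟩ := exists_homotopy N
  -- the retractions `1 - dh - hd` onto complements of the boundaries in the cycles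
  let e : M →ₗ[k] LinearMap.ker M.d :=
    (LinearMap.id - M.d ∘ₗ h - h ∘ₗ M.d).codRestrict _ (fun x => by
      simp [M.d_d, hd])
  let e' : N →ₗ[k] LinearMap.ker N.d :=
    (LinearMap.id - N.d ∘ₗ h' - h' ∘ₗ N.d).codRestrict _ (fun x => by
      simp [N.d_d, hd'])
  have he : ∀ x, (e x).1 = x - M.d (h x) - h (M.d x) := fun _ => rfl
  have he' : ∀ x, (e' x).1 = x - N.d (h' x) - h' (N.d x) := fun _ => rfl
  have hcls : ∀ z : LinearMap.ker M.d, M.cls (e z.1) = M.cls z := by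
    intro z
    rw [← sub_eq_zero, ← map_sub, cls_eq_zero_iff]
    refine ⟨- h z.1, ?_⟩
    have hz : M.d z.1 = 0 := z.2
    rw [Submodule.coe_sub, he, hz, map_zero, map_neg]
    abel
  have hcls' : ∀ z : LinearMap.ker N.d, N.cls (e' z.1) = N.cls z := by
    intro z
    rw [← sub_eq_zero, ← map_sub, cls_eq_zero_iff]
    refine ⟨- h' z.1, ?_⟩
    have hz : N.d z.1 = 0 := z.2
    rw [Submodule.coe_sub, he', hz, map_zero, map_neg]
    abel
  have hed0 : ∀ x, e (M.d x) = 0 := fun x => Subtype.ext (by simp [he, M.d_d, hd])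
  have hed0' : ∀ x, e' (N.d x) = 0 := fun x => Subtype.ext (by simp [he', N.d_d, hd'])
  constructor
  · let l : (M.tensor N).homology →ₗ[k] M.homology ⊗[k] N.homology :=
      homologyLift (TensorProduct.map (M.cls ∘ₗ e) (N.cls ∘ₗ e') ∘ₗ
          (LinearMap.ker (M.tensor N).d).subtype) (by
        rintro z ⟨y, hy⟩
        rw [LinearMap.comp_apply, Submodule.subtype_apply, ← hy]
        have : TensorProduct.map (M.cls ∘ₗ e) (N.cls ∘ₗ e') ∘ₗ (M.tensor N).d = 0 := by
          refine TensorProduct.ext' fun x y => ?_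
          simp [hed0, hed0']
        exact LinearMap.congr_fun this y)
    have hl : l ∘ₗ kunnethMap M N = LinearMap.id := by
      refine homology_tensor_ext fun z w => ?_
      change M.cls (e z.1) ⊗ₜ[k] N.cls (e' w.1) = M.cls z ⊗ₜ[k] N.cls w
      rw [hcls, hcls']
    exact Function.LeftInverse.injective (g := l) (LinearMap.congr_fun hl)
  · intro c
    obtain ⟨w, rfl⟩ := (M.tensor N).cls_surjective c
    let a : M ⊗[k] N →ₗ[k] M ⊗[k] N :=
      TensorProduct.map h LinearMap.id +
        TensorProduct.map (M.sgn ∘ₗ (LinearMap.ker M.d).subtype ∘ₗ e) h'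
    have hse : ∀ x, M.sgn (e x).1 = (e (M.sgn x)).1 := by
      intro x
      have e1 : M.sgn (M.d (h x)) = M.d (h (M.sgn x)) := by rw [sgn_d, hs, map_neg, neg_neg]
      have e2 : M.sgn (h (M.d x)) = h (M.d (M.sgn x)) := by rw [hs, sgn_d, map_neg, neg_neg]
      rw [he, he, map_sub, map_sub, e1, e2]
    have hss : ∀ x, M.sgn (M.sgn x) = x := by
      have : M.sgn ∘ₗ M.sgn = LinearMap.id := by
        refine lin_ext fun n x hx => ?_
        simp [sgn_of_mem hx, smul_smul, ← pow_add, ← two_mul]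
      exact LinearMap.congr_fun this
    have key : ∀ t, (M.tensor N).d (a t) + a ((M.tensor N).d t) =
        t - TensorProduct.map ((LinearMap.ker M.d).subtype ∘ₗ e)
          ((LinearMap.ker N.d).subtype ∘ₗ e') t := by
      have : (M.tensor N).d ∘ₗ a + a ∘ₗ (M.tensor N).d =
          LinearMap.id - TensorProduct.map ((LinearMap.ker M.d).subtype ∘ₗ e)
          ((LinearMap.ker N.d).subtype ∘ₗ e') := by
        refine TensorProduct.ext' fun x y => ?_
        have hde : ∀ x, M.d (e x).1 = 0 := fun x => (e x).2
        simp only [a, LinearMap.add_apply, LinearMap.comp_apply, TensorProduct.map_tmul,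
          LinearMap.id_apply, map_add, Submodule.subtype_apply, LinearMap.sub_apply, hde, hed0,
          hse, hss, hs, he']
        simp only [ZeroMemClass.coe_zero, map_zero, TensorProduct.zero_tmul,
          TensorProduct.neg_tmul, TensorProduct.tmul_sub, he, TensorProduct.sub_tmul]
        abel
      exact LinearMap.congr_fun this
    refine ⟨TensorProduct.map (M.cls ∘ₗ e) (N.cls ∘ₗ e') w.1, ?_⟩
    have hgen : ∀ t : M ⊗[k] N, ∃ hz : TensorProduct.map ((LinearMap.ker M.d).subtype ∘ₗ e)
          ((LinearMap.ker N.d).subtype ∘ₗ e') t ∈ LinearMap.ker (M.tensor N).d,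
        kunnethMap M N (TensorProduct.map (M.cls ∘ₗ e) (N.cls ∘ₗ e') t) =
          (M.tensor N).cls ⟨_, hz⟩ := by
      intro t
      induction t using TensorProduct.induction_on with
      | zero => exact ⟨by simp, by simp only [map_zero]; exact (map_zero _).symm⟩
      | tmul x y => exact ⟨tmul_mem_ker (e x) (e' y), rfl⟩
      | add s t ihs iht =>
        obtain ⟨hs1, hs2⟩ := ihs
        obtain ⟨ht1, ht2⟩ := iht
        refine ⟨by rw [map_add]; exact add_mem hs1 ht1, ?_⟩
        rw [map_add, map_add, hs2, ht2, ← map_add]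
        congr 1
        exact Subtype.ext (map_add _ _ _).symm
    obtain ⟨hz, hk⟩ := hgen w.1
    rw [hk, ← sub_eq_zero, ← map_sub, cls_eq_zero_iff]
    refine ⟨- a w.1, ?_⟩
    have hw : (M.tensor N).d w.1 = 0 := w.2
    have := key w.1
    rw [hw, map_zero, add_zero] at this
    rw [map_neg, this, Submodule.coe_sub]
    abel

/-- The Künneth isomorphism `H_*(M) ⊗ H_*(N) ≅ H_*(M ⊗ N)`, `[z] ⊗ [w] ↦ [z ⊗ w]`. -/
noncomputable def kunneth (M N : DGModule k) :
    M.homology ⊗[k] N.homology ≃ₗ[k] (M.tensor N).homology :=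
  LinearEquiv.ofBijective (kunnethMap M N) (kunnethMap_bijective M N)

end Semisimple

end DGModule

end Kunneth

section HomologyCoalgebra

variable {k : Type u} [CommRing k] [IsSemisimpleRing k]

open DGModule

/-! ### The homology coalgebra and the homology comodules -/

namespace DGModule

variable {M N P : DGModule k}

theorem kunneth_symm_mem (n : ℕ) (x : (M.tensor N).homology) (hx : x ∈ (M.tensor N).homology.gr n) :
    (kunneth M N).symm x ∈ tensorGr M.homology N.homology n := by
  obtain ⟨t, rfl⟩ := (kunneth M N).surjective x
  rw [LinearEquiv.symm_apply_apply]
  let κ : Hom (M.homology.tensor N.homology) (M.tensor N).homology :=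
    ⟨kunnethMap M N, kunnethMap_mem, fun t => by
      rw [homology_d, tensor_homology_d, map_zero]⟩
  have h1 : κ.lin ((M.homology.tensor N.homology).proj n t) = κ.lin t := by
    rw [κ.map_proj]; exact proj_same hx
  have h2 := (kunnethMap_bijective M N).1 h1
  have h3 := proj_mem (M := M.homology.tensor N.homology) n t
  rw [h2] at h3
  exact h3

theorem kunnethMap_kunneth_symm (x : (M.tensor N).homology) :
    kunnethMap M N ((kunneth M N).symm x) = x := (kunneth M N).apply_symm_apply x

/-- The map `H_*(M) ⟶ H_*(N) ⊗ H_*(P)` induced by a chain map `M ⟶ N ⊗ P`, through the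
Künneth isomorphism. -/
noncomputable def homologyCoaction (f : Hom M (N.tensor P)) :
    M.homology →ₗ[k] N.homology ⊗[k] P.homology :=
  (kunneth N P).symm.toLinearMap ∘ₗ f.homologyMap.lin

theorem kunnethMap_homologyCoaction (f : Hom M (N.tensor P)) (x : M.homology) :
    kunnethMap N P (homologyCoaction f x) = f.homologyMap.lin x := kunnethMap_kunneth_symm _

theorem homologyCoaction_mem (f : Hom M (N.tensor P)) (n : ℕ) (x : M.homology)
    (hx : x ∈ M.homology.gr n) : homologyCoaction f x ∈ tensorGr N.homology P.homology n :=
  kunneth_symm_mem n _ (f.homologyMap.map_mem n x hx)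

/-- Coassociativity passes to homology. -/
theorem homologyCoaction_coassoc (f : Hom M (M.tensor N)) (g : Hom N (N.tensor N))
    (h : (TensorProduct.assoc k M N N).toLinearMap ∘ₗ f.lin.rTensor N ∘ₗ f.lin =
      g.lin.lTensor M ∘ₗ f.lin) :
    (TensorProduct.assoc k M.homology N.homology N.homology).toLinearMap ∘ₗ
        (homologyCoaction f).rTensor N.homology ∘ₗ homologyCoaction f =
      (homologyCoaction g).lTensor M.homology ∘ₗ homologyCoaction f := by
  have hinj : Function.Injective
      (kunnethMap M (N.tensor N) ∘ₗ (kunnethMap N N).lTensor M.homology) := by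
    refine (kunnethMap_bijective M (N.tensor N)).1.comp ?_
    exact (TensorProduct.congr (LinearEquiv.refl k M.homology) (kunneth N N)).injective
  have hf : kunnethMap M N ∘ₗ homologyCoaction f = f.homologyMap.lin :=
    LinearMap.ext (kunnethMap_homologyCoaction f)
  have hg : kunnethMap N N ∘ₗ homologyCoaction g = g.homologyMap.lin :=
    LinearMap.ext (kunnethMap_homologyCoaction g)
  refine LinearMap.ext fun x => hinj ?_
  have nat1 := LinearMap.congr_fun (kunnethMap_natural f (Hom.id N)) (homologyCoaction f x)
  have nat2 := LinearMap.congr_fun (kunnethMap_natural (Hom.id M) g) (homologyCoaction f x)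
  have idM : (Hom.id M).homologyMap.lin = LinearMap.id := by
    refine LinearMap.ext fun y => ?_
    obtain ⟨z, rfl⟩ := M.cls_surjective y
    rfl
  have idN : (Hom.id N).homologyMap.lin = LinearMap.id := by
    refine LinearMap.ext fun y => ?_
    obtain ⟨z, rfl⟩ := N.cls_surjective y
    rfl
  rw [idN] at nat1
  rw [idM] at nat2
  simp only [LinearMap.comp_apply] at nat1 nat2 ⊢
  have as := LinearMap.congr_fun (kunnethMap_assoc M N N)
    ((homologyCoaction f).rTensor N.homology (homologyCoaction f x))
  simp only [LinearMap.comp_apply] at as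
  rw [← as, ← LinearMap.comp_apply (LinearMap.rTensor _ _), ← LinearMap.rTensor_comp, hf,
    ← LinearMap.comp_apply (LinearMap.lTensor _ _), ← LinearMap.lTensor_comp, hg]
  have e1 : f.homologyMap.lin.rTensor N.homology =
    TensorProduct.map f.homologyMap.lin LinearMap.id := rfl
  have e2 : g.homologyMap.lin.lTensor M.homology =
    TensorProduct.map LinearMap.id g.homologyMap.lin := rfl
  rw [e1, e2, nat1, nat2, kunnethMap_homologyCoaction]
  obtain ⟨z, rfl⟩ := M.cls_surjective x
  refine congrArg (M.tensor (N.tensor N)).cls (Subtype.ext ?_)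
  exact LinearMap.congr_fun h z.1

end DGModule

/-- The counit of the homology coalgebra, `[z] ↦ ε z`. -/
noncomputable def DGCoalgebra.homologyCounit (C : DGCoalgebra k) :
    C.toDGModule.homology →ₗ[k] k :=
  homologyLift ((Coalgebra.counit (R := k) (A := C)) ∘ₗ (LinearMap.ker C.d).subtype) (by
    rintro z ⟨y, hy⟩
    rw [LinearMap.comp_apply, Submodule.subtype_apply, ← hy, C.counit_d])

/-- Counitality passes to homology (right counit). -/
theorem homologyCoaction_counit {M : DGModule k} (C : DGCoalgebra k)
    (f : DGModule.Hom M (M.tensor C.toDGModule))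
    (h : (Coalgebra.counit (R := k) (A := C)).lTensor M ∘ₗ f.lin =
      (TensorProduct.mk k M k).flip 1) :
    C.homologyCounit.lTensor M.homology ∘ₗ homologyCoaction f =
      (TensorProduct.mk k M.homology k).flip 1 := by
  have hR : (TensorProduct.rid k M.homology).toLinearMap ∘ₗ C.homologyCounit.lTensor M.homology =
      (DGCoalgebra.counitHom M C).homologyMap.lin ∘ₗ kunnethMap M C.toDGModule := by
    refine homology_tensor_ext fun z w => ?_
    rw [LinearMap.comp_apply, LinearMap.comp_apply, kunnethMap_cls, LinearMap.lTensor_tmul,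
      LinearEquiv.coe_coe, TensorProduct.rid_tmul, Hom.homologyMap_cls]
    change Coalgebra.counit (R := k) w.1 • M.cls z = _
    rw [← map_smul]
    exact congrArg M.cls (Subtype.ext (DGCoalgebra.counitHom_tmul M C z.1 w.1).symm)
  refine LinearMap.ext fun x => (TensorProduct.rid k M.homology).injective ?_
  have h1 := LinearMap.congr_fun hR (homologyCoaction f x)
  simp only [LinearMap.comp_apply, LinearEquiv.coe_coe] at h1
  rw [LinearMap.comp_apply, h1, kunnethMap_homologyCoaction]
  obtain ⟨z, rfl⟩ := M.cls_surjective x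
  simp only [LinearMap.flip_apply, TensorProduct.mk_apply, TensorProduct.rid_tmul, one_smul]
  refine congrArg M.cls (Subtype.ext ?_)
  have h2 := congrArg (TensorProduct.rid k M) (LinearMap.congr_fun h z.1)
  exact h2.trans (by simp)

/-- Counitality passes to homology (left counit). -/
theorem homologyCoaction_counit_left (C : DGCoalgebra k) :
    C.homologyCounit.rTensor C.toDGModule.homology ∘ₗ homologyCoaction C.comulHom =
      TensorProduct.mk k k C.toDGModule.homology 1 := by
  let r : C ⊗[k] C →ₗ[k] C :=
    (TensorProduct.lid k C).toLinearMap ∘ₗ (Coalgebra.counit (R := k) (A := C)).rTensor C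
  have hr : ∀ c x, r (c ⊗ₜ x) = Coalgebra.counit (R := k) c • x := fun x c => by simp [r]
  let R : DGModule.Hom (C.toDGModule.tensor C.toDGModule) C.toDGModule :=
    { lin := r
      map_mem := fun n t ht => by
        refine (tensorGr_le (S := (C.gr n).comap r) ?_ ht :)
        intro i j c x hij hc hx
        rw [Submodule.mem_comap, hr]
        rcases i with _ | i
        · obtain rfl : j = n := by omega
          exact Submodule.smul_mem _ _ hx
        · rw [C.counit_of_mem i c hc, zero_smul]; exact zero_mem _
      map_d := fun t => by
        have : r ∘ₗ (C.toDGModule.tensor C.toDGModule).d = C.d ∘ₗ r := by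
          refine tensor_lin_ext fun i j c hc x hx => ?_
          rcases i with _ | i
          · simp [hr, C.counit_d, sgn_of_mem hc]
          · simp [hr, C.counit_d, sgn_of_mem hc, C.counit_of_mem i c hc]
        exact LinearMap.congr_fun this t }
  have hR : (TensorProduct.lid k C.toDGModule.homology).toLinearMap ∘ₗ
      C.homologyCounit.rTensor C.toDGModule.homology =
      R.homologyMap.lin ∘ₗ kunnethMap C.toDGModule C.toDGModule := by
    refine homology_tensor_ext fun w z => ?_
    rw [LinearMap.comp_apply, LinearMap.comp_apply, kunnethMap_cls, LinearMap.rTensor_tmul,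
      LinearEquiv.coe_coe, TensorProduct.lid_tmul, Hom.homologyMap_cls]
    change Coalgebra.counit (R := k) w.1 • C.toDGModule.cls z = _
    rw [← map_smul]
    exact congrArg C.toDGModule.cls (Subtype.ext (hr w.1 z.1).symm)
  refine LinearMap.ext fun x => (TensorProduct.lid k C.toDGModule.homology).injective ?_
  have h1 := LinearMap.congr_fun hR (homologyCoaction C.comulHom x)
  simp only [LinearMap.comp_apply, LinearEquiv.coe_coe] at h1
  rw [LinearMap.comp_apply, h1, kunnethMap_homologyCoaction]
  obtain ⟨z, rfl⟩ := C.toDGModule.cls_surjective x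
  simp only [TensorProduct.mk_apply, TensorProduct.lid_tmul, one_smul]
  refine congrArg C.toDGModule.cls (Subtype.ext ?_)
  have h2 := congrArg (TensorProduct.lid k C)
    (LinearMap.congr_fun (Coalgebra.rTensor_counit_comp_comul (R := k) (A := C)) z.1)
  exact h2.trans (by simp)

/-- The dg-coalgebra `H_*(C)` (with zero differential): its comultiplication is
`H_*(C) ⟶ H_*(C ⊗ C) ≅ H_*(C) ⊗ H_*(C)`. -/
noncomputable abbrev DGCoalgebra.homology (C : DGCoalgebra k) : DGCoalgebra k where
  toDGModule := C.toDGModule.homology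
  coalgebra :=
    { comul := homologyCoaction C.comulHom
      counit := C.homologyCounit
      coassoc := homologyCoaction_coassoc C.comulHom C.comulHom Coalgebra.coassoc
      rTensor_counit_comp_comul := homologyCoaction_counit_left C
      lTensor_counit_comp_comul :=
        homologyCoaction_counit C C.comulHom Coalgebra.lTensor_counit_comp_comul }
  comul_mem := homologyCoaction_mem C.comulHom
  comul_d x := by rw [homology_d, map_zero, tensor_homology_d]
  counit_of_mem n x hx := by
    obtain ⟨z, hz, rfl⟩ := exists_cls_of_mem hx
    exact C.counit_of_mem n z.1 hz
  counit_d x := by rw [homology_d, map_zero]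

/-- The `H_*(C)`-comodule `H_*(X)`: its coaction is
`H_*(X) ⟶ H_*(X ⊗ C) ≅ H_*(X) ⊗ H_*(C)`. -/
noncomputable def DGComodule.homology {C : DGCoalgebra k} (X : DGComodule C) :
    DGComodule C.homology where
  toDGModule := X.toDGModule.homology
  coact := homologyCoaction X.coactHom
  coact_mem := homologyCoaction_mem X.coactHom
  coact_d _ := (map_zero (homologyCoaction X.coactHom)).trans (tensor_homology_d _).symm
  coassoc := homologyCoaction_coassoc X.coactHom C.comulHom X.coassoc
  counit_coact := homologyCoaction_counit C X.coactHom X.counit_coact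

end HomologyCoalgebra
section Resolution

variable {k : Type u} [CommRing k]

open DGModule

/-! ### Cofree comodules and injective resolutions -/

/-- The complex `∏ₙ Dⁿ⁺¹(Nₙ)`: its degree `n` part is `Nₙ × Nₙ₋₁` and `d (x, y) = (y, 0)`. -/
noncomputable abbrev DGModule.disk (N : DGModule k) : DGModule k where
  carrier := N × N
  gr
    | 0 => (N.gr 0).prod ⊥
    | n + 1 => (N.gr (n + 1)).prod (N.gr n)
  isInternal := by
    refine isInternal_of_proj _
      (fun n => match n with
        | 0 => (N.proj 0).prodMap 0
        | n + 1 => (N.proj (n + 1)).prodMap (N.proj n)) ?_ ?_ ?_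
    · rintro (_ | n) ⟨x, y⟩ ⟨hx, hy⟩
      · exact Prod.ext (proj_same hx) ((Submodule.mem_bot k).1 hy).symm
      · exact Prod.ext (proj_same hx) (proj_same hy)
    · rintro (_ | m) (_ | n) ⟨x, y⟩ ⟨hx, hy⟩ hne
      · exact absurd rfl hne
      · exact Prod.ext (proj_ne hx hne) rfl
      · refine Prod.ext (proj_ne hx hne) ?_
        have : y = 0 := (Submodule.mem_bot k).1 hy
        subst this
        exact map_zero (N.proj m)
      · exact Prod.ext (proj_ne hx hne) (proj_ne hy (by omega))
    · rw [eq_top_iff]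
      rintro ⟨x, y⟩ -
      have hx : (x, (0 : N)) ∈ ⨆ n, (match n with
          | 0 => (N.gr 0).prod ⊥
          | n + 1 => (N.gr (n + 1)).prod (N.gr n) : Submodule k (N × N)) := by
        induction x using DGModule.induction with
        | mem n x hx =>
          refine Submodule.mem_iSup_of_mem n ?_
          rcases n with _ | n
          · exact ⟨hx, zero_mem _⟩
          · exact ⟨hx, zero_mem _⟩
        | zero => exact zero_mem _
        | add x x' hx hx' => simpa using add_mem hx hx'
      have hy : ((0 : N), y) ∈ ⨆ n, (match n with
          | 0 => (N.gr 0).prod ⊥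
          | n + 1 => (N.gr (n + 1)).prod (N.gr n) : Submodule k (N × N)) := by
        induction y using DGModule.induction with
        | mem n y hy => exact Submodule.mem_iSup_of_mem (n + 1) ⟨zero_mem _, hy⟩
        | zero => exact zero_mem _
        | add y y' hy hy' => simpa using add_mem hy hy'
      simpa using add_mem hx hy
  d := LinearMap.inl k N N ∘ₗ LinearMap.snd k N N
  d_mem := by
    rintro (_ | n) ⟨x, y⟩ ⟨hx, hy⟩
    · exact ⟨hy, zero_mem _⟩
    · exact ⟨hy, zero_mem _⟩
  d_zero := by
    rintro ⟨x, y⟩ ⟨hx, hy⟩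
    exact Prod.ext ((Submodule.mem_bot k).1 hy) rfl
  d_d _ := rfl

/-- A linear map `g : M ⟶ N` of degree zero gives the chain map `x ↦ (g x, g (d x))`. -/
noncomputable def DGModule.toDisk {M N : DGModule k} (g : M →ₗ[k] N)
    (hg : ∀ n x, x ∈ M.gr n → g x ∈ N.gr n) : DGModule.Hom M N.disk where
  lin := g.prod (g ∘ₗ M.d)
  map_mem := by
    rintro (_ | n) x hx
    · refine ⟨hg 0 x hx, ?_⟩
      change g (M.d x) ∈ (⊥ : Submodule k N)
      rw [M.d_zero x hx, map_zero]
      exact zero_mem _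
    · exact ⟨hg _ x hx, hg n _ (M.d_mem n x hx)⟩
  map_d x := by
    refine Prod.ext rfl ?_
    change g (M.d (M.d x)) = 0
    rw [M.d_d, map_zero]

namespace DGComodule

variable {C : DGCoalgebra k}

/-- The cofree comodule `M ⊗ C`. -/
noncomputable abbrev cofree (M : DGModule k) (C : DGCoalgebra k) : DGComodule C where
  toDGModule := M.tensor C.toDGModule
  coact := (TensorProduct.assoc k M C C).symm.toLinearMap ∘ₗ
    TensorProduct.map LinearMap.id (Coalgebra.comul (R := k) (A := C))
  coact_mem n x hx := ((assocInvHom M C.toDGModule C.toDGModule).comp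
    ((DGModule.Hom.id M).tensor C.comulHom)).map_mem n x hx
  coact_d x := ((assocInvHom M C.toDGModule C.toDGModule).comp
    ((DGModule.Hom.id M).tensor C.comulHom)).map_d x
  coassoc := by
    refine TensorProduct.ext' fun m c => ?_
    let φ : C ⊗[k] (C ⊗[k] C) →ₗ[k] (M ⊗[k] C) ⊗[k] (C ⊗[k] C) :=
      (TensorProduct.mk k M C m).rTensor (C ⊗[k] C)
    have h1 : ∀ s : C ⊗[k] C, ∀ b : C,
        TensorProduct.assoc k (M ⊗[k] C) C C
          ((TensorProduct.assoc k M C C).symm (m ⊗ₜ s) ⊗ₜ b) =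
        φ (TensorProduct.assoc k C C C (s ⊗ₜ b)) := by
      intro s b
      induction s using TensorProduct.induction_on with
      | zero => simp
      | tmul p q => simp [φ]
      | add s t hs ht =>
        simp only [TensorProduct.tmul_add, TensorProduct.add_tmul, map_add, hs, ht]
    have h2 : ∀ t : C ⊗[k] C,
        TensorProduct.assoc k (M ⊗[k] C) C C (LinearMap.rTensor C
          ((TensorProduct.assoc k M C C).symm.toLinearMap ∘ₗ
            TensorProduct.map LinearMap.id (Coalgebra.comul (R := k) (A := C)))
          ((TensorProduct.assoc k M C C).symm (m ⊗ₜ t))) =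
        φ (TensorProduct.assoc k C C C
          ((Coalgebra.comul (R := k) (A := C)).rTensor C t)) := by
      intro t
      induction t using TensorProduct.induction_on with
      | zero => simp
      | tmul a b => simp [h1]
      | add s t hs ht => simp only [TensorProduct.tmul_add, map_add, hs, ht]
    have h3 : ∀ t : C ⊗[k] C,
        LinearMap.lTensor (M ⊗[k] C) (Coalgebra.comul (R := k) (A := C))
          ((TensorProduct.assoc k M C C).symm (m ⊗ₜ t)) =
        φ ((Coalgebra.comul (R := k) (A := C)).lTensor C t) := by
      intro t
      induction t using TensorProduct.induction_on with
      | zero => simp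
      | tmul a b => simp [φ]
      | add s t hs ht => simp only [TensorProduct.tmul_add, map_add, hs, ht]
    have h4 := h2 (Coalgebra.comul (R := k) c)
    have h5 := h3 (Coalgebra.comul (R := k) c)
    rw [Coalgebra.coassoc_apply] at h4
    exact h4.trans h5.symm
  counit_coact := by
    refine TensorProduct.ext' fun m c => ?_
    have h3 : ∀ t : C ⊗[k] C,
        LinearMap.lTensor (M ⊗[k] C) (Coalgebra.counit (R := k) (A := C))
          ((TensorProduct.assoc k M C C).symm (m ⊗ₜ t)) =
        (TensorProduct.mk k M C m).rTensor k ((Coalgebra.counit (R := k) (A := C)).lTensor C t) := by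
      intro t
      induction t using TensorProduct.induction_on with
      | zero => simp
      | tmul a b => simp
      | add s t hs ht => simp only [TensorProduct.tmul_add, map_add, hs, ht]
    have h5 := h3 (Coalgebra.comul (R := k) c)
    rw [Coalgebra.lTensor_counit_comul] at h5
    exact h5

/-- The comodule map `X ⟶ M ⊗ C` which corresponds to a chain map `X ⟶ M`. -/
noncomputable def cofreeLift {M : DGModule k} {X : DGComodule C}
    (g : DGModule.Hom X.toDGModule M) : Hom X (cofree M C) where
  toHom := (g.tensor (DGModule.Hom.id C.toDGModule)).comp X.coactHom
  map_coact x := by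
    have h1 : ∀ t : X ⊗[k] C,
        (TensorProduct.assoc k M C C).symm
          (TensorProduct.map LinearMap.id (Coalgebra.comul (R := k) (A := C))
            (TensorProduct.map g.lin LinearMap.id t)) =
        (TensorProduct.map g.lin (LinearMap.id (R := k) (M := C))).rTensor C
          ((TensorProduct.assoc k X C C).symm
            ((Coalgebra.comul (R := k) (A := C)).lTensor X t)) := by
      intro t
      induction t using TensorProduct.induction_on with
      | zero => simp
      | tmul a b =>
        simp only [TensorProduct.map_tmul, LinearMap.id_apply, LinearMap.lTensor_tmul]
        induction Coalgebra.comul (R := k) b using TensorProduct.induction_on with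
        | zero => simp
        | tmul c d => simp
        | add s t hs ht => simp only [TensorProduct.tmul_add, map_add, hs, ht]
      | add s t hs ht => simp only [map_add, hs, ht]
    have h2 := LinearMap.congr_fun X.coassoc x
    simp only [LinearMap.comp_apply, LinearEquiv.coe_coe] at h2
    have h3 := h1 (X.coact x)
    rw [← h2, LinearEquiv.symm_apply_apply] at h3
    refine Eq.trans ?_ h3.symm
    change LinearMap.rTensor C (TensorProduct.map g.lin LinearMap.id ∘ₗ X.coact) (X.coact x) = _
    rw [LinearMap.rTensor_comp]
    rfl

theorem counitHom_coact (X : DGComodule C) (x : X) :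
    (DGCoalgebra.counitHom X.toDGModule C).lin (X.coact x) = x := by
  have h := congrArg (TensorProduct.rid k X) (LinearMap.congr_fun X.counit_coact x)
  exact h.trans (by simp)

theorem counitHom_cofreeLift {M : DGModule k} {X : DGComodule C}
    (g : DGModule.Hom X.toDGModule M) (x : X) :
    (DGCoalgebra.counitHom M C).lin ((cofreeLift g).lin x) = g.lin x := by
  have h : ∀ t : X ⊗[k] C, (DGCoalgebra.counitHom M C).lin
      (TensorProduct.map g.lin LinearMap.id t) =
        g.lin ((DGCoalgebra.counitHom X.toDGModule C).lin t) := by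
    intro t
    induction t using TensorProduct.induction_on with
    | zero => simp
    | tmul a b =>
      rw [TensorProduct.map_tmul, LinearMap.id_apply]
      exact (DGCoalgebra.counitHom_tmul M C _ b).trans
        ((map_smul _ _ _).symm.trans
          (congrArg g.lin (DGCoalgebra.counitHom_tmul X.toDGModule C a b).symm))
    | add s t hs ht => simp only [map_add, hs, ht]
  refine (h (X.coact x)).trans ?_
  rw [counitHom_coact]

/-- A comodule map to a cofree comodule is determined by its composition with `id ⊗ ε`. -/
theorem map_counitHom_coact {M : DGModule k} {X : DGComodule C} (f : Hom X (cofree M C)) (x : X) :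
    TensorProduct.map ((DGCoalgebra.counitHom M C).lin ∘ₗ f.lin) LinearMap.id (X.coact x) =
      f.lin x := by
  have h : ∀ t : M ⊗[k] C, (DGCoalgebra.counitHom M C).lin.rTensor C
      ((cofree M C).coact t) = t := by
    intro t
    induction t using TensorProduct.induction_on with
    | zero => simp
    | tmul m c =>
      have h1 : ∀ s : C ⊗[k] C, (DGCoalgebra.counitHom M C).lin.rTensor C
          ((TensorProduct.assoc k M C C).symm (m ⊗ₜ s)) =
          m ⊗ₜ (TensorProduct.lid k C ((Coalgebra.counit (R := k) (A := C)).rTensor C s)) := by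
        intro s
        induction s using TensorProduct.induction_on with
        | zero => simp
        | tmul a b =>
          have := DGCoalgebra.counitHom_tmul M C m a
          simp only [TensorProduct.assoc_symm_tmul, LinearMap.rTensor_tmul,
            TensorProduct.lid_tmul, TensorProduct.tmul_smul, this, TensorProduct.smul_tmul']
        | add s t hs ht => simp only [TensorProduct.tmul_add, map_add, hs, ht]
      refine (h1 (Coalgebra.comul (R := k) c)).trans ?_
      rw [Coalgebra.rTensor_counit_comul, TensorProduct.lid_tmul, one_smul]
    | add s t hs ht => simp only [map_add, hs, ht]
  have h2 := h (f.lin x)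
  rw [← f.map_coact x] at h2
  refine Eq.trans ?_ h2
  change LinearMap.rTensor C _ _ = _
  rw [LinearMap.rTensor_comp]
  rfl

theorem isInjective_cofree_disk [IsSemisimpleRing k] (N : DGModule k) (C : DGCoalgebra k) :
    (cofree N.disk C).IsInjective := by
  intro A B i hi f
  let f' := (DGCoalgebra.counitHom N.disk C).comp f.toHom
  obtain ⟨g0, hg0⟩ := IsSemisimpleModule.extension_property i.lin hi
    (LinearMap.fst k N N ∘ₗ f'.lin)
  have hfst : ∀ n x, x ∈ A.gr n → (f'.lin x).1 ∈ N.gr n := by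
    rintro (_ | n) x hx
    · exact (f'.map_mem 0 x hx).1
    · exact (f'.map_mem (n + 1) x hx).1
  let g1 : B →ₗ[k] N := B.toDGModule.glue fun n => N.proj n ∘ₗ g0
  have hg1 : ∀ n x, x ∈ B.gr n → g1 x ∈ N.gr n := by
    intro n x hx
    simp only [g1]
    rw [glue_of_mem _ hx]
    exact proj_mem n (g0 x)
  have hg1i : ∀ a, g1 (i.lin a) = (f'.lin a).1 := by
    have : g1 ∘ₗ i.lin = LinearMap.fst k N N ∘ₗ f'.lin := by
      refine DGModule.lin_ext fun n x hx => ?_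
      have h1 : g0 (i.lin x) = (f'.lin x).1 := LinearMap.congr_fun hg0 x
      simp only [g1, LinearMap.comp_apply]
      rw [glue_of_mem _ (i.map_mem n x hx), LinearMap.comp_apply, h1, proj_same (hfst n x hx)]
      rfl
    exact LinearMap.congr_fun this
  let g2 : DGModule.Hom B.toDGModule N.disk := toDisk g1 hg1
  have hg2 : g2.lin ∘ₗ i.lin = f'.lin := by
    refine LinearMap.ext fun a => Prod.ext (hg1i a) ?_
    change g1 (B.d (i.lin a)) = _
    rw [← i.map_d, hg1i, f'.map_d]
    rfl
  refine ⟨cofreeLift g2, fun a => ?_⟩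
  change TensorProduct.map g2.lin LinearMap.id (B.coact (i.lin a)) = _
  rw [← i.map_coact a, ← map_counitHom_coact f a]
  change LinearMap.rTensor C g2.lin (LinearMap.rTensor C i.lin (A.coact a)) =
    LinearMap.rTensor C f'.lin (A.coact a)
  rw [← hg2, LinearMap.rTensor_comp]
  rfl

/-- An embedding of a comodule into an injective one, the cofree comodule on `∏ₙ Dⁿ⁺¹(Yₙ)`. -/
noncomputable def embed (Y : DGComodule C) : Hom Y (cofree Y.toDGModule.disk C) :=
  cofreeLift (toDisk LinearMap.id fun _ _ h => h)

theorem embed_injective (Y : DGComodule C) : Function.Injective Y.embed.lin := by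
  intro x y h
  have h1 := congrArg (DGCoalgebra.counitHom Y.toDGModule.disk C).lin h
  rw [embed, counitHom_cofreeLift, counitHom_cofreeLift] at h1
  exact congrArg Prod.fst h1

/-- The underlying complex of the cokernel of a map of comodules. -/
noncomputable abbrev cokerModule {X Y : DGComodule C} (f : Hom X Y) : DGModule k :=
  Y.toDGModule.quot (LinearMap.range f.lin)
    (by
      rintro n _ ⟨x, rfl⟩
      exact ⟨X.toDGModule.proj n x, f.map_proj n x⟩)
    (by
      rintro _ ⟨x, rfl⟩
      exact ⟨X.d x, f.map_d x⟩)

/-- The projection to the cokernel, as a chain map. -/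
noncomputable def cokerProj {X Y : DGComodule C} (f : Hom X Y) :
    DGModule.Hom Y.toDGModule (cokerModule f) :=
  ⟨(LinearMap.range f.lin).mkQ, fun _ y hy => ⟨y, hy, rfl⟩, fun _ => rfl⟩

/-- The cokernel of a map of comodules, with the induced coaction. -/
noncomputable abbrev coker {X Y : DGComodule C} (f : Hom X Y) : DGComodule C where
  toDGModule := cokerModule f
  coact := (LinearMap.range f.lin).liftQ ((cokerProj f).lin.rTensor C ∘ₗ Y.coact) (by
    rintro _ ⟨x, rfl⟩
    rw [LinearMap.mem_ker, LinearMap.comp_apply, ← f.map_coact x, ← LinearMap.comp_apply,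
      ← LinearMap.rTensor_comp]
    have : (cokerProj f).lin ∘ₗ f.lin = 0 := LinearMap.range_mkQ_comp _
    rw [this, LinearMap.rTensor_zero, LinearMap.zero_apply])
  coact_mem := by
    rintro n _ ⟨y, hy, rfl⟩
    exact ((cokerProj f).tensor (DGModule.Hom.id C.toDGModule)).map_mem n _ (Y.coact_mem n y hy)
  coact_d := by
    intro y
    obtain ⟨y, rfl⟩ := Submodule.mkQ_surjective _ y
    change (cokerProj f).lin.rTensor C (Y.coact (Y.d y)) = _
    rw [Y.coact_d]
    exact ((cokerProj f).tensor (DGModule.Hom.id C.toDGModule)).map_d _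
  coassoc := by
    refine LinearMap.ext fun y => ?_
    obtain ⟨y, rfl⟩ := Submodule.mkQ_surjective _ y
    let π := (cokerProj f).lin
    let ρ := (LinearMap.range f.lin).liftQ (π.rTensor C ∘ₗ Y.coact) (by
      rintro _ ⟨x, rfl⟩
      rw [LinearMap.mem_ker, LinearMap.comp_apply, ← f.map_coact x, ← LinearMap.comp_apply,
        ← LinearMap.rTensor_comp]
      have : π ∘ₗ f.lin = 0 := LinearMap.range_mkQ_comp _
      rw [this, LinearMap.rTensor_zero, LinearMap.zero_apply])
    change TensorProduct.assoc k _ C C (ρ.rTensor C (π.rTensor C (Y.coact y))) =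
      (Coalgebra.comul (R := k) (A := C)).lTensor _ (π.rTensor C (Y.coact y))
    have h0 : ρ ∘ₗ π = π.rTensor C ∘ₗ Y.coact := LinearMap.ext fun _ => rfl
    have h1 : ∀ t : (Y ⊗[k] C) ⊗[k] C,
        TensorProduct.assoc k _ C C ((π.rTensor C).rTensor C t) =
          π.rTensor (C ⊗[k] C) (TensorProduct.assoc k Y C C t) := by
      have : (TensorProduct.assoc k _ C C).toLinearMap ∘ₗ (π.rTensor C).rTensor C =
          π.rTensor (C ⊗[k] C) ∘ₗ (TensorProduct.assoc k Y C C).toLinearMap :=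
        TensorProduct.ext_threefold fun x y z => rfl
      exact LinearMap.congr_fun this
    have h2 := LinearMap.congr_fun Y.coassoc y
    simp only [LinearMap.comp_apply, LinearEquiv.coe_coe] at h2
    rw [← LinearMap.comp_apply (ρ.rTensor C), ← LinearMap.rTensor_comp, h0,
      LinearMap.rTensor_comp, LinearMap.comp_apply, h1, h2, ← LinearMap.comp_apply,
      LinearMap.rTensor_comp_lTensor, ← LinearMap.comp_apply (LinearMap.lTensor _ _),
      LinearMap.lTensor_comp_rTensor]
  counit_coact := by
    refine LinearMap.ext fun y => ?_
    obtain ⟨y, rfl⟩ := Submodule.mkQ_surjective _ y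
    change (Coalgebra.counit (R := k) (A := C)).lTensor _
      ((cokerProj f).lin.rTensor C (Y.coact y)) = _
    have h2 := LinearMap.congr_fun Y.counit_coact y
    rw [← LinearMap.comp_apply, LinearMap.lTensor_comp_rTensor, ← LinearMap.rTensor_comp_lTensor,
      LinearMap.comp_apply]
    simp only [LinearMap.comp_apply] at h2
    rw [h2]
    rfl

/-- The projection to the cokernel, as a map of comodules. -/
noncomputable def cokerMap {X Y : DGComodule C} (f : Hom X Y) : Hom Y (coker f) where
  toHom := cokerProj f
  map_coact _ := rfl

/-- Composition of maps of comodules. -/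
noncomputable def Hom.comp {X Y Z : DGComodule C} (g : Hom Y Z) (f : Hom X Y) : Hom X Z where
  toHom := g.toHom.comp f.toHom
  map_coact x := by
    change LinearMap.rTensor C (g.lin ∘ₗ f.lin) (X.coact x) = Z.coact (g.lin (f.lin x))
    rw [LinearMap.rTensor_comp, LinearMap.comp_apply, f.map_coact, g.map_coact]

/-- An injective resolution `0 ⟶ Y ⟶ I⁰ ⟶ I¹ ⟶ ⋯` in the category of `C`-comodules. -/
structure InjectiveResolution (Y : DGComodule C) where
  /-- the terms of the resolution -/
  obj : ℕ → DGComodule C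
  injective : ∀ n, (obj n).IsInjective
  /-- the coaugmentation -/
  aug : Hom Y (obj 0)
  /-- the differentials -/
  diff : ∀ n, Hom (obj n) (obj (n + 1))
  aug_injective : Function.Injective aug.lin
  exact_zero : Function.Exact aug.lin (diff 0).lin
  exact_succ : ∀ n, Function.Exact (diff n).lin (diff (n + 1)).lin

/-- The iterated cokernels of the standard embeddings. -/
noncomputable def cosyzygy (Y : DGComodule C) : ℕ → DGComodule C
  | 0 => Y
  | n + 1 => coker (cosyzygy Y n).embed

/-- The differential of the standard injective resolution. -/
noncomputable def standardDiff (Y : DGComodule C) (n : ℕ) :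
    Hom (cofree (cosyzygy Y n).toDGModule.disk C) (cofree (cosyzygy Y (n + 1)).toDGModule.disk C) :=
  (cosyzygy Y (n + 1)).embed.comp (cokerMap (cosyzygy Y n).embed)

theorem embed_standardDiff_exact (Y : DGComodule C) (n : ℕ) :
    Function.Exact (cosyzygy Y n).embed.lin (standardDiff Y n).lin := by
  intro x
  have h : (standardDiff Y n).lin x = 0 ↔ (cokerMap (cosyzygy Y n).embed).lin x = 0 :=
    map_eq_zero_iff (cosyzygy Y (n + 1)).embed.lin (embed_injective _)
  rw [h]
  exact Submodule.Quotient.mk_eq_zero _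

/-- The standard injective resolution of a comodule. -/
noncomputable def injectiveResolution [IsSemisimpleRing k] (Y : DGComodule C) :
    InjectiveResolution Y where
  obj n := cofree (cosyzygy Y n).toDGModule.disk C
  injective n := isInjective_cofree_disk _ _
  aug := Y.embed
  diff := standardDiff Y
  aug_injective := embed_injective Y
  exact_zero := embed_standardDiff_exact Y 0
  exact_succ n x := by
    rw [embed_standardDiff_exact Y (n + 1) x]
    constructor
    · rintro ⟨y, rfl⟩
      obtain ⟨z, rfl⟩ := Submodule.mkQ_surjective _ y
      exact ⟨z, rfl⟩
    · rintro ⟨z, rfl⟩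
      exact ⟨(cokerMap (cosyzygy Y n).embed).lin z, rfl⟩

/-! ### CoTor -/

/-- The degree `p` part of the cochain complex `X □_C I⁰ ⟶ X □_C I¹ ⟶ ⋯`. -/
noncomputable def cotensorComplex (X : DGComodule C) {Y : DGComodule C}
    (I : InjectiveResolution Y) (p : ℕ) : CochainComplex (ModuleCat.{u} k) ℕ :=
  CochainComplex.of (fun q => ModuleCat.of k ((X.cotensor (I.obj q)).gr p))
    (fun q => ModuleCat.ofHom
      ((X.cotensorMap (I.diff q)).lin.restrict ((X.cotensorMap (I.diff q)).map_mem p)))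
    (fun q => by
      ext w
      change TensorProduct.map LinearMap.id (I.diff (q + 1)).lin
        (TensorProduct.map LinearMap.id (I.diff q).lin w.1.1) = 0
      have : (I.diff (q + 1)).lin ∘ₗ (I.diff q).lin = 0 :=
        LinearMap.ext fun x => (I.exact_succ q).apply_apply_eq_zero x
      rw [← LinearMap.comp_apply, ← TensorProduct.map_comp, this, TensorProduct.map_zero_right,
        LinearMap.zero_apply])

/-- The degree `p` part of `CoTor^q_C(X, Y)`, the value at `Y` of the `q`-th right derived functor
of `X □_C -`: the `q`-th cohomology of `X □_C I^•` for an injective resolution `I^•` of `Y`. -/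
noncomputable def CoTor [IsSemisimpleRing k] (X Y : DGComodule C) (q p : ℕ) : ModuleCat.{u} k :=
  (cotensorComplex X Y.injectiveResolution p).homology q

end DGComodule

end Resolution

/-! ### Spectral sequences -/

section Spectral

variable {k : Type u} [CommRing k]

/-- Spectral sequences of `k`-modules `E^r_{p,q}` with `p, q ≥ 0` and `r ≥ 2`, with differentials
`d^r : E^r_{p,q} ⟶ E^r_{p+r-1,q+r}`; here `p - q` is the total degree, lowered by one by `d^r`. -/
abbrev EMSpectralSequence (k : Type u) [CommRing k] :=
  SpectralSequence (ModuleCat.{u} k) (fun r => ComplexShape.spectralSequenceNat (r - 1, r)) 2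

/-- Convergence of `E` to the graded module `A`: each `Aₙ` has a finite decreasing filtration
`Aₙ = F⁰Aₙ ⊇ F¹Aₙ ⊇ ⋯ ⊇ 0`, and for all `p, q`, from some page on the differentials into and out
of `E^r_{p,q}` vanish, so that `E^r_{p,q} = E^∞_{p,q}`, and this term is `F^qA_{p-q}/F^{q+1}A_{p-q}`
(zero if `p < q`). -/
def EMSpectralSequence.ConvergesTo (E : EMSpectralSequence k) (A : DGModule k) : Prop :=
  ∃ F : ∀ n : ℕ, ℕ → Submodule k (A.gr n),
    (∀ n, Antitone (F n)) ∧ (∀ n, F n 0 = ⊤) ∧ (∀ n, ∃ s, F n s = ⊥) ∧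
    ∀ p q : ℕ, ∃ r₀ : ℤ, ∃ h₀ : 2 ≤ r₀, ∀ (r : ℤ) (hr : r₀ ≤ r),
      (∀ x, (E.page r (h₀.trans hr)).d x (p, q) = 0) ∧
      (∀ x, (E.page r (h₀.trans hr)).d (p, q) x = 0) ∧
      (p < q → Limits.IsZero ((E.page r (h₀.trans hr)).X (p, q))) ∧
      (∀ n, p = n + q → Nonempty ((E.page r (h₀.trans hr)).X (p, q) ≅
        ModuleCat.of k (F n q ⧸ (F n (q + 1)).submoduleOf (F n q))))

end Spectral

end EilenbergMoore

open EilenbergMoore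

/-! Put `Y_0 = Y` and let `Y_{q+1}` be the cokernel of the coaction `Y_q → Y_q ⊗ C` (`coactSyzygy`).
If `X` is fibrant or coflat, `X □_C -` keeps the sequences `0 → Y_q → Y_q ⊗ C → Y_{q+1} → 0` exact
(`cotensor_shortExact`). Their long exact homology sequences form an exact couple with `D_{p,q} =
H_p(X □_C Y_q)` and `E_{p,q} = H_p(X □_C (Y_q ⊗ C))` (`exactCouple`), and the spectral sequence is
the one of this couple.

Exactness: `X □_C -` is left exact because modules over a semisimple ring are flat. For coflat `X`
the rest is the definition. For fibrant `X`, the map from `X` to the homotopy fibre of `X ⊗ C →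
coker` is an injective quasi-isomorphism; lifting the identity of `X` along it yields a retraction
of the coaction that respects degrees and coactions but perhaps not differentials
(`IsFibrant.exists_retraction`). This is enough for surjectivity (`grMap_surjective`).

Convergence: as `C_0 = k` and `C_1 = 0`, each cokernel vanishes in two more degrees than the
comodule before it (`coker_coactMap_gr_eq_bot`), so `D_{p,q} = 0` for `p < 2q`. All filtrations are
then finite and the differentials at a given spot eventually vanish
(`spectralSequence_convergesTo`).

Second page: the counit retracts each coaction by a chain map, so homology turns the short exact
sequences into short exact sequences of `H_*(C)`-comodules, with middle terms `H_*(Y_q ⊗ C) ≅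
H_*(Y_q) ⊗ H_*(C)`, which are injective as graded comodules (`homologyGrResolution`). On cofree
comodules the comparison map from `H_*(X □_C -)` to `H_*(X) □ H_*(-)` is bijective
(`homologyCotensor_cofree_bijective`), so the second page is the cohomology of `H_*(X) □ H_*(Y_• ⊗
C)`. CoTor is defined by another resolution, the standard one by dg-comodules; its underlying graded
comodules are injective too, and two such resolutions of one comodule have the same cohomology
(`nonempty_cohomology_equiv`). -/

namespace EilenbergMoore

/-! ### Recognising the homology of a complex of modules. -/

section ModuleLemmas

variable {k : Type u} [CommRing k]

/-- Two quotients of a module with the same kernel are isomorphic. -/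
noncomputable def equivOfSurjective {W M N : Type u} [AddCommGroup W] [Module k W]
    [AddCommGroup M] [Module k M] [AddCommGroup N] [Module k N] (a : W →ₗ[k] M) (b : W →ₗ[k] N)
    (ha : Function.Surjective a) (hb : Function.Surjective b) (h : ∀ w, a w = 0 ↔ b w = 0) :
    M ≃ₗ[k] N :=
  (a.quotKerEquivOfSurjective ha).symm ≪≫ₗ
    Submodule.quotEquivOfEq (LinearMap.ker a) (LinearMap.ker b) (Submodule.ext fun w => h w) ≪≫ₗ b.quotKerEquivOfSurjective hb

/-- The homology of a complex of modules at `j` is `M` as soon as some module `W` maps onto the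
cycles and onto `M`, such that the kernel of `W → M` is the preimage of the boundaries. -/
theorem nonempty_homology_iso {ι : Type*} {c : ComplexShape ι}
    (K : HomologicalComplex (ModuleCat.{u} k) c) (j : ι) {W M : Type u}
    [AddCommGroup W] [Module k W] [AddCommGroup M] [Module k M]
    (a : W →ₗ[k] K.X j) (b : W →ₗ[k] M)
    (ha : ∀ x : K.X j, (∀ l, (K.d j l).hom x = 0) ↔ ∃ w, a w = x) (hb : Function.Surjective b)
    (hab : ∀ w, b w = 0 ↔ ∃ i, ∃ y : K.X i, (K.d i j).hom y = a w) :
    Nonempty (K.homology j ≅ ModuleCat.of k M) := by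
  let S := K.sc j
  have hg : ∀ x : K.X j, S.g.hom x = 0 ↔ ∀ l, (K.d j l).hom x = 0 := by
    intro x
    constructor
    · intro hx l
      by_cases h : c.Rel j l
      · obtain rfl := c.next_eq' h
        exact hx
      · rw [K.shape _ _ h]; rfl
    · intro hx
      exact hx _
  let a' : W →ₗ[k] LinearMap.ker S.g.hom := 
    a.codRestrict (LinearMap.ker S.g.hom) fun w => (hg _).2 ((ha _).2 ⟨w, rfl⟩)
  have ha' : Function.Surjective a' := by
    rintro ⟨x, hx⟩
    obtain ⟨w, hw⟩ := (ha x).1 ((hg x).1 hx)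
    exact ⟨w, Subtype.ext hw⟩
  -- Homology and `M` are both quotients of `W`; only their kernels have to be compared.
  let e := equivOfSurjective ((LinearMap.range S.moduleCatToCycles).mkQ ∘ₗ a') b
    ((Submodule.mkQ_surjective _).comp ha') hb (by
      intro w
      rw [hab, LinearMap.comp_apply, Submodule.mkQ_apply, Submodule.Quotient.mk_eq_zero]
      constructor
      · rintro ⟨y, hy⟩
        exact ⟨_, y, congrArg Subtype.val hy⟩
      · rintro ⟨i, y, hy⟩
        by_cases h : c.Rel i j
        · obtain rfl := c.prev_eq' h
          exact ⟨y, Subtype.ext hy⟩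
        · rw [K.shape _ _ h] at hy
          refine ⟨0, Subtype.ext ?_⟩
          rw [map_zero]
          exact hy)
  exact ⟨S.moduleCatHomologyIso ≪≫ e.toModuleIso⟩

end ModuleLemmas

/-! ### Exact couples and their derived pages. -/

/-- A bigraded exact couple `D ⟶ D ⟶ E ⟶ D` in the first quadrant, vanishing for `p < 2 q`. -/
structure ExactCouple (k : Type u) [CommRing k] where
  /-- the terms `D_{p,q}` -/
  D : ℕ → ℕ → Type u
  /-- the terms `E_{p,q}` -/
  E : ℕ → ℕ → Type u
  [addCommGroupD : ∀ p q, AddCommGroup (D p q)]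
  [moduleD : ∀ p q, Module k (D p q)]
  [addCommGroupE : ∀ p q, AddCommGroup (E p q)]
  [moduleE : ∀ p q, Module k (E p q)]
  /-- the map of bidegree `(-1, -1)` -/
  i : ∀ p q, D (p + 1) (q + 1) →ₗ[k] D p q
  /-- the map of bidegree `(0, 0)` -/
  j : ∀ p q, D p q →ₗ[k] E p q
  /-- the map of bidegree `(0, 1)` -/
  κ : ∀ p q, E p q →ₗ[k] D p (q + 1)
  exact_i_j : ∀ p q, Function.Exact (i p q) (j p q)
  exact_j_κ : ∀ p q, Function.Exact (j p q) (κ p q)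
  exact_κ_i : ∀ p q, Function.Exact (κ (p + 1) q) (i p q)
  eq_zero : ∀ p q, p < 2 * q → ∀ x : D p q, x = 0

attribute [instance] ExactCouple.addCommGroupD ExactCouple.moduleD ExactCouple.addCommGroupE
  ExactCouple.moduleE

namespace ExactCouple

variable {k : Type u} [CommRing k] (c : ExactCouple k)

/-- Both neighbours `D p q` and `D p (q + 1)` in the exact sequence vanish. -/
theorem E_eq_zero {p q : ℕ} (h : p < 2 * q) (x : c.E p q) : x = 0 := by
  obtain ⟨y, rfl⟩ := (c.exact_j_κ p q x).1 (c.eq_zero _ _ (by omega) _)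
  rw [c.eq_zero p q h y, map_zero]

/-- The iterates of `i`. -/
def iter : ∀ m p q : ℕ, c.D (p + m) (q + m) →ₗ[k] c.D p q
  | 0, _, _ => LinearMap.id
  | m + 1, p, q => iter m p q ∘ₗ c.i (p + m) (q + m)

/-- The kernels of the iterates of `i`. -/
def kerIter : ∀ _ p q : ℕ, Submodule k (c.D p q)
  | 0, _, _ => ⊥
  -- No `i` leaves the edge of the quadrant, so iteration stops there with zero kernel, as if the
  -- couple were continued by isomorphisms beyond `q = 0`. Recursion from the source end avoids
  -- subtracting `m` from the indices.
  | _ + 1, 0, _ => ⊥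
  | _ + 1, _, 0 => ⊥
  | m + 1, p + 1, q + 1 => (kerIter m p q).comap (c.i p q)

theorem kerIter_zero_right (m p : ℕ) : c.kerIter m p 0 = ⊥ := by
  rcases m with _ | m <;> rcases p with _ | p <;> rfl

/-- Links the two recursions: `kerIter` peels off the first map applied, `iter` is built from the
other end. -/
theorem kerIter_add (n m p q : ℕ) :
    c.kerIter (n + m) (p + m) (q + m) = (c.kerIter n p q).comap (c.iter m p q) := by
  induction m with
  | zero => rfl
  | succ m ih =>
    change (c.kerIter (n + m) (p + m) (q + m)).comap (c.i (p + m) (q + m)) = _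
    rw [ih]
    rfl

theorem mem_kerIter_iff (m p q : ℕ) (x : c.D (p + m) (q + m)) :
    x ∈ c.kerIter m (p + m) (q + m) ↔ c.iter m p q x = 0 := by
  have h := c.kerIter_add 0 m p q
  rw [zero_add] at h
  rw [h]
  exact Iff.rfl

/-- After `q` steps the edge `q = 0` is reached and further iteration changes nothing. -/
theorem kerIter_le_eq {q m : ℕ} (h : q ≤ m) (n : ℕ) :
    c.kerIter m (n + q) (0 + q) = LinearMap.ker (c.iter q n 0) := by
  obtain ⟨l, rfl⟩ := Nat.exists_eq_add_of_le' h
  rw [kerIter_add, kerIter_zero_right]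
  rfl

theorem kerIter_succ_eq {q m : ℕ} (h : q ≤ m) (p : ℕ) :
    c.kerIter (m + 1) p q = c.kerIter m p q := by
  by_cases hp : p < q
  · have : ∀ x : c.D p q, x = 0 := c.eq_zero p q (by omega)
    ext x
    simp [this x]
  · obtain ⟨n, rfl⟩ := Nat.exists_eq_add_of_le' (not_lt.1 hp)
    -- `0 + q` and `q` are not definitionally equal; the variable `q'` allows rewriting without a
    -- cast between the modules `D`.
    have : ∀ q', q' = 0 + q → c.kerIter (m + 1) (n + q) q' = c.kerIter m (n + q) q' := by
      rintro _ rfl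
      rw [c.kerIter_le_eq h, c.kerIter_le_eq (h.trans (Nat.le_succ m))]
    exact this q (by simp)

/-- The cycles of the page `m + 1`. -/
def cyc (m p q : ℕ) : Submodule k (c.E p q) :=
  (LinearMap.range (c.iter m p (q + 1))).comap (c.κ p q)

/-- The boundaries of the page `m + 1`. -/
def bdy (m p q : ℕ) : Submodule k (c.E p q) := (c.kerIter m p q).map (c.j p q)

/-- The term at `(p, q)` of the page `m + 1`. -/
abbrev Page (m p q : ℕ) : Type u := c.cyc m p q ⧸ (c.bdy m p q).submoduleOf (c.cyc m p q)

theorem j_mem_cyc (m p q : ℕ) (x : c.D p q) : c.j p q x ∈ c.cyc m p q := by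
  rw [cyc, Submodule.mem_comap, (c.exact_j_κ p q).apply_apply_eq_zero]
  exact zero_mem _

/-- The class on the page `m + 1` of an element in the image of `j`. -/
def jPage (m p q : ℕ) : c.D p q →ₗ[k] c.Page m p q :=
  Submodule.mkQ _ ∘ₗ (c.j p q).codRestrict _ (c.j_mem_cyc m p q)

theorem mk_eq_zero_iff {m p q : ℕ} (x : c.cyc m p q) :
    ((c.bdy m p q).submoduleOf (c.cyc m p q)).mkQ x = 0 ↔ x.1 ∈ c.bdy m p q :=
  Submodule.Quotient.mk_eq_zero _

theorem jPage_eq_zero_iff {m p q : ℕ} (x : c.D p q) :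
    c.jPage m p q x = 0 ↔ c.j p q x ∈ c.bdy m p q :=
  Submodule.Quotient.mk_eq_zero _

/-- The differential of the page `m + 1`, on cycles. -/
noncomputable def diffCyc (m p q : ℕ) :
    c.cyc m p q →ₗ[k] c.Page m (p + m) (q + 1 + m) :=
  -- The differential is `j ∘ i⁻ᵐ ∘ κ`. The choice in `i⁻ᵐ` is an element of the kernel of `iᵐ`,
  -- whose image under `j` is exactly what the target page divides out.
  (LinearMap.ker (c.iter m p (q + 1))).liftQ (c.jPage m (p + m) (q + 1 + m)) (by
      intro y hy
      rw [LinearMap.mem_ker, jPage_eq_zero_iff]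
      exact ⟨y, (c.mem_kerIter_iff m p (q + 1) y).2 hy, rfl⟩) ∘ₗ
    (c.iter m p (q + 1)).quotKerEquivRange.symm.toLinearMap ∘ₗ
    (c.κ p q).restrict (p := c.cyc m p q) (q := LinearMap.range (c.iter m p (q + 1)))
      (fun _ hx => hx)

theorem diffCyc_apply {m p q : ℕ} (x : c.cyc m p q) (y : c.D (p + m) (q + 1 + m))
    (h : c.iter m p (q + 1) y = c.κ p q x.1) :
    c.diffCyc m p q x = c.jPage m (p + m) (q + 1 + m) y := by
  have h1 : (c.iter m p (q + 1)).quotKerEquivRange.symm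
      ((c.κ p q).restrict (p := c.cyc m p q) (q := LinearMap.range (c.iter m p (q + 1)))
        (fun _ hx => hx) x) = Submodule.Quotient.mk y := by
    rw [LinearEquiv.symm_apply_eq]
    exact Subtype.ext h.symm
  rw [diffCyc, LinearMap.comp_apply, LinearMap.comp_apply, LinearEquiv.coe_coe, h1]
  rfl

theorem exists_iter_eq {m p q : ℕ} (x : c.cyc m p q) :
    ∃ y : c.D (p + m) (q + 1 + m), c.iter m p (q + 1) y = c.κ p q x.1 := x.2

/-- The differential of the page `m + 1`. -/
noncomputable def diff (m p q : ℕ) : c.Page m p q →ₗ[k] c.Page m (p + m) (q + 1 + m) :=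
  Submodule.liftQ _ (c.diffCyc m p q) (by
    rintro x ⟨y, -, hy⟩
    have : c.κ p q x.1 = 0 := by
      rw [← (c.exact_j_κ p q).apply_apply_eq_zero y, hy]
      rfl
    rw [LinearMap.mem_ker, c.diffCyc_apply x 0 (by rw [this, map_zero]), map_zero])

theorem diff_mk {m p q : ℕ} (x : c.cyc m p q) :
    c.diff m p q (Submodule.mkQ _ x) = c.diffCyc m p q x := rfl

/-- The differential of the page `m + 1`, with free target indices. -/
noncomputable def diffTo (m p q p' q' : ℕ) (hp : p + m = p') (hq : q + 1 + m = q') :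
    c.Page m p q →ₗ[k] c.Page m p' q' := by
  subst hp
  subst hq
  exact c.diff m p q

theorem diffTo_jPage (m p q p' q' : ℕ) (hp : p + m = p') (hq : q + 1 + m = q') (y : c.D p q) :
    c.diffTo m p q p' q' hp hq (c.jPage m p q y) = 0 := by
  subst hp
  subst hq
  have : c.κ p q (c.j p q y) = 0 := (c.exact_j_κ p q).apply_apply_eq_zero y
  change c.diffCyc m p q ⟨c.j p q y, c.j_mem_cyc m p q y⟩ = 0
  rw [c.diffCyc_apply _ 0 (by rw [this, map_zero]), map_zero]

/-- With `diffTo_jPage` this gives `d ∘ d = 0`: values of `d` come from `j`, and `κ ∘ j = 0`. -/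
theorem exists_diffTo_eq_jPage (m p q p' q' : ℕ) (hp : p + m = p') (hq : q + 1 + m = q')
    (x : c.Page m p q) : ∃ y, c.diffTo m p q p' q' hp hq x = c.jPage m p' q' y := by
  subst hp
  subst hq
  obtain ⟨x, rfl⟩ := Submodule.mkQ_surjective _ x
  obtain ⟨y, hy⟩ := c.exists_iter_eq x
  exact ⟨y, c.diffCyc_apply x y hy⟩

theorem range_iter_succ_le (m p q : ℕ) :
    LinearMap.range (c.iter (m + 1) p q) ≤ LinearMap.range (c.iter m p q) := by
  rintro _ ⟨y, rfl⟩
  exact ⟨_, rfl⟩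

theorem cyc_succ_le (m p q : ℕ) : c.cyc (m + 1) p q ≤ c.cyc m p q :=
  Submodule.comap_mono (c.range_iter_succ_le m p (q + 1))

/-- The cycles of the page `m + 2`, mapped to the page `m + 1`. -/
def cycToPage (m p q : ℕ) : c.cyc (m + 1) p q →ₗ[k] c.Page m p q :=
  Submodule.mkQ _ ∘ₗ Submodule.inclusion (c.cyc_succ_le m p q)

/-- If `κ x = iᵐ y` and `j y = j y'` with `iᵐ y' = 0`, then `y - y' = i t` by exactness, hence `κ x
= iᵐ⁺¹ t`: a `d`-cycle is an element whose `κ` can be divided by `i` once more. -/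
theorem diff_eq_zero_iff {m p q : ℕ} (x : c.Page m p q) :
    c.diff m p q x = 0 ↔ ∃ w, c.cycToPage m p q w = x := by
  constructor
  · intro hx
    obtain ⟨x, rfl⟩ := Submodule.mkQ_surjective _ x
    obtain ⟨y, hy⟩ := c.exists_iter_eq x
    rw [diff_mk, c.diffCyc_apply x y hy, jPage_eq_zero_iff] at hx
    obtain ⟨y', hy', h⟩ := hx
    have h0 : c.j (p + m) (q + 1 + m) (y - y') = 0 := by rw [map_sub, h, sub_self]
    obtain ⟨t, ht⟩ := (c.exact_i_j _ _ _).1 h0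
    have hx' : x.1 ∈ c.cyc (m + 1) p q := by
      refine ⟨t, ?_⟩
      change c.iter m p (q + 1) (c.i (p + m) (q + 1 + m) t) = _
      have := (c.mem_kerIter_iff m p (q + 1) y').1 hy'
      rw [ht, map_sub, this, hy, sub_zero]
    exact ⟨⟨x.1, hx'⟩, rfl⟩
  · rintro ⟨⟨x, y, hy⟩, rfl⟩
    refine (c.diffCyc_apply ⟨x, c.cyc_succ_le m p q ⟨y, hy⟩⟩
      (c.i (p + m) (q + 1 + m) y) hy).trans ?_
    rw [jPage_eq_zero_iff, (c.exact_i_j _ _).apply_apply_eq_zero]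
    exact zero_mem _

/-- By exactness of `κ` and `i`, the kernel of `iᵐ⁺¹` consists of the `y` with `iᵐ y` in the image
of `κ`; these are the elements that compute values of the differential. -/
theorem exists_diff_eq_jPage_iff {m p q : ℕ} (y : c.D (p + m) (q + 1 + m)) :
    (∃ x, c.diff m p q x = c.jPage m _ _ y) ↔
      c.j _ _ y ∈ c.bdy (m + 1) (p + m) (q + 1 + m) := by
  have key : ∀ y : c.D (p + m) (q + 1 + m), y ∈ c.kerIter (m + 1) (p + m) (q + 1 + m) ↔
      ∃ x, c.κ p q x = c.iter m p (q + 1) y := by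
    intro y
    rw [add_comm m 1, kerIter_add, Submodule.mem_comap]
    -- At `p = 0` no map `i` leaves `D 0 (q + 1)`, but this module is zero.
    rcases p with _ | p
    · have h := c.eq_zero 0 (q + 1) (by omega)
      rw [h (c.iter m 0 (q + 1) y)]
      exact ⟨fun _ => ⟨0, map_zero _⟩, fun _ => zero_mem _⟩
    · exact c.exact_κ_i p q _
  constructor
  · rintro ⟨x, hx⟩
    obtain ⟨x, rfl⟩ := Submodule.mkQ_surjective _ x
    obtain ⟨z, hz⟩ := c.exists_iter_eq x
    rw [diff_mk, c.diffCyc_apply x z hz, ← sub_eq_zero, ← map_sub, jPage_eq_zero_iff] at hx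
    obtain ⟨y', hy', h⟩ := hx
    refine ⟨z - y', (key _).2 ⟨x.1, ?_⟩, ?_⟩
    · have := (c.mem_kerIter_iff m p (q + 1) y').1 hy'
      rw [map_sub, this, sub_zero, hz]
    · rw [map_sub, h, map_sub]
      abel
  · rintro ⟨y', hy', h⟩
    obtain ⟨x, hx⟩ := (key y').1 hy'
    refine ⟨Submodule.mkQ _ ⟨x, ⟨y', hx.symm⟩⟩, ?_⟩
    rw [diff_mk, c.diffCyc_apply _ y' hx.symm, ← sub_eq_zero, ← map_sub, jPage_eq_zero_iff,
      map_sub, h, sub_self]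
    exact zero_mem _

theorem diffTo_eq_zero_iff {m p q p' q' : ℕ} (hp : p + m = p') (hq : q + 1 + m = q')
    (x : c.Page m p q) :
    c.diffTo m p q p' q' hp hq x = 0 ↔ ∃ w, c.cycToPage m p q w = x := by
  subst hp
  subst hq
  exact c.diff_eq_zero_iff x

theorem bdy_mono (m p q : ℕ) : c.bdy m p q ≤ c.bdy (m + 1) p q := by
  refine Submodule.map_mono ?_
  induction m generalizing p q with
  | zero => exact bot_le
  | succ m ih =>
    rcases p with _ | p
    · exact le_rfl
    rcases q with _ | q
    · exact le_rfl
    exact Submodule.comap_mono (ih p q)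

theorem exists_diffTo_eq_iff {m p q p' q' : ℕ} (hp : p + m = p') (hq : q + 1 + m = q')
    (w : c.cyc (m + 1) p' q') :
    (∃ x, c.diffTo m p q p' q' hp hq x = c.cycToPage m p' q' w) ↔ w.1 ∈ c.bdy (m + 1) p' q' := by
  subst hp
  subst hq
  constructor
  · rintro ⟨x, hx⟩
    obtain ⟨y, hy⟩ := c.exists_diffTo_eq_jPage m p q _ _ rfl rfl x
    have h1 := (c.exists_diff_eq_jPage_iff y).1 ⟨x, hy⟩
    rw [hy] at hx
    have h2 : c.j _ _ y - w.1 ∈ c.bdy m (p + m) (q + 1 + m) :=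
      (Submodule.Quotient.eq ((c.bdy m _ _).submoduleOf (c.cyc m _ _))).1 hx
    simpa using sub_mem h1 (c.bdy_mono _ _ _ h2)
  · rintro ⟨y, hy, hw⟩
    obtain ⟨x, hx⟩ := (c.exists_diff_eq_jPage_iff y).2 ⟨y, hy, rfl⟩
    refine ⟨x, hx.trans ?_⟩
    exact congrArg (Submodule.mkQ _) (Subtype.ext hw)

/-! ### The pages as complexes, and the homology of a page. -/

/-- The page `r = m + 1` of the spectral sequence of an exact couple. -/
noncomputable def page (r : ℤ) (m : ℕ) (h : r = m + 1) :
    HomologicalComplex (ModuleCat.{u} k) (ComplexShape.spectralSequenceNat (r - 1, r)) where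
  X a := ModuleCat.of k (c.Page m a.1 a.2)
  d a b := if h : a.1 + m = b.1 ∧ a.2 + 1 + m = b.2 then
    ModuleCat.ofHom (c.diffTo m a.1 a.2 b.1 b.2 h.1 h.2) else 0
  shape a b hab := by
    rw [dif_neg]
    rintro ⟨h1, h2⟩
    exact hab ⟨by simp only; omega, by simp only; omega⟩
  d_comp_d' a b e _ _ := by
    split_ifs with h1 h2 h2
    · refine ModuleCat.hom_ext (LinearMap.ext fun x => ?_)
      obtain ⟨y, hy⟩ := c.exists_diffTo_eq_jPage m a.1 a.2 b.1 b.2 h1.1 h1.2 x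
      change c.diffTo m b.1 b.2 e.1 e.2 h2.1 h2.2 (c.diffTo m a.1 a.2 b.1 b.2 h1.1 h1.2 x) = 0
      rw [hy, diffTo_jPage]
    all_goals simp

theorem page_d_of_eq {r : ℤ} {m : ℕ} (h : r = m + 1) {a b : ℕ × ℕ} (hp : a.1 + m = b.1)
    (hq : a.2 + 1 + m = b.2) :
    (c.page r m h).d a b = ModuleCat.ofHom (c.diffTo m a.1 a.2 b.1 b.2 hp hq) :=
  dif_pos ⟨hp, hq⟩

theorem page_d_of_ne {r : ℤ} {m : ℕ} (h : r = m + 1) {a b : ℕ × ℕ}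
    (hab : ¬(a.1 + m = b.1 ∧ a.2 + 1 + m = b.2)) : (c.page r m h).d a b = 0 :=
  dif_neg hab

theorem page_d_eq_zero_iff {r : ℤ} {m : ℕ} (h : r = m + 1) (a : ℕ × ℕ)
    (x : (c.page r m h).X a) :
    (∀ b, ((c.page r m h).d a b).hom x = 0) ↔ ∃ w, c.cycToPage m a.1 a.2 w = x := by
  constructor
  · intro hx
    have h1 := hx (a.1 + m, a.2 + 1 + m)
    rw [c.page_d_of_eq h (a := a) (b := (a.1 + m, a.2 + 1 + m)) rfl rfl] at h1
    exact (c.diffTo_eq_zero_iff rfl rfl x).1 h1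
  · intro hx b
    by_cases hb : a.1 + m = b.1 ∧ a.2 + 1 + m = b.2
    · rw [c.page_d_of_eq h hb.1 hb.2]
      exact (c.diffTo_eq_zero_iff hb.1 hb.2 x).2 hx
    · rw [c.page_d_of_ne h hb]
      rfl

theorem exists_page_d_eq_iff {r : ℤ} {m : ℕ} (h : r = m + 1) (b : ℕ × ℕ)
    (w : c.cyc (m + 1) b.1 b.2) :
    (∃ a, ∃ x : (c.page r m h).X a, ((c.page r m h).d a b).hom x = c.cycToPage m b.1 b.2 w) ↔
      w.1 ∈ c.bdy (m + 1) b.1 b.2 := by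
  have hz : (0 : c.Page m b.1 b.2) = c.cycToPage m b.1 b.2 w → w.1 ∈ c.bdy (m + 1) b.1 b.2 := by
    intro h0
    exact c.bdy_mono _ _ _ ((c.mk_eq_zero_iff _).1 h0.symm)
  constructor
  · rintro ⟨a, x, hx⟩
    by_cases hb : a.1 + m = b.1 ∧ a.2 + 1 + m = b.2
    · rw [c.page_d_of_eq h hb.1 hb.2] at hx
      exact (c.exists_diffTo_eq_iff hb.1 hb.2 w).1 ⟨x, hx⟩
    · rw [c.page_d_of_ne h hb] at hx
      exact hz hx
  · intro hw
    by_cases hb : ∃ p q, p + m = b.1 ∧ q + 1 + m = b.2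
    · obtain ⟨p, q, h1, h2⟩ := hb
      obtain ⟨x, hx⟩ := (c.exists_diffTo_eq_iff h1 h2 w).2 hw
      refine ⟨(p, q), x, ?_⟩
      rw [c.page_d_of_eq h (a := (p, q)) h1 h2]
      exact hx
    -- No differential arrives at `b`, so `w` must already be zero on the page. If `b.2 ≤ m`, the
    -- boundaries have stabilised by `kerIter_succ_eq`; otherwise `b.1 < m < b.2` and `E` vanishes
    -- at `b`.
    · refine ⟨b, 0, ?_⟩
      rw [map_zero]
      refine ((c.mk_eq_zero_iff _).2 ?_).symm
      by_cases h2 : b.2 ≤ m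
      · rwa [bdy, c.kerIter_succ_eq h2] at hw
      · have h1 : b.1 < m := by
          by_contra h1
          exact hb ⟨b.1 - m, b.2 - 1 - m, by omega, by omega⟩
        change w.1 ∈ _
        rw [c.E_eq_zero (by omega) w.1]
        exact zero_mem _

/-- The homology of a page is the next page. -/
theorem nonempty_page_homology_iso (r : ℤ) (m m' : ℕ) (h : r = m + 1) (hm : m' = m + 1)
    (a : ℕ × ℕ) : Nonempty ((c.page r m h).homology a ≅ ModuleCat.of k (c.Page m' a.1 a.2)) := by
  subst hm
  exact nonempty_homology_iso (c.page r m h) a (c.cycToPage m a.1 a.2) (Submodule.mkQ _)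
    (c.page_d_eq_zero_iff h a) (Submodule.mkQ_surjective _)
    (fun w => (c.mk_eq_zero_iff w).trans (c.exists_page_d_eq_iff h a w).symm)

/-- The spectral sequence of an exact couple. -/
noncomputable def spectralSequence : EMSpectralSequence k where
  page r hr := c.page r (r - 1).toNat (by omega)
  iso r r' a hr' hr := Classical.choice
    (c.nonempty_page_homology_iso r (r - 1).toNat (r' - 1).toNat (by omega) (by omega) a)

/-! ### Convergence of the spectral sequence of an exact couple. -/

/-- The filtration of the abutment of the spectral sequence of an exact couple. -/
def filtration (n q : ℕ) : Submodule k (c.D n 0) := LinearMap.range (c.iter q n 0)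

theorem filtration_antitone (n : ℕ) : Antitone (c.filtration n) :=
  antitone_nat_of_succ_le fun q => c.range_iter_succ_le q n 0

theorem filtration_zero (n : ℕ) : c.filtration n 0 = ⊤ := LinearMap.range_id

theorem filtration_eq_bot (n : ℕ) : c.filtration n (n + 1) = ⊥ := by
  refine (Submodule.eq_bot_iff _).2 ?_
  rintro _ ⟨y, rfl⟩
  rw [c.eq_zero _ _ (by omega) y, map_zero]

theorem nonempty_page_equiv_filtration {m n q : ℕ} (hm : n + q ≤ m) :
    Nonempty (c.Page m (n + q) q ≃ₗ[k]
      (c.filtration n q ⧸ (c.filtration n (q + 1)).submoduleOf (c.filtration n q))) := by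
  have : ∀ q', q' = 0 + q → Nonempty (c.Page m (n + q) q' ≃ₗ[k]
      (c.filtration n q ⧸ (c.filtration n (q + 1)).submoduleOf (c.filtration n q))) := by
    rintro _ rfl
    let ρ : c.D (n + q) (0 + q) →ₗ[k] c.filtration n q := (c.iter q n 0).rangeRestrict
    have hρ : Function.Surjective ρ := LinearMap.surjective_rangeRestrict _
    refine ⟨equivOfSurjective (c.jPage m (n + q) (0 + q))
      (Submodule.mkQ _ ∘ₗ ρ) ?_
      ((Submodule.mkQ_surjective _).comp hρ) ?_⟩
    · intro x
      obtain ⟨⟨x, y, hy⟩, rfl⟩ := Submodule.mkQ_surjective _ x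
      -- For `m ≥ n + q` the element `y` lies in the vanishing range `p < 2 q` of `D`. Cycles are
      -- thus killed by `κ`, that is, they come from `j`.
      rw [c.eq_zero _ _ (by omega) y, map_zero] at hy
      obtain ⟨z, rfl⟩ := (c.exact_j_κ _ _ _).1 hy.symm
      exact ⟨z, rfl⟩
    · intro x
      -- `j x` is a boundary iff `x` lies in the kernel of `i^q` plus the image of `i`, iff `i^q x`
      -- lies in the image of `i^(q+1)`.
      rw [jPage_eq_zero_iff, bdy, c.kerIter_le_eq (by omega), LinearMap.comp_apply,
        Submodule.mkQ_apply, Submodule.Quotient.mk_eq_zero]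
      constructor
      · rintro ⟨y, hy, h⟩
        have h0 : c.j _ _ (x - y) = 0 := by rw [map_sub, h, sub_self]
        obtain ⟨t, ht⟩ := (c.exact_i_j _ _ _).1 h0
        refine ⟨t, ?_⟩
        change c.iter q n 0 (c.i _ _ t) = c.iter q n 0 x
        rw [ht, map_sub, LinearMap.mem_ker.1 hy, sub_zero]
      · rintro ⟨t, ht⟩
        change c.iter q n 0 (c.i _ _ t) = c.iter q n 0 x at ht
        refine ⟨x - c.i (n + q) (0 + q) t, ?_, ?_⟩
        · rw [SetLike.mem_coe, LinearMap.mem_ker, map_sub, ht, sub_self]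
        · rw [map_sub, (c.exact_i_j _ _).apply_apply_eq_zero, sub_zero]
  exact this q (by simp)

theorem page_isZero {m p q : ℕ} (h : p < 2 * q) :
    Limits.IsZero (ModuleCat.of k (c.Page m p q)) := by
  have : Subsingleton (c.Page m p q) := by
    refine ⟨fun x y => ?_⟩
    obtain ⟨x, rfl⟩ := Submodule.mkQ_surjective _ x
    obtain ⟨y, rfl⟩ := Submodule.mkQ_surjective _ y
    exact congrArg _ (Subtype.ext ((c.E_eq_zero h _).trans (c.E_eq_zero h _).symm))
  exact ModuleCat.isZero_of_subsingleton _

/-- A nontrivial arrow has `b.2 ≥ m + 1`, excluding the first alternative. In the second, `b.1 = a.1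
+ m ≤ 2 m < 2 * b.2`, so the target vanishes. -/
theorem page_d_eq_zero {r : ℤ} {m : ℕ} (h : r = m + 1) (a b : ℕ × ℕ)
    (h' : b.2 ≤ m ∨ a.1 ≤ m) : (c.page r m h).d a b = 0 := by
  by_cases hab : a.1 + m = b.1 ∧ a.2 + 1 + m = b.2
  · refine (c.page_isZero (m := m) (p := b.1) (q := b.2) ?_).eq_of_tgt _ _
    omega
  · exact c.page_d_of_ne h hab

/-- The spectral sequence of an exact couple converges to `D_{•,0}`. -/
theorem spectralSequence_convergesTo (A : DGModule k) (e : ∀ n, c.D n 0 ≃ₗ[k] A.gr n) :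
    c.spectralSequence.ConvergesTo A := by
  refine ⟨fun n q => (c.filtration n q).map (e n).toLinearMap,
    fun n _ _ h => Submodule.map_mono (c.filtration_antitone n h), fun n => ?_,
    -- From `r = p + q + 2` on, `m = r - 1` exceeds both `p` and `q`: this kills the differentials
    -- on both sides of `(p, q)` and meets the bound `n + q ≤ m` with `p = n + q`.
    fun n => ⟨n + 1, ?_⟩, fun p q => ⟨p + q + 2, by omega, fun r hr => ⟨fun x => ?_, fun x => ?_,
      fun h => ?_, ?_⟩⟩⟩
  · simp only
    rw [filtration_zero, Submodule.map_top, LinearEquiv.range]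
  · simp only
    rw [filtration_eq_bot, Submodule.map_bot]
  · exact c.page_d_eq_zero (m := (r - 1).toNat) (by omega) _ _ (Or.inl (by simp only; omega))
  · exact c.page_d_eq_zero (m := (r - 1).toNat) (by omega) _ _ (Or.inr (by simp only; omega))
  · exact c.page_isZero (by omega)
  · rintro n rfl
    obtain ⟨f⟩ := c.nonempty_page_equiv_filtration (m := (r - 1).toNat) (n := n) (q := q) (by omega)
    let g : c.filtration n q ≃ₗ[k] (c.filtration n q).map (e n).toLinearMap :=
      (e n).submoduleMap (c.filtration n q)
    refine ⟨(f ≪≫ₗ Submodule.Quotient.equiv _ _ g ?_).toModuleIso⟩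
    ext x
    simp only [Submodule.mem_map, Submodule.submoduleOf, Submodule.mem_comap]
    constructor
    · rintro ⟨y, hy, rfl⟩
      exact ⟨y.1, hy, rfl⟩
    · rintro ⟨y, hy, h⟩
      exact ⟨⟨y, c.filtration_antitone n (Nat.le_succ q) hy⟩, hy, Subtype.ext h⟩

/-- The first differential is `j ∘ κ`; this lemma and the next two describe the second page as its
cohomology. -/
theorem mem_cyc_one_iff {p q : ℕ} (x : c.E p q) :
    x ∈ c.cyc 1 p q ↔ c.j p (q + 1) (c.κ p q x) = 0 :=
  (c.exact_i_j p (q + 1) _).symm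

theorem bdy_one_zero (p : ℕ) : c.bdy 1 p 0 = ⊥ := by
  rw [bdy, kerIter_zero_right, Submodule.map_bot]

theorem mem_bdy_one_iff {p q : ℕ} (x : c.E p (q + 1)) :
    x ∈ c.bdy 1 p (q + 1) ↔ ∃ y, c.j p (q + 1) (c.κ p q y) = x := by
  rcases p with _ | p
  · rw [c.E_eq_zero (by omega) x]
    exact ⟨fun _ => ⟨0, by rw [map_zero, map_zero]⟩, fun _ => zero_mem _⟩
  · constructor
    · rintro ⟨y, hy, rfl⟩
      obtain ⟨z, rfl⟩ := (c.exact_κ_i p q y).1 hy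
      exact ⟨z, rfl⟩
    · rintro ⟨y, rfl⟩
      exact ⟨_, (c.exact_κ_i p q).apply_apply_eq_zero y, rfl⟩

/-- Recognition of the terms of a page. -/
theorem nonempty_page_iso {m p q : ℕ} {W M : Type u} [AddCommGroup W] [Module k W]
    [AddCommGroup M] [Module k M] (a : W →ₗ[k] c.E p q) (b : W →ₗ[k] M)
    (ha : ∀ x, x ∈ c.cyc m p q ↔ ∃ w, a w = x) (hb : Function.Surjective b)
    (hab : ∀ w, b w = 0 ↔ a w ∈ c.bdy m p q) : Nonempty (c.Page m p q ≃ₗ[k] M) := by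
  let a' : W →ₗ[k] c.cyc m p q := a.codRestrict _ fun w => (ha _).2 ⟨w, rfl⟩
  have ha' : Function.Surjective a' := by
    rintro ⟨x, hx⟩
    obtain ⟨w, hw⟩ := (ha x).1 hx
    exact ⟨w, Subtype.ext hw⟩
  exact ⟨equivOfSurjective (Submodule.mkQ _ ∘ₗ a') b ((Submodule.mkQ_surjective _).comp ha') hb
    fun w => (c.mk_eq_zero_iff _).trans (hab w).symm⟩

end ExactCouple

/-! ### Graded maps and the long exact homology sequence. -/

section LongExact

variable {k : Type u} [CommRing k]

namespace DGModule

variable {A B M N P Q : DGModule k}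

/-- Linear maps of degree zero. -/
def IsGraded (f : M →ₗ[k] N) : Prop := ∀ n x, x ∈ M.gr n → f x ∈ N.gr n

theorem IsGraded.map_proj {f : M →ₗ[k] N} (hf : IsGraded f) (n : ℕ) (x : M) :
    f (M.proj n x) = N.proj n (f x) := by
  have : f ∘ₗ M.proj n = N.proj n ∘ₗ f := by
    refine lin_ext fun m x hx => ?_
    simp only [LinearMap.comp_apply, proj_of_mem hx, proj_of_mem (hf m x hx)]
    split_ifs <;> simp
  exact LinearMap.congr_fun this x

/-- Any preimage may be replaced by its degree `n` component. This passes exactness and surjectivity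
from total modules to single degrees. -/
theorem IsGraded.exists_mem {f : M →ₗ[k] N} (hf : IsGraded f) {n : ℕ} {y : N} (hy : y ∈ N.gr n)
    (h : ∃ x, f x = y) : ∃ x ∈ M.gr n, f x = y := by
  obtain ⟨x, rfl⟩ := h
  exact ⟨M.proj n x, proj_mem n x, by rw [hf.map_proj, proj_same hy]⟩

theorem IsGraded.exact_restrict {f : M →ₗ[k] N} {g : N →ₗ[k] P} (hf : IsGraded f)
    (hg : IsGraded g) (h : Function.Exact f g) (n : ℕ) :
    Function.Exact (f.restrict (hf n)) (g.restrict (hg n)) := by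
  rintro ⟨y, hy⟩
  constructor
  · intro h0
    obtain ⟨x, hx, hxy⟩ := hf.exists_mem hy ((h y).1 (congrArg Subtype.val h0))
    exact ⟨⟨x, hx⟩, Subtype.ext hxy⟩
  · rintro ⟨x, hx⟩
    exact Subtype.ext ((h y).2 ⟨x.1, congrArg Subtype.val hx⟩)

theorem IsGraded.surjective_restrict {f : M →ₗ[k] N} (hf : IsGraded f)
    (h : Function.Surjective f) (n : ℕ) : Function.Surjective (f.restrict (hf n)) := by
  rintro ⟨y, hy⟩
  obtain ⟨x, hx, hxy⟩ := hf.exists_mem hy (h y)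
  exact ⟨⟨x, hx⟩, Subtype.ext hxy⟩

theorem injective_restrict {f : M →ₗ[k] N} (hf : IsGraded f)
    (h : Function.Injective f) (n : ℕ) : Function.Injective (f.restrict (hf n)) :=
  fun _ _ hxy => Subtype.ext (h (congrArg Subtype.val hxy))

/-- Short exact sequences of complexes. -/
structure ShortExact (f : Hom A B) (g : Hom B Q) : Prop where
  injective : Function.Injective f.lin
  exact : Function.Exact f.lin g.lin
  surjective : Function.Surjective g.lin

namespace ShortExact

variable {f : Hom A B} {g : Hom B Q}

theorem exact_homologyMap (h : ShortExact f g) : Function.Exact f.homologyMap.lin g.homologyMap.lin := by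
  intro x
  obtain ⟨z, rfl⟩ := B.cls_surjective x
  constructor
  · intro hz
    rw [Hom.homologyMap_cls, cls_eq_zero_iff] at hz
    obtain ⟨y, hy⟩ := hz
    obtain ⟨b, rfl⟩ := h.surjective y
    have h1 : g.lin (z.1 - B.d b) = 0 := by
      rw [map_sub, g.map_d, hy]
      exact sub_self _
    obtain ⟨a, ha⟩ := (h.exact _).1 h1
    have hd : A.d a = 0 := h.injective (by
      have hz' : B.d z.1 = 0 := z.2
      rw [f.map_d, ha, map_sub, B.d_d, hz', sub_zero, map_zero])
    refine ⟨A.cls ⟨a, hd⟩, ?_⟩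
    rw [Hom.homologyMap_cls, ← sub_eq_zero, ← map_sub, cls_eq_zero_iff]
    refine ⟨-b, ?_⟩
    rw [map_neg]
    change _ = f.lin a - z.1
    rw [ha]
    abel
  · rintro ⟨y, hy⟩
    obtain ⟨a, rfl⟩ := A.cls_surjective y
    rw [← hy, Hom.homologyMap_cls, Hom.homologyMap_cls, cls_eq_zero_iff]
    exact ⟨0, by rw [map_zero]; exact (h.exact.apply_apply_eq_zero a.1).symm⟩

/-- A linear section `s` of `g`, available over a semisimple ring, makes the snake construction `z ↦
f⁻¹ (d (s z))` linear from the start. -/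
theorem exists_connecting [IsSemisimpleRing k] (h : ShortExact f g) : ∃ δ : Q.homology →ₗ[k] A.homology,
    ∀ (z : LinearMap.ker Q.d) (b : B) (a : LinearMap.ker A.d), g.lin b = z.1 →
      f.lin a.1 = B.d b → δ (Q.cls z) = A.cls a := by
  obtain ⟨s, hs⟩ := IsSemisimpleModule.lifting_property g.lin h.surjective LinearMap.id
  have hs' : ∀ y, g.lin (s y) = y := LinearMap.congr_fun hs
  let c : LinearMap.ker Q.d →ₗ[k] LinearMap.range f.lin :=
    (B.d ∘ₗ s ∘ₗ (LinearMap.ker Q.d).subtype).codRestrict _ fun z => by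
      refine (h.exact _).1 ?_
      change g.lin (B.d (s z.1)) = 0
      rw [g.map_d, hs']
      exact z.2
  let e := (LinearEquiv.ofInjective f.lin h.injective).symm
  have he : ∀ z, f.lin (e (c z)) = B.d (s z.1) := fun z =>
    congrArg Subtype.val ((LinearEquiv.ofInjective f.lin h.injective).apply_symm_apply (c z))
  let c' : LinearMap.ker Q.d →ₗ[k] LinearMap.ker A.d :=
    (e.toLinearMap ∘ₗ c).codRestrict _ fun z => h.injective (by
      rw [f.map_d, map_zero]
      change B.d (f.lin (e (c z))) = 0
      rw [he, B.d_d])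
  have hc' : ∀ z, f.lin (c' z).1 = B.d (s z.1) := he
  -- Another lift `b` differs from `s z` by some `f a'`, and the resulting cycle by `d a'`. The same
  -- fact shows below that boundaries go to zero.
  have key : ∀ (z : LinearMap.ker Q.d) (b : B) (a : LinearMap.ker A.d), g.lin b = z.1 →
      f.lin a.1 = B.d b → A.cls (c' z) = A.cls a := by
    intro z b a hb ha
    rw [← sub_eq_zero, ← map_sub, cls_eq_zero_iff]
    have h1 : g.lin (s z.1 - b) = 0 := by rw [map_sub, hs', hb, sub_self]
    obtain ⟨a', ha'⟩ := (h.exact _).1 h1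
    refine ⟨a', h.injective ?_⟩
    rw [f.map_d, ha', map_sub, Submodule.coe_sub, map_sub, hc', ha]
  refine ⟨homologyLift (A.cls ∘ₗ c') ?_, fun z b a hb ha => key z b a hb ha⟩
  rintro z ⟨y, hy⟩
  obtain ⟨b, rfl⟩ := h.surjective y
  refine (key z (B.d b) 0 (by rw [g.map_d, hy]) ?_).trans (map_zero _)
  rw [B.d_d]
  exact map_zero _

theorem exists_lift (h : ShortExact f g) (z : LinearMap.ker Q.d) (b : B) (hb : g.lin b = z.1) :
    ∃ a : LinearMap.ker A.d, f.lin a.1 = B.d b := by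
  have h1 : g.lin (B.d b) = 0 := by rw [g.map_d, hb]; exact z.2
  obtain ⟨a, ha⟩ := (h.exact _).1 h1
  exact ⟨⟨a, h.injective (by rw [f.map_d, ha, B.d_d, map_zero])⟩, ha⟩

/-- The connecting homomorphism of a short exact sequence of complexes. -/
noncomputable def connecting [IsSemisimpleRing k] (h : ShortExact f g) : Q.homology →ₗ[k] A.homology :=
  h.exists_connecting.choose

variable [IsSemisimpleRing k]

theorem connecting_cls (h : ShortExact f g) (z : LinearMap.ker Q.d) (b : B) (a : LinearMap.ker A.d)
    (hb : g.lin b = z.1) (ha : f.lin a.1 = B.d b) : h.connecting (Q.cls z) = A.cls a :=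
  h.exists_connecting.choose_spec z b a hb ha

theorem exact_homologyMap_connecting (h : ShortExact f g) : Function.Exact g.homologyMap.lin h.connecting := by
  intro x
  obtain ⟨z, rfl⟩ := Q.cls_surjective x
  constructor
  · intro hz
    obtain ⟨b, hb⟩ := h.surjective z.1
    obtain ⟨a, ha⟩ := h.exists_lift z b hb
    rw [h.connecting_cls z b a hb ha, cls_eq_zero_iff] at hz
    obtain ⟨y, hy⟩ := hz
    refine ⟨B.cls ⟨b - f.lin y, ?_⟩, ?_⟩
    · rw [LinearMap.mem_ker, map_sub, ← f.map_d, hy, ha, sub_self]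
    · rw [Hom.homologyMap_cls]
      refine congrArg Q.cls (Subtype.ext ?_)
      change g.lin (b - f.lin y) = z.1
      rw [map_sub, h.exact.apply_apply_eq_zero, hb, sub_zero]
  · rintro ⟨y, hy⟩
    obtain ⟨b, rfl⟩ := B.cls_surjective y
    rw [← hy, Hom.homologyMap_cls, h.connecting_cls (g.cyclesMap b) b.1 0 rfl, map_zero]
    have hb : B.d b.1 = 0 := b.2
    rw [hb]
    exact map_zero _

theorem exact_connecting_homologyMap (h : ShortExact f g) : Function.Exact h.connecting f.homologyMap.lin := by
  intro x
  obtain ⟨a, rfl⟩ := A.cls_surjective x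
  constructor
  · intro ha
    rw [Hom.homologyMap_cls, cls_eq_zero_iff] at ha
    obtain ⟨b, hb⟩ := ha
    have hz : Q.d (g.lin b) = 0 := by
      rw [← g.map_d, hb]
      exact h.exact.apply_apply_eq_zero a.1
    exact ⟨Q.cls ⟨g.lin b, hz⟩, h.connecting_cls ⟨g.lin b, hz⟩ b a rfl hb.symm⟩
  · rintro ⟨y, hy⟩
    obtain ⟨z, rfl⟩ := Q.cls_surjective y
    obtain ⟨b, hb⟩ := h.surjective z.1
    obtain ⟨a', ha'⟩ := h.exists_lift z b hb
    rw [← hy, h.connecting_cls z b a' hb ha', Hom.homologyMap_cls, cls_eq_zero_iff]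
    exact ⟨b, ha'.symm⟩

theorem connecting_mem (h : ShortExact f g) (n : ℕ) (x : Q.homology) (hx : x ∈ Q.homology.gr (n + 1)) :
    h.connecting x ∈ A.homology.gr n := by
  obtain ⟨z, hz, rfl⟩ := exists_cls_of_mem hx
  obtain ⟨b, hbm, hb⟩ := IsGraded.exists_mem g.map_mem hz (h.surjective z.1)
  obtain ⟨a, ha⟩ := h.exists_lift z b hb
  rw [h.connecting_cls z b a hb ha]
  refine cls_mem ?_
  have h1 : f.lin (A.proj n a.1) = f.lin a.1 := by
    rw [f.map_proj, ha, proj_same (B.d_mem n b hbm)]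
  rw [← h.injective h1]
  exact proj_mem _ _

theorem connecting_zero (h : ShortExact f g) (x : Q.homology) (hx : x ∈ Q.homology.gr 0) : h.connecting x = 0 := by
  obtain ⟨z, hz, rfl⟩ := exists_cls_of_mem hx
  obtain ⟨b, hbm, hb⟩ := IsGraded.exists_mem g.map_mem hz (h.surjective z.1)
  rw [h.connecting_cls z b 0 hb, map_zero]
  rw [B.d_zero b hbm]
  exact map_zero _

/-- Needed to find homogeneous preimages under the connecting map: it lowers degrees by one, so
`IsGraded` does not apply to it. -/
theorem connecting_proj (h : ShortExact f g) (n : ℕ) (x : Q.homology) :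
    h.connecting (Q.homology.proj (n + 1) x) = A.homology.proj n (h.connecting x) := by
  have : h.connecting ∘ₗ Q.homology.proj (n + 1) = A.homology.proj n ∘ₗ h.connecting := by
    refine lin_ext fun m x hx => ?_
    rcases m with _ | m
    · simp [proj_of_mem hx, h.connecting_zero x hx]
    · simp only [LinearMap.comp_apply, proj_of_mem hx, proj_of_mem (h.connecting_mem m x hx),
        add_left_inj]
      split_ifs <;> simp
  exact LinearMap.congr_fun this x

/-- The connecting homomorphism `H_{n+1}(Q) ⟶ H_n(A)`. -/
noncomputable def connectingGr (h : ShortExact f g) (n : ℕ) : Q.homology.gr (n + 1) →ₗ[k] A.homology.gr n :=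
  h.connecting.restrict (h.connecting_mem n)

theorem exact_connectingGr_homologyMap (h : ShortExact f g) (n : ℕ) : Function.Exact (h.connectingGr n)
    (f.homologyMap.lin.restrict (f.homologyMap.map_mem n)) := by
  rintro ⟨y, hy⟩
  constructor
  · intro h0
    obtain ⟨x, rfl⟩ := (h.exact_connecting_homologyMap y).1 (congrArg Subtype.val h0)
    exact ⟨⟨Q.homology.proj (n + 1) x, proj_mem _ _⟩,
      Subtype.ext ((h.connecting_proj n x).trans (proj_same hy))⟩
  · rintro ⟨x, hx⟩
    exact Subtype.ext ((h.exact_connecting_homologyMap y).2 ⟨x.1, congrArg Subtype.val hx⟩)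

theorem exact_homologyMap_connectingGr (h : ShortExact f g) (n : ℕ) : Function.Exact
    (g.homologyMap.lin.restrict (g.homologyMap.map_mem (n + 1))) (h.connectingGr n) := by
  rintro ⟨y, hy⟩
  constructor
  · intro h0
    obtain ⟨x, hx, hxy⟩ := IsGraded.exists_mem g.homologyMap.map_mem hy
      ((h.exact_homologyMap_connecting y).1 (congrArg Subtype.val h0))
    exact ⟨⟨x, hx⟩, Subtype.ext hxy⟩
  · rintro ⟨x, hx⟩
    exact Subtype.ext ((h.exact_homologyMap_connecting y).2 ⟨x.1, congrArg Subtype.val hx⟩)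

end ShortExact

end DGModule

end LongExact

/-! ### Exactness of the cotensor product, and its value on cofree comodules. -/

section Cotensor

variable {k : Type u} [CommRing k]

/-- Surjections onto `M` split, so `M` is projective. -/
theorem flat_of_isSemisimpleRing [IsSemisimpleRing k] (M : Type u) [AddCommGroup M] [Module k M] :
    Module.Flat k M :=
  have : Module.Projective k M := Module.Projective.of_lifting_property'' fun f hf =>
    IsSemisimpleModule.lifting_property f hf LinearMap.id
  inferInstance

namespace DGModule

variable {M N P Q : DGModule k}

/-- The Koszul sign sees degrees only, so compatibility with differentials plays no role. -/
theorem twist_natural_of_isGraded {f : M →ₗ[k] N} {g : P →ₗ[k] Q} (hf : IsGraded f)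
    (hg : IsGraded g) :
    twist N Q ∘ₗ TensorProduct.map f g = TensorProduct.map g f ∘ₗ twist M P := by
  refine tensor_lin_ext fun i j x hx y hy => ?_
  simp [twist_tmul hx hy, twist_tmul (hf i x hx) (hg j y hy)]

theorem twist_twist (x : M ⊗[k] N) : twist N M (twist M N x) = x := by
  have : twist N M ∘ₗ twist M N = LinearMap.id := by
    refine tensor_lin_ext fun i j x hx y hy => ?_
    simp [twist_tmul hx hy, twist_tmul hy hx, smul_smul, ← pow_add, mul_comm j i, ← two_mul]
  exact LinearMap.congr_fun this x

theorem tensor_lin_ext₃ {V : Type u} [AddCommGroup V] [Module k V]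
    {f g : (M ⊗[k] N) ⊗[k] P →ₗ[k] V}
    (h : ∀ i j l, ∀ x ∈ M.gr i, ∀ y ∈ N.gr j, ∀ z ∈ P.gr l,
      f (x ⊗ₜ y ⊗ₜ z) = g (x ⊗ₜ y ⊗ₜ z)) : f = g := by
  refine TensorProduct.ext (tensor_lin_ext fun i j x hx y hy => lin_ext fun l z hz => ?_)
  exact h i j l x hx y hy z hz

/-- Reversal of the order of three factors, in two ways. -/
theorem twist_reverse (M N P : DGModule k) (t : (M ⊗[k] N) ⊗[k] P) :
    TensorProduct.assoc k P N M (twist M (P.tensor N)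
      ((twist N P).lTensor M (TensorProduct.assoc k M N P t))) =
      (twist M N).lTensor P (twist (M.tensor N) P t) := by
  have : (TensorProduct.assoc k P N M).toLinearMap ∘ₗ twist M (P.tensor N) ∘ₗ
      (twist N P).lTensor M ∘ₗ (TensorProduct.assoc k M N P).toLinearMap =
      (twist M N).lTensor P ∘ₗ twist (M.tensor N) P := by
    refine tensor_lin_ext₃ fun i j l x hx y hy z hz => ?_
    have h1 : x ⊗ₜ[k] y ∈ (M.tensor N).gr (i + j) := tmul_mem_tensorGr hx hy rfl
    have h2 : z ⊗ₜ[k] y ∈ (P.tensor N).gr (l + j) := tmul_mem_tensorGr hz hy rfl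
    simp only [LinearMap.comp_apply, LinearEquiv.coe_coe, TensorProduct.assoc_tmul,
      LinearMap.lTensor_tmul, twist_tmul hy hz, TensorProduct.tmul_smul, map_smul]
    rw [twist_tmul hx h2, twist_tmul (M := M.tensor N) h1 hz]
    simp only [map_smul, TensorProduct.assoc_tmul, LinearMap.lTensor_tmul, twist_tmul hx hy,
      TensorProduct.tmul_smul, smul_smul, ← pow_add]
    congr 2
    ring
  exact LinearMap.congr_fun this t

/-- Reversal of the order of three factors followed by a cyclic permutation. -/
theorem twist_reverse_cyclic (M N P : DGModule k) (t : (M ⊗[k] N) ⊗[k] P) :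
    twist (P.tensor N) M ((TensorProduct.assoc k P N M).symm (twist (N.tensor M) P
      ((twist M N).rTensor P t))) =
      (twist N P).lTensor M (TensorProduct.assoc k M N P t) := by
  have : twist (P.tensor N) M ∘ₗ (TensorProduct.assoc k P N M).symm.toLinearMap ∘ₗ
      twist (N.tensor M) P ∘ₗ (twist M N).rTensor P =
      (twist N P).lTensor M ∘ₗ (TensorProduct.assoc k M N P).toLinearMap := by
    refine tensor_lin_ext₃ fun i j l x hx y hy z hz => ?_
    have h1 : y ⊗ₜ[k] x ∈ (N.tensor M).gr (j + i) := tmul_mem_tensorGr hy hx rfl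
    have h2 : z ⊗ₜ[k] y ∈ (P.tensor N).gr (l + j) := tmul_mem_tensorGr hz hy rfl
    simp only [LinearMap.comp_apply, LinearEquiv.coe_coe, TensorProduct.assoc_tmul,
      LinearMap.rTensor_tmul, LinearMap.lTensor_tmul, twist_tmul hx hy, twist_tmul hy hz,
      TensorProduct.tmul_smul]
    have h3 : twist (N.tensor M) P (((-1 : k) ^ (i * j) • (y ⊗ₜ[k] x)) ⊗ₜ z) =
        (-1 : k) ^ (i * j + (j + i) * l) • (z ⊗ₜ[k] (y ⊗ₜ[k] x)) := by
      rw [← TensorProduct.smul_tmul', map_smul, twist_tmul (M := N.tensor M) h1 hz, smul_smul,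
        pow_add]
    rw [h3, map_smul, TensorProduct.assoc_symm_tmul, map_smul,
      twist_tmul (M := P.tensor N) h2 hx, smul_smul, ← pow_add]
    congr 1
    -- `x` passes each of `y` and `z` twice, which costs no sign; only the exchange of `y` and `z`
    -- remains.
    rw [show i * j + (j + i) * l + (l + j) * i = j * l + 2 * (i * j + i * l) by ring, pow_add,
      pow_mul]
    simp
  exact LinearMap.congr_fun this t

end DGModule

open DGModule

namespace DGComodule

variable {C : DGCoalgebra k} {X X' Y Y' Z : DGComodule C}

/-- Maps of the underlying graded comodules: the differentials are ignored. -/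
structure GrHom (X Y : DGComodule C) where
  /-- the underlying linear map -/
  lin : X →ₗ[k] Y
  map_mem : IsGraded lin
  map_coact : ∀ x, lin.rTensor C (X.coact x) = Y.coact (lin x)

/-- The map of graded comodules underlying a map of dg-comodules. -/
def Hom.toGr (f : Hom X Y) : GrHom X Y := ⟨f.lin, f.map_mem, f.map_coact⟩

namespace GrHom

/-- The identity. -/
def id (X : DGComodule C) : GrHom X X :=
  ⟨LinearMap.id, fun _ _ h => h, fun x => by rw [LinearMap.rTensor_id]; rfl⟩

/-- Composition of maps of graded comodules. -/
def comp (g : GrHom Y Z) (f : GrHom X Y) : GrHom X Z where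
  lin := g.lin ∘ₗ f.lin
  map_mem n x hx := g.map_mem n _ (f.map_mem n x hx)
  map_coact x := by
    rw [LinearMap.rTensor_comp, LinearMap.comp_apply, f.map_coact, g.map_coact]
    rfl

/-- The difference of maps of graded comodules. -/
def sub (f g : GrHom X Y) : GrHom X Y where
  lin := f.lin - g.lin
  map_mem n x hx := sub_mem (f.map_mem n x hx) (g.map_mem n x hx)
  map_coact x := by
    rw [LinearMap.rTensor_sub, LinearMap.sub_apply, f.map_coact, g.map_coact, ← map_sub]
    rfl

theorem map_leftCoact (f : GrHom Y Y') (y : Y) :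
    f.lin.lTensor C (Y.leftCoactHom.lin y) = Y'.leftCoactHom.lin (f.lin y) := by
  have h1 := LinearMap.congr_fun (twist_natural_of_isGraded f.map_mem
    (g := (LinearMap.id : C →ₗ[k] C)) (P := C.toDGModule) (Q := C.toDGModule)
    (fun _ _ h => h)) (Y.coact y)
  have h2 := f.map_coact y
  change TensorProduct.map LinearMap.id f.lin (twist _ _ (Y.coact y)) =
    twist _ _ (Y'.coact (f.lin y))
  rw [← h2]
  exact h1.symm

end GrHom

theorem mem_cotensor_iff (X Y : DGComodule C) (w : X ⊗[k] Y) :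
    w ∈ LinearMap.eqLocus
      ((assocHom X.toDGModule C.toDGModule Y.toDGModule).comp
        (X.coactHom.tensor (DGModule.Hom.id Y.toDGModule))).lin
      ((DGModule.Hom.id X.toDGModule).tensor Y.leftCoactHom).lin ↔
    TensorProduct.assoc k X C Y (X.coact.rTensor Y w) = Y.leftCoactHom.lin.lTensor X w := Iff.rfl

theorem cotensor_eq {X Y : DGComodule C} (w : X.cotensor Y) :
    TensorProduct.assoc k X C Y (X.coact.rTensor Y w.1) = Y.leftCoactHom.lin.lTensor X w.1 := w.2

theorem assoc_coact_lTensor {N : Type u} [AddCommGroup N] [Module k N] (f : Y →ₗ[k] N)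
    (w : X ⊗[k] Y) :
    TensorProduct.assoc k X C N (X.coact.rTensor N (f.lTensor X w)) =
      (f.lTensor C).lTensor X (TensorProduct.assoc k X C Y (X.coact.rTensor Y w)) := by
  have h1 : ∀ (s : X ⊗[k] C) (y : Y), TensorProduct.assoc k X C N (s ⊗ₜ f y) =
      (f.lTensor C).lTensor X (TensorProduct.assoc k X C Y (s ⊗ₜ y)) := by
    intro s y
    induction s using TensorProduct.induction_on with
    | zero => simp
    | tmul a c => simp
    | add a b ha hb => simp only [TensorProduct.add_tmul, map_add, ha, hb]
  induction w using TensorProduct.induction_on with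
  | zero => simp
  | tmul x y => exact h1 _ _
  | add a b ha hb => simp only [map_add, ha, hb]

/-- The map `X □_C Y ⟶ X □_C Y'` induced by a map of graded comodules `Y ⟶ Y'`. -/
noncomputable def grMap (X : DGComodule C) {Y Y' : DGComodule C} (f : GrHom Y Y') :
    X.cotensor Y →ₗ[k] X.cotensor Y' :=
  (f.lin.lTensor X).restrict (by
    intro w hw
    rw [mem_cotensor_iff] at hw ⊢
    rw [assoc_coact_lTensor, hw, ← LinearMap.comp_apply, ← LinearMap.lTensor_comp,
      ← LinearMap.comp_apply, ← LinearMap.lTensor_comp]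
    congr 2
    exact LinearMap.ext f.map_leftCoact)

theorem grMap_coe (X : DGComodule C) (f : GrHom Y Y') (w : X.cotensor Y) :
    (X.grMap f w).1 = f.lin.lTensor X w.1 := rfl

theorem isGraded_grMap (X : DGComodule C) (f : GrHom Y Y') : IsGraded (X.grMap f) := by
  intro n w hw
  refine (tensorGr_le (S := (tensorGr X.toDGModule Y'.toDGModule n).comap (f.lin.lTensor X)) ?_ hw :)
  intro i j x y h hx hy
  exact tmul_mem_tensorGr hx (f.map_mem j y hy) h

/-- Functoriality of the cotensor product in its first variable, used for the retraction of the
coaction of `X`. -/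
theorem rTensor_mem_cotensor (f : GrHom X X') (w : X.cotensor Y) :
    TensorProduct.assoc k X' C Y (X'.coact.rTensor Y (f.lin.rTensor Y w.1)) =
      Y.leftCoactHom.lin.lTensor X' (f.lin.rTensor Y w.1) := by
  have h1 : X'.coact ∘ₗ f.lin = f.lin.rTensor C ∘ₗ X.coact :=
    LinearMap.ext fun x => (f.map_coact x).symm
  have h2 : ∀ t : (X ⊗[k] C) ⊗[k] Y, TensorProduct.assoc k X' C Y ((f.lin.rTensor C).rTensor Y t) =
      f.lin.rTensor (C ⊗[k] Y) (TensorProduct.assoc k X C Y t) := by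
    have : (TensorProduct.assoc k X' C Y).toLinearMap ∘ₗ (f.lin.rTensor C).rTensor Y =
        f.lin.rTensor (C ⊗[k] Y) ∘ₗ (TensorProduct.assoc k X C Y).toLinearMap :=
      TensorProduct.ext_threefold fun x y z => rfl
    exact LinearMap.congr_fun this
  rw [← LinearMap.comp_apply, ← LinearMap.rTensor_comp, h1, LinearMap.rTensor_comp,
    LinearMap.comp_apply, h2, cotensor_eq, ← LinearMap.comp_apply, ← LinearMap.comp_apply,
    LinearMap.rTensor_comp_lTensor, LinearMap.lTensor_comp_rTensor]

/-! ### Left exactness -/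

section Semisimple

variable [IsSemisimpleRing k]

theorem grMap_injective (X : DGComodule C) (f : GrHom Y Y') (hf : Function.Injective f.lin) :
    Function.Injective (X.grMap f) := by
  have := flat_of_isSemisimpleRing (k := k) X
  intro w w' h
  exact Subtype.ext (Module.Flat.lTensor_preserves_injective_linearMap f.lin hf
    (congrArg Subtype.val h))

theorem grMap_exact (X : DGComodule C) (f : GrHom Y Y') (g : GrHom Y' Z)
    (hf : Function.Injective f.lin) (h : Function.Exact f.lin g.lin) :
    Function.Exact (X.grMap f) (X.grMap g) := by
  have := flat_of_isSemisimpleRing (k := k) X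
  have := flat_of_isSemisimpleRing (k := k) C
  intro w
  constructor
  · intro hw
    obtain ⟨v, hv⟩ := (Module.Flat.lTensor_exact X h w.1).1 (congrArg Subtype.val hw)
    refine ⟨⟨v, (mem_cotensor_iff X Y v).2 ?_⟩, Subtype.ext hv⟩
    -- The equalizer equation for `v` may be tested after the injection `X ⊗ C ⊗ f`, where it
    -- becomes the equation of `w`.
    apply Module.Flat.lTensor_preserves_injective_linearMap (M := X) _
      (Module.Flat.lTensor_preserves_injective_linearMap (M := C) f.lin hf)
    rw [← assoc_coact_lTensor, hv, cotensor_eq, ← hv, ← LinearMap.comp_apply,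
      ← LinearMap.lTensor_comp, ← LinearMap.comp_apply, ← LinearMap.lTensor_comp]
    congr 2
    exact (LinearMap.ext f.map_leftCoact).symm
  · rintro ⟨v, rfl⟩
    refine Subtype.ext ?_
    rw [grMap_coe, grMap_coe]
    exact (Module.Flat.lTensor_exact X h).apply_apply_eq_zero v.1

end Semisimple

/-! ### Cotensor products with cofree comodules -/

/-- The left coaction of a comodule over a cocommutative coalgebra is coassociative. -/
theorem leftCoact_coassoc (hC : C.IsCocommutative) (Y : DGComodule C) (y : Y) :
    TensorProduct.assoc k C C Y ((Coalgebra.comul (R := k) (A := C)).rTensor Y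
      (Y.leftCoactHom.lin y)) =
      Y.leftCoactHom.lin.lTensor C (Y.leftCoactHom.lin y) := by
  have h1 : (Coalgebra.comul (R := k) (A := C)).rTensor Y (Y.leftCoactHom.lin y) =
      twist Y.toDGModule (C.toDGModule.tensor C.toDGModule)
        ((Coalgebra.comul (R := k) (A := C)).lTensor Y (Y.coact y)) :=
    (LinearMap.congr_fun (twist_natural (DGModule.Hom.id Y.toDGModule) C.comulHom) (Y.coact y)).symm
  have h2 : Y.coact.lTensor C (Y.leftCoactHom.lin y) =
      twist (Y.toDGModule.tensor C.toDGModule) C.toDGModule (Y.coact.rTensor C (Y.coact y)) :=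
    (LinearMap.congr_fun (twist_natural Y.coactHom (DGModule.Hom.id C.toDGModule)) (Y.coact y)).symm
  have h3 : Y.leftCoactHom.lin = twist Y.toDGModule C.toDGModule ∘ₗ Y.coact := rfl
  -- Passing to the left reverses the tensor factors, so the left coaction is coassociative for the
  -- opposite comultiplication; cocommutativity identifies it with the given one.
  have h4 : twist C.toDGModule C.toDGModule ∘ₗ Coalgebra.comul (R := k) (A := C) =
    Coalgebra.comul (R := k) (A := C) := LinearMap.ext hC
  have h5 := LinearMap.congr_fun Y.coassoc y
  simp only [LinearMap.comp_apply, LinearEquiv.coe_coe] at h5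
  rw [h1, ← h4, LinearMap.lTensor_comp, LinearMap.comp_apply, ← h5]
  rw [twist_reverse Y.toDGModule C.toDGModule C.toDGModule, ← h2, h3, LinearMap.lTensor_comp]
  rfl

/-- `X ⊗ Y` maps to `(X ⊗ C) □_C Y` by the left coaction of `Y`. -/
theorem assoc_symm_leftCoact_mem (hC : C.IsCocommutative) (M : DGModule k) (Y : DGComodule C)
    (w : M ⊗[k] Y) :
    TensorProduct.assoc k (M ⊗[k] C) C Y ((cofree M C).coact.rTensor Y
      ((TensorProduct.assoc k M C Y).symm (Y.leftCoactHom.lin.lTensor M w))) =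
    Y.leftCoactHom.lin.lTensor (M ⊗[k] C)
      ((TensorProduct.assoc k M C Y).symm (Y.leftCoactHom.lin.lTensor M w)) := by
  induction w using TensorProduct.induction_on with
  | zero => simp only [map_zero]
  | add a b ha hb => simp only [map_add, ha, hb]
  | tmul m y =>
    let φ : C ⊗[k] (C ⊗[k] Y) →ₗ[k] (M ⊗[k] C) ⊗[k] (C ⊗[k] Y) :=
      (TensorProduct.mk k M C m).rTensor (C ⊗[k] Y)
    have h0 : ∀ (s : C ⊗[k] C) (y : Y), TensorProduct.assoc k (M ⊗[k] C) C Y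
        ((TensorProduct.assoc k M C C).symm (m ⊗ₜ s) ⊗ₜ y) =
        φ (TensorProduct.assoc k C C Y (s ⊗ₜ y)) := by
      intro s y
      induction s using TensorProduct.induction_on with
      | zero => simp
      | tmul p q => simp [φ]
      | add s t hs ht =>
        simp only [TensorProduct.tmul_add, TensorProduct.add_tmul, map_add, hs, ht]
    have h1 : ∀ t : C ⊗[k] Y, TensorProduct.assoc k (M ⊗[k] C) C Y ((cofree M C).coact.rTensor Y
        ((TensorProduct.assoc k M C Y).symm (m ⊗ₜ t))) =
        φ (TensorProduct.assoc k C C Y ((Coalgebra.comul (R := k) (A := C)).rTensor Y t)) := by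
      intro t
      induction t using TensorProduct.induction_on with
      | zero => simp
      | tmul a b =>
        simp only [TensorProduct.assoc_symm_tmul, LinearMap.rTensor_tmul]
        exact h0 _ _
      | add s t hs ht => simp only [TensorProduct.tmul_add, map_add, hs, ht]
    have h2 : ∀ t : C ⊗[k] Y, Y.leftCoactHom.lin.lTensor (M ⊗[k] C)
        ((TensorProduct.assoc k M C Y).symm (m ⊗ₜ t)) =
        φ (Y.leftCoactHom.lin.lTensor C t) := by
      intro t
      induction t using TensorProduct.induction_on with
      | zero => simp
      | tmul a b => simp [φ]
      | add s t hs ht => simp only [TensorProduct.tmul_add, map_add, hs, ht]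
    rw [LinearMap.lTensor_tmul, h1, h2, leftCoact_coassoc hC]

/-- If the coaction `X ⟶ X ⊗ C` has a retraction of graded comodules, then `X □_C -` preserves
surjections. -/
theorem grMap_surjective (hC : C.IsCocommutative) (r : GrHom (cofree X.toDGModule C) X)
    (hr : ∀ x, r.lin (X.coact x) = x) (g : GrHom Y Y') (hg : Function.Surjective g.lin) :
    Function.Surjective (X.grMap g) := by
  intro w
  -- `w` lifts to `X ⊗ Y`, but perhaps not into the cotensor product. The left coaction of `Y`
  -- pushes the lift into `(X ⊗ C) □_C Y`, and the retraction brings it back to `X □_C Y`.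
  obtain ⟨v, hv⟩ := LinearMap.lTensor_surjective X hg w.1
  let u : (cofree X.toDGModule C).cotensor Y :=
    ⟨(TensorProduct.assoc k X C Y).symm (Y.leftCoactHom.lin.lTensor X v),
      assoc_symm_leftCoact_mem hC X.toDGModule Y v⟩
  refine ⟨⟨r.lin.rTensor Y u.1, rTensor_mem_cotensor r u⟩, Subtype.ext ?_⟩
  rw [grMap_coe]
  change g.lin.lTensor X (r.lin.rTensor Y u.1) = w.1
  have h1 : ∀ t : X ⊗[k] (C ⊗[k] Y), g.lin.lTensor (X ⊗[k] C) ((TensorProduct.assoc k X C Y).symm t) =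
      (TensorProduct.assoc k X C Y').symm ((g.lin.lTensor C).lTensor X t) := by
    intro t
    obtain ⟨t, rfl⟩ := (TensorProduct.assoc k X C Y).surjective t
    rw [LinearEquiv.symm_apply_apply, LinearEquiv.eq_symm_apply]
    have : (TensorProduct.assoc k X C Y').toLinearMap ∘ₗ g.lin.lTensor (X ⊗[k] C) =
        (g.lin.lTensor C).lTensor X ∘ₗ (TensorProduct.assoc k X C Y).toLinearMap :=
      TensorProduct.ext_threefold fun _ _ _ => rfl
    exact LinearMap.congr_fun this t
  have h2 : r.lin ∘ₗ X.coact = LinearMap.id := LinearMap.ext hr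
  rw [← LinearMap.comp_apply, LinearMap.lTensor_comp_rTensor, ← LinearMap.rTensor_comp_lTensor,
    LinearMap.comp_apply]
  change r.lin.rTensor Y' (g.lin.lTensor (X ⊗[k] C) ((TensorProduct.assoc k X C Y).symm
    (Y.leftCoactHom.lin.lTensor X v))) = w.1
  rw [h1, ← LinearMap.comp_apply (LinearMap.lTensor _ _), ← LinearMap.lTensor_comp]
  have h3 : g.lin.lTensor C ∘ₗ Y.leftCoactHom.lin = Y'.leftCoactHom.lin ∘ₗ g.lin :=
    LinearMap.ext g.map_leftCoact
  -- As `w` is in the cotensor product, the left coaction of `Y'` may be traded for the coaction of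
  -- `X`, which `r` undoes.
  rw [h3, LinearMap.lTensor_comp, LinearMap.comp_apply, hv, ← cotensor_eq,
    LinearEquiv.symm_apply_apply]
  change r.lin.rTensor Y' (X.coact.rTensor Y' w.1) = _
  rw [← LinearMap.comp_apply, ← LinearMap.rTensor_comp, h2, LinearMap.rTensor_id]
  rfl

/-- The case of the identity in `map_counitHom_coact`. -/
theorem counitHom_rTensor_coact (M : DGModule k) (t : M ⊗[k] C) :
    (DGCoalgebra.counitHom M C).lin.rTensor C ((cofree M C).coact t) = t := by
  have h := map_counitHom_coact (Hom.mk (DGModule.Hom.id (cofree M C).toDGModule) (fun x => by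
    change LinearMap.rTensor C LinearMap.id _ = _
    rw [LinearMap.rTensor_id]
    rfl) : Hom (cofree M C) (cofree M C)) t
  exact h

/-- The map `X □_C (M ⊗ C) ⟶ X ⊗ M`, `id ⊗ id ⊗ ε`. -/
noncomputable def cotensorCofree (X : DGComodule C) (M : DGModule k) :
    DGModule.Hom (X.cotensor (cofree M C)) (X.toDGModule.tensor M) where
  lin := (DGCoalgebra.counitHom M C).lin.lTensor X ∘ₗ Submodule.subtype _
  map_mem n w hw :=
    ((DGModule.Hom.id X.toDGModule).tensor (DGCoalgebra.counitHom M C)).map_mem n w.1 hw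
  map_d w := ((DGModule.Hom.id X.toDGModule).tensor (DGCoalgebra.counitHom M C)).map_d w.1

/-- Applying the coaction of `X` to the image of `w` recovers `w` up to the invertible twist of `M`
and `C`: the equalizer equation moves the coaction to `M ⊗ C`, where the counit cancels the
comultiplication. -/
theorem cotensorCofree_injective (X : DGComodule C) (M : DGModule k) :
    Function.Injective (X.cotensorCofree M).lin := by
  have key : ∀ w : X.cotensor (cofree M C), TensorProduct.assoc k X C M (X.coact.rTensor M
      ((X.cotensorCofree M).lin w)) = (twist M C.toDGModule).lTensor X w.1 := by
    intro w
    change TensorProduct.assoc k X C M (X.coact.rTensor M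
      ((DGCoalgebra.counitHom M C).lin.lTensor X w.1)) = _
    have h1 := assoc_coact_lTensor (X := X) (Y := cofree M C) (DGCoalgebra.counitHom M C).lin w.1
    refine h1.trans ?_
    rw [cotensor_eq, ← LinearMap.comp_apply, ← LinearMap.lTensor_comp]
    congr 2
    refine LinearMap.ext fun t => ?_
    have h2 := LinearMap.congr_fun (twist_natural (DGCoalgebra.counitHom M C)
      (DGModule.Hom.id C.toDGModule)) ((cofree M C).coact t)
    refine h2.symm.trans ?_
    exact congrArg (twist M C.toDGModule) (counitHom_rTensor_coact M t)
  intro w w' h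
  have h1 := (key w).symm.trans ((congrArg (fun v => TensorProduct.assoc k X C M
    (X.coact.rTensor M v)) h).trans (key w'))
  have h2 := congrArg ((twist C.toDGModule M).lTensor X) h1
  have h3 : twist C.toDGModule M ∘ₗ twist M C.toDGModule = LinearMap.id :=
    LinearMap.ext twist_twist
  rw [← LinearMap.comp_apply, ← LinearMap.lTensor_comp, h3, LinearMap.lTensor_id,
    ← LinearMap.comp_apply, ← LinearMap.lTensor_comp, h3, LinearMap.lTensor_id] at h2
  exact Subtype.ext h2

/-- After the twist, the left coaction of `M ⊗ C` is comultiplication on the left factor of `C ⊗ M`.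
Cocommutativity is needed because the twists reverse the two copies of `C`. -/
theorem leftCoact_twist (hC : C.IsCocommutative) (M : DGModule k) (t : C ⊗[k] M) :
    (cofree M C).leftCoactHom.lin (twist C.toDGModule M t) =
      (twist C.toDGModule M).lTensor C (TensorProduct.assoc k C C M
        ((Coalgebra.comul (R := k) (A := C)).rTensor M t)) := by
  have h1 : (Coalgebra.comul (R := k) (A := C)).lTensor M (twist C.toDGModule M t) =
      twist (C.toDGModule.tensor C.toDGModule) M
        ((Coalgebra.comul (R := k) (A := C)).rTensor M t) :=
    (LinearMap.congr_fun (twist_natural C.comulHom (DGModule.Hom.id M)) t).symm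
  have h4 : twist C.toDGModule C.toDGModule ∘ₗ Coalgebra.comul (R := k) (A := C) =
    Coalgebra.comul (R := k) (A := C) := LinearMap.ext hC
  have h5 := twist_reverse_cyclic C.toDGModule C.toDGModule M
    ((Coalgebra.comul (R := k) (A := C)).rTensor M t)
  rw [← h5, ← LinearMap.comp_apply (LinearMap.rTensor _ _), ← LinearMap.rTensor_comp, h4, ← h1]
  rfl

theorem cotensorCofree_surjective (hC : C.IsCocommutative) (X : DGComodule C) (M : DGModule k) :
    Function.Surjective (X.cotensorCofree M).lin := by
  -- The inverse map: coact on `x`, then move `m` past the factor in `C`. With `m` fixed, `θ` and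
  -- `Θ` reduce membership in the cotensor product to coassociativity of `X`.
  let φ : X ⊗[k] M →ₗ[k] X ⊗[k] (M ⊗[k] C) := (twist C.toDGModule M).lTensor X ∘ₗ
    (TensorProduct.assoc k X C M).toLinearMap ∘ₗ X.coact.rTensor M
  let θ : M → C →ₗ[k] M ⊗[k] C := fun m => twist C.toDGModule M ∘ₗ (TensorProduct.mk k C M).flip m
  let Θ : M → C ⊗[k] C →ₗ[k] C ⊗[k] (M ⊗[k] C) := fun m => (twist C.toDGModule M).lTensor C ∘ₗ
    (TensorProduct.assoc k C C M).toLinearMap ∘ₗ (TensorProduct.mk k (C ⊗[k] C) M).flip m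
  have hΘ : ∀ m, (cofree M C).leftCoactHom.lin ∘ₗ θ m = Θ m ∘ₗ Coalgebra.comul (R := k) (A := C) :=
    fun m => LinearMap.ext fun c => leftCoact_twist hC M (c ⊗ₜ m)
  have hφ : ∀ x m, φ (x ⊗ₜ m) = (θ m).lTensor X (X.coact x) := by
    intro x m
    change (twist C.toDGModule M).lTensor X (TensorProduct.assoc k X C M (X.coact x ⊗ₜ m)) = _
    induction X.coact x using TensorProduct.induction_on with
    | zero => simp
    | tmul a c => simp [θ]
    | add s t hs ht => simp only [TensorProduct.add_tmul, map_add, hs, ht]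
  have hmem : ∀ v, TensorProduct.assoc k X C (M ⊗[k] C) (X.coact.rTensor (M ⊗[k] C) (φ v)) =
      (cofree M C).leftCoactHom.lin.lTensor X (φ v) := by
    intro v
    induction v using TensorProduct.induction_on with
    | zero => simp only [map_zero]
    | add s t hs ht => simp only [map_add, hs, ht]
    | tmul x m =>
      rw [hφ]
      have h0 : ∀ (s : X ⊗[k] C) (c : C), TensorProduct.assoc k X C (M ⊗[k] C) (s ⊗ₜ θ m c) =
          (Θ m).lTensor X (TensorProduct.assoc k X C C (s ⊗ₜ c)) := by
        intro s c
        induction s using TensorProduct.induction_on with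
        | zero => simp
        | tmul p q => simp [Θ, θ]
        | add s t hs ht => simp only [TensorProduct.add_tmul, map_add, hs, ht]
      have h1 : ∀ t : X ⊗[k] C, TensorProduct.assoc k X C (M ⊗[k] C)
          (X.coact.rTensor (M ⊗[k] C) ((θ m).lTensor X t)) =
          (Θ m).lTensor X (TensorProduct.assoc k X C C (X.coact.rTensor C t)) := by
        intro t
        induction t using TensorProduct.induction_on with
        | zero => simp only [map_zero]
        | tmul a c => exact h0 _ _
        | add s t hs ht => simp only [map_add, hs, ht]
      have h2 := LinearMap.congr_fun X.coassoc x
      simp only [LinearMap.comp_apply, LinearEquiv.coe_coe] at h2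
      rw [h1, h2, ← LinearMap.comp_apply, ← LinearMap.lTensor_comp, ← hΘ, LinearMap.lTensor_comp]
      rfl
  intro v
  refine ⟨⟨φ v, (mem_cotensor_iff X (cofree M C) (φ v)).2 (hmem v)⟩, ?_⟩
  change (DGCoalgebra.counitHom M C).lin.lTensor X (φ v) = v
  induction v using TensorProduct.induction_on with
  | zero => simp only [map_zero]
  | add s t hs ht => simp only [map_add, hs, ht]
  | tmul x m =>
    -- The Koszul sign in `θ` disappears because the counit only sees degree zero.
    have hε : (DGCoalgebra.counitHom M C).lin ∘ₗ θ m =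
        (LinearMap.toSpanSingleton k M m) ∘ₗ Coalgebra.counit (R := k) (A := C) := by
      refine DGModule.lin_ext (M := C.toDGModule) fun n c hc => ?_
      change (DGCoalgebra.counitHom M C).lin (twist C.toDGModule M (c ⊗ₜ m)) =
        Coalgebra.counit (R := k) c • m
      induction m using DGModule.induction with
      | zero => simp only [TensorProduct.tmul_zero, map_zero, smul_zero]
      | add a b ha hb => simp only [TensorProduct.tmul_add, map_add, smul_add, ha, hb]
      | mem i m hm =>
        rw [twist_tmul hc hm, map_smul]
        refine (congrArg _ (DGCoalgebra.counitHom_tmul M C m c)).trans ?_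
        rcases n with _ | n
        · simp
        · rw [C.counit_of_mem n c hc, zero_smul, smul_zero]
    rw [hφ, ← LinearMap.comp_apply, ← LinearMap.lTensor_comp, hε, LinearMap.lTensor_comp,
      LinearMap.comp_apply]
    have h2 := LinearMap.congr_fun X.counit_coact x
    simp only [LinearMap.comp_apply] at h2
    rw [h2]
    simp

theorem cotensorCofree_bijective (hC : C.IsCocommutative) (X : DGComodule C) (M : DGModule k) :
    Function.Bijective (X.cotensorCofree M).lin :=
  ⟨X.cotensorCofree_injective M, cotensorCofree_surjective hC X M⟩

end DGComodule

end Cotensor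

/-! ### The resolution by coactions, its connectivity, and fibrant comodules. -/

section CoactionResolution

variable {k : Type u} [CommRing k]

open DGModule

namespace DGComodule

variable {C : DGCoalgebra k}

/-- The coaction as a map from a comodule to a cofree comodule. -/
noncomputable def coactMap (Y : DGComodule C) : Hom Y (cofree Y.toDGModule C) where
  toHom := Y.coactHom
  map_coact y := by
    have h := LinearMap.congr_fun Y.coassoc y
    exact ((TensorProduct.assoc k Y C C).eq_symm_apply).2 h

theorem coactMap_injective (Y : DGComodule C) : Function.Injective Y.coactMap.lin :=
  Function.LeftInverse.injective (g := (DGCoalgebra.counitHom Y.toDGModule C).lin)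
    (counitHom_coact Y)

/-- The projection from the cofree comodule on `Y` to the cokernel of the coaction. -/
noncomputable abbrev coactProj (Y : DGComodule C) :
    Hom (cofree Y.toDGModule C) (coker Y.coactMap) := cokerMap Y.coactMap

theorem coactProj_surjective (Y : DGComodule C) : Function.Surjective Y.coactProj.lin :=
  Submodule.mkQ_surjective _

theorem coactMap_coactProj_exact (Y : DGComodule C) :
    Function.Exact Y.coactMap.lin Y.coactProj.lin :=
  fun _ => Submodule.Quotient.mk_eq_zero _

theorem coact_shortExact (Y : DGComodule C) :
    ShortExact Y.coactMap.toHom Y.coactProj.toHom :=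
  ⟨Y.coactMap_injective, Y.coactMap_coactProj_exact, Y.coactProj_surjective⟩

/-- The iterated cokernels of the coactions. -/
noncomputable def coactSyzygy (Y : DGComodule C) : ℕ → DGComodule C
  | 0 => Y
  | n + 1 => coker (coactSyzygy Y n).coactMap

/-- Over a simply connected coalgebra, the cokernel of the coaction is twice more connected. -/
theorem coker_coactMap_gr_eq_bot (hC : C.IsSimplyConnected) (Y : DGComodule C) (a : ℕ)
    (hY : ∀ n < a, Y.gr n = ⊥) (n : ℕ) (hn : n < a + 2) : (coker Y.coactMap).gr n = ⊥ := by
  obtain ⟨⟨e, he⟩, hee⟩ := hC.1.2 1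
  have hee : Coalgebra.counit (R := k) e = 1 := hee
  have hc : ∀ c ∈ C.gr 0, c = Coalgebra.counit (R := k) c • e := by
    intro c hc
    refine congrArg Subtype.val (a₁ := (⟨c, hc⟩ : C.gr 0))
      (a₂ := ⟨_, Submodule.smul_mem _ _ he⟩) (hC.1.1 ?_)
    change Coalgebra.counit (R := k) c = Coalgebra.counit (R := k) (Coalgebra.counit (R := k) c • e)
    rw [map_smul, hee, smul_eq_mul, mul_one]
  -- Here `C_0 = k e` and `C_1 = 0`, while a factor of degree at least 2 in `C` leaves degree below
  -- `a` for `Y`. So in degree `n < a + 2` only `Y ⊗ e` survives.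
  have h1 : tensorGr Y.toDGModule C.toDGModule n ≤
      LinearMap.range ((TensorProduct.mk k Y C).flip e) := by
    refine tensorGr_le ?_
    intro i j x c hij hx hcj
    rcases j with _ | _ | j
    · refine ⟨Coalgebra.counit (R := k) c • x, ?_⟩
      change (Coalgebra.counit (R := k) c • x) ⊗ₜ[k] e = x ⊗ₜ c
      rw [TensorProduct.smul_tmul, ← hc c hcj]
    · rw [hC.2, Submodule.mem_bot] at hcj
      rw [hcj, TensorProduct.tmul_zero]
      exact zero_mem _
    · rw [hY i (by omega), Submodule.mem_bot] at hx
      rw [hx, TensorProduct.zero_tmul]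
      exact zero_mem _
  have h2 : ∀ y, (DGCoalgebra.counitHom Y.toDGModule C).lin (y ⊗ₜ e) = y := by
    intro y
    refine (DGCoalgebra.counitHom_tmul Y.toDGModule C y e).trans ?_
    rw [hee, one_smul]
  rw [Submodule.eq_bot_iff]
  rintro _ ⟨t, ht, rfl⟩
  refine (Submodule.Quotient.mk_eq_zero _).2 ?_
  obtain ⟨y, rfl⟩ := h1 ht
  have hy : y ∈ Y.gr n := by
    have := (DGCoalgebra.counitHom Y.toDGModule C).map_mem n _ ht
    rwa [LinearMap.flip_apply, TensorProduct.mk_apply, h2] at this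
  refine ⟨y, ?_⟩
  -- The coaction of `y` has the form `y' ⊗ e`, and counitality gives `y' = y`; hence `y ⊗ e` is
  -- zero in the cokernel.
  change Y.coact y = y ⊗ₜ e
  obtain ⟨y', hy'⟩ := h1 (Y.coact_mem n y hy)
  have h3 := counitHom_coact Y y
  change y' ⊗ₜ[k] e = Y.coact y at hy'
  rw [← hy', h2] at h3
  rw [← hy', h3]

theorem coactSyzygy_gr_eq_bot (hC : C.IsSimplyConnected) (Y : DGComodule C) (q n : ℕ)
    (h : n < 2 * q) : (coactSyzygy Y q).gr n = ⊥ := by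
  induction q generalizing n with
  | zero => omega
  | succ q ih => exact coker_coactMap_gr_eq_bot hC _ (2 * q) ih n (by omega)

/-- `X` lives in non-negative degrees, so `X ⊗ Y` vanishes wherever all lower and equal degrees of
`Y` do. -/
theorem cotensor_homology_eq_zero (X Y : DGComodule C) {a n : ℕ} (hY : ∀ m < a, Y.gr m = ⊥)
    (h : n < a) (x : (X.cotensor Y).homology) (hx : x ∈ (X.cotensor Y).homology.gr n) : x = 0 := by
  obtain ⟨z, hz, rfl⟩ := exists_cls_of_mem hx
  have h1 : tensorGr X.toDGModule Y.toDGModule n ≤ ⊥ := by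
    refine tensorGr_le ?_
    intro i j x y hij hx hy
    rw [hY j (by omega), Submodule.mem_bot] at hy
    rw [hy, TensorProduct.tmul_zero]
    exact zero_mem _
  have h2 : z = 0 := Subtype.ext (Subtype.ext ((Submodule.mem_bot k).1 (h1 hz)))
  rw [h2, map_zero]

/-! ### The fibre of a map of comodules -/

section Fiber

variable {B Q : DGComodule C} (g : Hom B Q) (hQ : Q.gr 0 = ⊥)

theorem eq_zero_of_mem_gr_zero {Q : DGComodule C} (hQ : Q.gr 0 = ⊥) {q : Q} (hq : q ∈ Q.gr 0) : q = 0 := by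
  rw [hQ] at hq
  exact (Submodule.mem_bot k).1 hq

/-- The homotopy fibre `B ⊕ Q[-1]` of a chain map to a complex vanishing in degree zero. -/
noncomputable abbrev fiberModule : DGModule k where
  carrier := B × Q
  gr n := (B.gr n).prod (Q.gr (n + 1))
  isInternal := by
    refine isInternal_of_proj _
      (fun n => (B.toDGModule.proj n).prodMap (Q.toDGModule.proj (n + 1))) ?_ ?_ ?_
    · rintro n ⟨x, y⟩ ⟨hx, hy⟩
      exact Prod.ext (proj_same hx) (proj_same hy)
    · rintro m n ⟨x, y⟩ ⟨hx, hy⟩ hne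
      exact Prod.ext (proj_ne hx hne) (proj_ne hy (by omega))
    · rw [eq_top_iff]
      rintro ⟨x, y⟩ -
      have hx : (x, (0 : Q)) ∈ ⨆ n, (B.gr n).prod (Q.gr (n + 1)) := by
        induction x using DGModule.induction with
        | mem n x hx => exact Submodule.mem_iSup_of_mem n ⟨hx, zero_mem _⟩
        | zero => exact zero_mem _
        | add x x' hx hx' => simpa using add_mem hx hx'
      have hy : ((0 : B), y) ∈ ⨆ n, (B.gr n).prod (Q.gr (n + 1)) := by
        induction y using DGModule.induction with
        | mem n y hy =>
          rcases n with _ | n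
          · rw [eq_zero_of_mem_gr_zero hQ hy]
            exact zero_mem _
          · exact Submodule.mem_iSup_of_mem n ⟨zero_mem _, hy⟩
        | zero => exact zero_mem _
        | add y y' hy hy' => simpa using add_mem hy hy'
      simpa using add_mem hx hy
  d := (LinearMap.inl k B Q ∘ₗ B.d + LinearMap.inr k B Q ∘ₗ g.lin).coprod
    (-(LinearMap.inr k B Q ∘ₗ Q.d))
  d_mem := by
    rintro n ⟨x, y⟩ ⟨hx, hy⟩
    have h1 := B.d_mem n x hx
    have h2 := sub_mem (g.map_mem (n + 1) x hx) (Q.d_mem (n + 1) y hy)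
    have : ((LinearMap.inl k B Q ∘ₗ B.d + LinearMap.inr k B Q ∘ₗ g.lin).coprod
        (-(LinearMap.inr k B Q ∘ₗ Q.d))) (x, y) = (B.d x, g.lin x - Q.d y) := by
      simp [sub_eq_add_neg]
    rw [this]
    exact ⟨h1, h2⟩
  d_zero := by
    rintro ⟨x, y⟩ ⟨hx, hy⟩
    have h1 := B.d_zero x hx
    have h2 := eq_zero_of_mem_gr_zero hQ (g.map_mem 0 x hx)
    have h3 := eq_zero_of_mem_gr_zero hQ (Q.d_mem 0 y hy)
    simp [h1, h2, h3]
  d_d := by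
    rintro ⟨x, y⟩
    simp [B.d_d, Q.d_d, g.map_d]

theorem fiberModule_d (x : B) (y : Q) :
    (fiberModule g hQ).d (x, y) = (B.d x, g.lin x - Q.d y) := by
  simp [sub_eq_add_neg]

theorem fiberModule_sgn_inl (x : B) :
    (fiberModule g hQ).sgn (x, 0) = (B.toDGModule.sgn x, 0) := by
  have : (fiberModule g hQ).sgn ∘ₗ LinearMap.inl k B Q =
      LinearMap.inl k B Q ∘ₗ B.toDGModule.sgn := by
    refine lin_ext fun n x hx => ?_
    have h : ((x, 0) : B × Q) ∈ (fiberModule g hQ).gr n := ⟨hx, zero_mem _⟩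
    simp only [LinearMap.comp_apply, LinearMap.inl_apply]
    rw [sgn_of_mem h, sgn_of_mem hx]
    simp
  exact LinearMap.congr_fun this x

/-- The shift of `Q` by one reverses the Koszul sign, in accordance with the minus sign in its
differential. -/
theorem fiberModule_sgn_inr (y : Q) :
    (fiberModule g hQ).sgn (0, y) = -(0, Q.toDGModule.sgn y) := by
  have : (fiberModule g hQ).sgn ∘ₗ LinearMap.inr k B Q =
      -(LinearMap.inr k B Q ∘ₗ Q.toDGModule.sgn) := by
    refine lin_ext fun n y hy => ?_
    rcases n with _ | n
    · rw [eq_zero_of_mem_gr_zero hQ hy, map_zero, map_zero]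
    · have h : ((0, y) : B × Q) ∈ (fiberModule g hQ).gr n := ⟨zero_mem _, hy⟩
      simp only [LinearMap.comp_apply, LinearMap.inr_apply, LinearMap.neg_apply]
      rw [sgn_of_mem h, sgn_of_mem hy]
      simp [pow_succ]
  exact LinearMap.congr_fun this y

theorem tensor_fiberModule_d_inl (t : B ⊗[k] C) :
    ((fiberModule g hQ).tensor C.toDGModule).d ((LinearMap.inl k B Q).rTensor C t) =
      (LinearMap.inl k B Q).rTensor C ((B.toDGModule.tensor C.toDGModule).d t) +
        (LinearMap.inr k B Q).rTensor C (g.lin.rTensor C t) := by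
  induction t using TensorProduct.induction_on with
  | zero => simp only [map_zero, add_zero]
  | add s t hs ht => simp only [map_add, hs, ht]; abel
  | tmul b c =>
    refine (tensor_d_tmul (M := fiberModule g hQ) (N := C.toDGModule) (b, 0) c).trans ?_
    rw [fiberModule_d, fiberModule_sgn_inl, tensor_d_tmul, map_add, LinearMap.rTensor_tmul,
      LinearMap.rTensor_tmul, LinearMap.rTensor_tmul, LinearMap.rTensor_tmul, map_zero, sub_zero]
    have : (B.d b, g.lin b) = LinearMap.inl k B Q (B.d b) + LinearMap.inr k B Q (g.lin b) := by simp
    rw [this, TensorProduct.add_tmul, LinearMap.inl_apply, LinearMap.inl_apply]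
    abel

theorem tensor_fiberModule_d_inr (t : Q ⊗[k] C) :
    ((fiberModule g hQ).tensor C.toDGModule).d ((LinearMap.inr k B Q).rTensor C t) =
      -(LinearMap.inr k B Q).rTensor C ((Q.toDGModule.tensor C.toDGModule).d t) := by
  induction t using TensorProduct.induction_on with
  | zero => simp only [map_zero, neg_zero]
  | add s t hs ht => simp only [map_add, hs, ht]; abel
  | tmul q c =>
    refine (tensor_d_tmul (M := fiberModule g hQ) (N := C.toDGModule) (0, q) c).trans ?_
    rw [fiberModule_d, fiberModule_sgn_inr, tensor_d_tmul, map_add, LinearMap.rTensor_tmul,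
      LinearMap.rTensor_tmul, map_zero, map_zero, zero_sub, TensorProduct.neg_tmul]
    have : ((0 : B), -Q.d q) = -LinearMap.inr k B Q (Q.d q) := by simp
    rw [this, TensorProduct.neg_tmul, LinearMap.inr_apply, LinearMap.inr_apply]
    abel

/-- The homotopy fibre of a map of comodules. -/
noncomputable abbrev fiber : DGComodule C where
  toDGModule := fiberModule g hQ
  coact := ((LinearMap.inl k B Q).rTensor C ∘ₗ B.coact).coprod
    ((LinearMap.inr k B Q).rTensor C ∘ₗ Q.coact)
  coact_mem := by
    rintro n ⟨x, y⟩ ⟨hx, hy⟩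
    rw [LinearMap.coprod_apply]
    refine add_mem ?_ ?_
    · refine (tensorGr_le (S := (tensorGr (fiberModule g hQ) C.toDGModule n).comap
        ((LinearMap.inl k B Q).rTensor C)) ?_ (B.coact_mem n x hx) :)
      intro i j b c h hb hc
      exact tmul_mem_tensorGr (M := fiberModule g hQ) (x := (b, 0)) ⟨hb, zero_mem _⟩ hc h
    · refine (tensorGr_le (S := (tensorGr (fiberModule g hQ) C.toDGModule n).comap
        ((LinearMap.inr k B Q).rTensor C)) ?_ (Q.coact_mem (n + 1) y hy) :)
      intro i j b c h hb hc
      rcases i with _ | i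
      · rw [eq_zero_of_mem_gr_zero hQ hb, TensorProduct.zero_tmul]
        exact zero_mem _
      · exact tmul_mem_tensorGr (M := fiberModule g hQ) (x := (0, b)) (i := i) ⟨zero_mem _, hb⟩ hc
          (by omega)
  coact_d := by
    rintro ⟨x, y⟩
    rw [fiberModule_d, LinearMap.coprod_apply, LinearMap.coprod_apply, map_add]
    simp only [LinearMap.comp_apply]
    rw [tensor_fiberModule_d_inl, tensor_fiberModule_d_inr, map_sub, B.coact_d, Q.coact_d, map_sub,
      g.map_coact]
    abel
  coassoc := by
    -- Forgetting differentials, the coaction is that of a direct sum, so the axiom is checked on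
    -- each summand.
    have key : ∀ {V : Type u} [AddCommGroup V] [Module k V] (ι : V →ₗ[k] B × Q)
        (ρ : V →ₗ[k] V ⊗[k] C) (σ : B × Q →ₗ[k] (B × Q) ⊗[k] C), σ ∘ₗ ι = ι.rTensor C ∘ₗ ρ →
        (TensorProduct.assoc k V C C).toLinearMap ∘ₗ ρ.rTensor C ∘ₗ ρ =
          (Coalgebra.comul (R := k) (A := C)).lTensor V ∘ₗ ρ →
        ∀ v, TensorProduct.assoc k (B × Q) C C (σ.rTensor C (σ (ι v))) =
          (Coalgebra.comul (R := k) (A := C)).lTensor (B × Q) (σ (ι v)) := by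
      intro V _ _ ι ρ σ h1 h2 v
      have h3 : σ (ι v) = ι.rTensor C (ρ v) := LinearMap.congr_fun h1 v
      have h4 : ∀ t : (V ⊗[k] C) ⊗[k] C, TensorProduct.assoc k (B × Q) C C
          ((ι.rTensor C).rTensor C t) = ι.rTensor (C ⊗[k] C) (TensorProduct.assoc k V C C t) := by
        have : (TensorProduct.assoc k (B × Q) C C).toLinearMap ∘ₗ (ι.rTensor C).rTensor C =
            ι.rTensor (C ⊗[k] C) ∘ₗ (TensorProduct.assoc k V C C).toLinearMap :=
          TensorProduct.ext_threefold fun x y z => rfl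
        exact LinearMap.congr_fun this
      have h5 := LinearMap.congr_fun h2 v
      simp only [LinearMap.comp_apply, LinearEquiv.coe_coe] at h5
      rw [h3, ← LinearMap.comp_apply, ← LinearMap.rTensor_comp, h1, LinearMap.rTensor_comp,
        LinearMap.comp_apply, h4, h5, ← LinearMap.comp_apply, LinearMap.rTensor_comp_lTensor,
        ← LinearMap.lTensor_comp_rTensor]
      rfl
    refine LinearMap.prod_ext (LinearMap.ext fun x => ?_) (LinearMap.ext fun y => ?_)
    · exact key (LinearMap.inl k B Q) B.coact _ (LinearMap.coprod_inl _ _) B.coassoc x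
    · exact key (LinearMap.inr k B Q) Q.coact _ (LinearMap.coprod_inr _ _) Q.coassoc y
  counit_coact := by
    have key : ∀ {V : Type u} [AddCommGroup V] [Module k V] (ι : V →ₗ[k] B × Q)
        (ρ : V →ₗ[k] V ⊗[k] C), (Coalgebra.counit (R := k) (A := C)).lTensor V ∘ₗ ρ =
          (TensorProduct.mk k V k).flip 1 →
        ∀ v, (Coalgebra.counit (R := k) (A := C)).lTensor (B × Q) (ι.rTensor C (ρ v)) =
          ι v ⊗ₜ 1 := by
      intro V _ _ ι ρ h v
      have h2 := LinearMap.congr_fun h v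
      rw [LinearMap.comp_apply] at h2
      rw [← LinearMap.comp_apply, LinearMap.lTensor_comp_rTensor, ← LinearMap.rTensor_comp_lTensor,
        LinearMap.comp_apply, h2]
      rfl
    refine LinearMap.prod_ext (LinearMap.ext fun x => ?_) (LinearMap.ext fun y => ?_)
    · simp only [LinearMap.comp_apply, LinearMap.inl_apply, LinearMap.coprod_apply, map_zero,
        add_zero]
      exact key (LinearMap.inl k B Q) B.coact B.counit_coact x
    · simp only [LinearMap.comp_apply, LinearMap.inr_apply, LinearMap.coprod_apply, map_zero,
        zero_add]
      exact key (LinearMap.inr k B Q) Q.coact Q.counit_coact y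

variable {g} {A : DGComodule C} {f : Hom A B}

/-- A map whose composition with `g` vanishes lifts to the homotopy fibre of `g`. -/
noncomputable def toFiber (h : ∀ a, g.lin (f.lin a) = 0) : Hom A (fiber g hQ) where
  lin := LinearMap.inl k B Q ∘ₗ f.lin
  map_mem n x hx := ⟨f.map_mem n x hx, zero_mem _⟩
  map_d x := by
    refine Eq.trans ?_ (fiberModule_d g hQ (f.lin x) 0).symm
    rw [h, map_zero, sub_zero, ← f.map_d]
    rfl
  map_coact x := by
    rw [LinearMap.rTensor_comp, LinearMap.comp_apply, f.map_coact]
    change _ = (((LinearMap.inl k B Q).rTensor C ∘ₗ B.coact).coprod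
      ((LinearMap.inr k B Q).rTensor C ∘ₗ Q.coact)) (f.lin x, 0)
    rw [LinearMap.coprod_apply, map_zero, add_zero]
    rfl

/-- The kernel of a surjective chain map is equivalent to its homotopy fibre. Lifting the second
coordinate to `b'` and subtracting `d b'` from the first moves cycles and bounding elements into the
kernel. -/
theorem toFiber_isQuasiIso (h : ShortExact f.toHom g.toHom) :
    (toFiber hQ (f := f) (g := g) h.exact.apply_apply_eq_zero).toHom.IsQuasiIso := by
  constructor
  · refine (injective_iff_map_eq_zero _).2 fun x hx => ?_
    obtain ⟨z, rfl⟩ := A.cls_surjective x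
    rw [Hom.homologyMap_cls, cls_eq_zero_iff] at hx
    obtain ⟨⟨b, q⟩, hy⟩ := hx
    rw [fiberModule_d g hQ] at hy
    have h1 : B.d b = f.lin z.1 := congrArg Prod.fst hy
    have h2 : g.lin b - Q.d q = 0 := congrArg Prod.snd hy
    obtain ⟨b', rfl⟩ := h.surjective q
    rw [← g.map_d, ← map_sub] at h2
    obtain ⟨y, hy⟩ := (h.exact _).1 h2
    refine (cls_eq_zero_iff z).2 ⟨y, h.injective ?_⟩
    rw [f.map_d, hy, map_sub, B.d_d, sub_zero, h1]
  · intro x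
    obtain ⟨⟨⟨b, q⟩, hz⟩, rfl⟩ := (fiberModule g hQ).cls_surjective x
    rw [LinearMap.mem_ker, fiberModule_d] at hz
    have h1 : B.d b = 0 := congrArg Prod.fst hz
    have h2 : g.lin b - Q.d q = 0 := congrArg Prod.snd hz
    obtain ⟨b', rfl⟩ := h.surjective q
    rw [← g.map_d, ← map_sub] at h2
    obtain ⟨y, hy⟩ := (h.exact _).1 h2
    have hd : A.d y = 0 := h.injective (by
      rw [f.map_d, hy, map_sub, B.d_d, sub_zero, h1, map_zero])
    refine ⟨A.cls ⟨y, hd⟩, ?_⟩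
    rw [Hom.homologyMap_cls, ← sub_eq_zero, ← map_sub, cls_eq_zero_iff]
    -- The boundary of `(b', 0)` is `(d b', g b')`, precisely the difference between the cycle `(b,
    -- g b')` and its corrected version `(b - d b', 0)`.
    refine ⟨-(b', 0), ?_⟩
    rw [map_neg, fiberModule_d g hQ, map_zero, sub_zero]
    change -(B.d b', g.lin b') = (f.lin y, 0) - (b, g.lin b')
    rw [hy, Prod.mk_sub_mk, Prod.neg_mk]
    refine Prod.ext ?_ ?_ <;> simp

end Fiber

/-- The coaction of a fibrant comodule over a simply connected coalgebra has a retraction of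
graded comodules. -/
theorem IsFibrant.exists_retraction {X : DGComodule C} (hX : X.IsFibrant)
    (hC : C.IsSimplyConnected) :
    ∃ r : GrHom (cofree X.toDGModule C) X, ∀ x, r.lin (X.coact x) = x := by
  have hQ : (coker X.coactMap).gr 0 = ⊥ :=
    coker_coactMap_gr_eq_bot hC X 0 (fun _ h => absurd h (Nat.not_lt_zero _)) 0 (by omega)
  have h := X.coact_shortExact
  let i := toFiber hQ (f := X.coactMap) (g := X.coactProj) h.exact.apply_apply_eq_zero
  have hi : Function.Injective i.lin := fun x y hxy => h.injective (congrArg Prod.fst hxy)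
  -- Fibrancy extends the identity of `X` over the fibre.
  obtain ⟨G, hG⟩ := hX X _ i hi (toFiber_isQuasiIso hQ h)
    ⟨DGModule.Hom.id _, fun x => by
      change LinearMap.rTensor C LinearMap.id _ = _
      rw [LinearMap.rTensor_id]
      rfl⟩
  -- The summand `X ⊗ C` of the fibre is closed under the coaction but not under the differential,
  -- which is why the retraction is only a map of graded comodules.
  refine ⟨⟨G.lin ∘ₗ LinearMap.inl k _ _, fun n x hx => G.map_mem n _ ⟨hx, zero_mem _⟩,
    fun x => ?_⟩, hG⟩
  refine Eq.trans ?_ (G.map_coact (x, 0))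
  change _ = G.lin.rTensor C (LinearMap.coprod _ _ (x, 0))
  rw [LinearMap.coprod_apply, map_zero, add_zero, LinearMap.rTensor_comp]
  rfl

end DGComodule

end CoactionResolution

/-! ### Injective graded comodules. -/

section GradedInjective

variable {k : Type u} [CommRing k]

open DGModule

namespace DGComodule

variable {C : DGCoalgebra k}

/-- The inverse of a bijective map of graded comodules. -/
theorem GrHom.exists_inverse {X Y : DGComodule C} (f : GrHom X Y)
    (hf : Function.Bijective f.lin) :
    ∃ g : GrHom Y X, (∀ x, g.lin (f.lin x) = x) ∧ ∀ y, f.lin (g.lin y) = y := by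
  let e := LinearEquiv.ofBijective f.lin hf
  have he : ∀ y, f.lin (e.symm y) = y := e.apply_symm_apply
  refine ⟨⟨e.symm.toLinearMap, fun n y hy => ?_, fun y => ?_⟩, e.symm_apply_apply, he⟩
  · have h1 : f.lin (X.toDGModule.proj n (e.symm y)) = f.lin (e.symm y) := by
      rw [f.map_mem.map_proj, he, proj_same hy]
    have h2 := proj_mem (M := X.toDGModule) n (e.symm y)
    rw [hf.1 h1] at h2
    exact h2
  · have h1 := f.map_coact (e.symm y)
    rw [he] at h1
    rw [← h1, ← LinearMap.comp_apply, ← LinearMap.rTensor_comp]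
    have : e.symm.toLinearMap ∘ₗ f.lin = LinearMap.id := LinearMap.ext e.symm_apply_apply
    rw [this, LinearMap.rTensor_id]
    rfl

theorem grMap_bijective (X : DGComodule C) {Y Y' : DGComodule C} (f : GrHom Y Y')
    (hf : Function.Bijective f.lin) : Function.Bijective (X.grMap f) := by
  obtain ⟨g, h1, h2⟩ := f.exists_inverse hf
  refine Function.bijective_iff_has_inverse.2 ⟨X.grMap g, fun w => ?_, fun w => ?_⟩
  · refine Subtype.ext ?_
    have : g.lin ∘ₗ f.lin = LinearMap.id := LinearMap.ext h1
    rw [grMap_coe, grMap_coe, ← LinearMap.comp_apply, ← LinearMap.lTensor_comp, this,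
      LinearMap.lTensor_id]
    rfl
  · refine Subtype.ext ?_
    have : f.lin ∘ₗ g.lin = LinearMap.id := LinearMap.ext h2
    rw [grMap_coe, grMap_coe, ← LinearMap.comp_apply, ← LinearMap.lTensor_comp, this,
      LinearMap.lTensor_id]
    rfl

/-- Injectivity in the category of graded comodules. -/
def IsGrInjective (J : DGComodule C) : Prop :=
  ∀ (A B : DGComodule C) (i : GrHom A B), Function.Injective i.lin →
    ∀ f : GrHom A J, ∃ g : GrHom B J, ∀ a, g.lin (i.lin a) = f.lin a

theorem IsGrInjective.of_bijective {J J' : DGComodule C} (hJ : J.IsGrInjective) (e : GrHom J J')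
    (he : Function.Bijective e.lin) : J'.IsGrInjective := by
  intro A B i hi f
  obtain ⟨e', -, h2⟩ := e.exists_inverse he
  obtain ⟨g, hg⟩ := hJ A B i hi (e'.comp f)
  refine ⟨e.comp g, fun a => ?_⟩
  change e.lin (g.lin (i.lin a)) = _
  rw [hg]
  exact h2 _

/-- A graded linear map `B ⟶ M` gives a map of graded comodules `B ⟶ M ⊗ C`. -/
noncomputable def grCofreeLift {M : DGModule k} {B : DGComodule C} (g : B →ₗ[k] M)
    (hg : IsGraded g) : GrHom B (cofree M C) where
  lin := g.rTensor C ∘ₗ B.coact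
  map_mem n x hx := by
    refine (tensorGr_le (S := (tensorGr M C.toDGModule n).comap (g.rTensor C)) ?_
      (B.coact_mem n x hx) :)
    intro i j x c h hx hc
    exact tmul_mem_tensorGr (hg i x hx) hc h
  map_coact x := by
    refine ((TensorProduct.assoc k M C C).eq_symm_apply).2 ?_
    have h1 : ∀ t : (B ⊗[k] C) ⊗[k] C, TensorProduct.assoc k M C C ((g.rTensor C).rTensor C t) =
        g.rTensor (C ⊗[k] C) (TensorProduct.assoc k B C C t) := by
      have : (TensorProduct.assoc k M C C).toLinearMap ∘ₗ (g.rTensor C).rTensor C =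
          g.rTensor (C ⊗[k] C) ∘ₗ (TensorProduct.assoc k B C C).toLinearMap :=
        TensorProduct.ext_threefold fun x y z => rfl
      exact LinearMap.congr_fun this
    have h2 := LinearMap.congr_fun B.coassoc x
    simp only [LinearMap.comp_apply, LinearEquiv.coe_coe] at h2
    rw [LinearMap.rTensor_comp, LinearMap.comp_apply, h1, h2, ← LinearMap.comp_apply,
      LinearMap.rTensor_comp_lTensor, ← LinearMap.lTensor_comp_rTensor]
    rfl

/-- Graded comodule maps into `M ⊗ C` correspond to graded linear maps into `M`, and these extend
along injections over a semisimple ring. Since differentials are ignored, no disk complex is needed.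
-/
theorem isGrInjective_cofree [IsSemisimpleRing k] (M : DGModule k) (C : DGCoalgebra k) :
    (cofree M C).IsGrInjective := by
  intro A B i hi f
  let f' : A →ₗ[k] M := (DGCoalgebra.counitHom M C).lin ∘ₗ f.lin
  have hf' : IsGraded f' := fun n x hx =>
    (DGCoalgebra.counitHom M C).map_mem n _ (f.map_mem n x hx)
  obtain ⟨g0, hg0⟩ := IsSemisimpleModule.extension_property i.lin hi f'
  -- The linear extension `g0` need not preserve degrees; only its degree zero component is kept.
  let g1 : B →ₗ[k] M := B.toDGModule.glue fun n => M.proj n ∘ₗ g0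
  have hg1 : IsGraded g1 := by
    intro n x hx
    simp only [g1]
    rw [glue_of_mem _ hx]
    exact proj_mem n (g0 x)
  have hg1i : g1 ∘ₗ i.lin = f' := by
    refine DGModule.lin_ext fun n x hx => ?_
    have h1 : g0 (i.lin x) = f' x := LinearMap.congr_fun hg0 x
    simp only [g1, LinearMap.comp_apply]
    rw [glue_of_mem _ (i.map_mem n x hx), LinearMap.comp_apply, h1, proj_same (hf' n x hx)]
  refine ⟨grCofreeLift g1 hg1, fun a => ?_⟩
  change g1.rTensor C (B.coact (i.lin a)) = f.lin a
  rw [← i.map_coact, ← LinearMap.comp_apply, ← LinearMap.rTensor_comp, hg1i,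
    LinearMap.rTensor_comp, LinearMap.comp_apply, f.map_coact]
  exact counitHom_rTensor_coact M (f.lin a)

end DGComodule

end GradedInjective

/-! ### Homology of comodules and of cotensor products. -/

section HomologyComodule

variable {k : Type u} [CommRing k]

open DGModule

namespace DGModule

variable {M N P : DGModule k}

theorem Hom.homologyMap_comp (g : Hom N P) (f : Hom M N) (x : M.homology) :
    (g.comp f).homologyMap.lin x = g.homologyMap.lin (f.homologyMap.lin x) := by
  obtain ⟨z, rfl⟩ := M.cls_surjective x
  rfl

theorem Hom.homologyMap_id (x : M.homology) : (Hom.id M).homologyMap.lin x = x := by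
  obtain ⟨z, rfl⟩ := M.cls_surjective x
  rfl

theorem Hom.homologyMap_id_lin (M : DGModule k) : (Hom.id M).homologyMap.lin = LinearMap.id :=
  LinearMap.ext Hom.homologyMap_id

theorem Hom.homologyMap_congr {f g : Hom M N} (h : ∀ x, f.lin x = g.lin x) :
    f.homologyMap = g.homologyMap := by
  have : f = g := Hom.ext (LinearMap.ext h)
  rw [this]

theorem Hom.homologyMap_bijective (f : Hom M N) (hf : Function.Bijective f.lin) :
    Function.Bijective f.homologyMap.lin := by
  constructor
  · refine (injective_iff_map_eq_zero _).2 fun x hx => ?_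
    obtain ⟨z, rfl⟩ := M.cls_surjective x
    rw [Hom.homologyMap_cls, cls_eq_zero_iff] at hx
    obtain ⟨y, hy⟩ := hx
    obtain ⟨y, rfl⟩ := hf.2 y
    exact (cls_eq_zero_iff z).2 ⟨y, hf.1 (by rw [f.map_d, hy]; rfl)⟩
  · intro x
    obtain ⟨⟨z, hz⟩, rfl⟩ := N.cls_surjective x
    obtain ⟨y, rfl⟩ := hf.2 z
    have hy : M.d y = 0 := hf.1 (by rw [f.map_d, map_zero]; exact hz)
    exact ⟨M.cls ⟨y, hy⟩, rfl⟩

/-- Cycles can be chosen in the degrees of their classes, so both twists produce the same sign. -/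
theorem kunnethMap_twist (t : M.homology ⊗[k] N.homology) :
    kunnethMap N M (twist M.homology N.homology t) =
      (twistHom M N).homologyMap.lin (kunnethMap M N t) := by
  have : kunnethMap N M ∘ₗ twist M.homology N.homology =
      (twistHom M N).homologyMap.lin ∘ₗ kunnethMap M N := by
    refine tensor_lin_ext fun i j x hx y hy => ?_
    obtain ⟨z, hz, rfl⟩ := exists_cls_of_mem hx
    obtain ⟨w, hw, rfl⟩ := exists_cls_of_mem hy
    rw [LinearMap.comp_apply, LinearMap.comp_apply, twist_tmul hx hy, map_smul, kunnethMap_cls,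
      kunnethMap_cls, Hom.homologyMap_cls, ← map_smul]
    exact congrArg (N.tensor M).cls (Subtype.ext (twist_tmul hz hw).symm)
  exact LinearMap.congr_fun this t

theorem kunnethMap_lTensor (f : Hom N P) (t : M.homology ⊗[k] N.homology) :
    kunnethMap M P (f.homologyMap.lin.lTensor M.homology t) =
      ((Hom.id M).tensor f).homologyMap.lin (kunnethMap M N t) := by
  have h := LinearMap.congr_fun (kunnethMap_natural (Hom.id M) f) t
  rw [Hom.homologyMap_id_lin] at h
  exact h

theorem kunnethMap_rTensor (f : Hom N P) (t : N.homology ⊗[k] M.homology) :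
    kunnethMap P M (f.homologyMap.lin.rTensor M.homology t) =
      (f.tensor (Hom.id M)).homologyMap.lin (kunnethMap N M t) := by
  have h := LinearMap.congr_fun (kunnethMap_natural f (Hom.id M)) t
  rw [Hom.homologyMap_id_lin] at h
  exact h

theorem kunnethMap_assoc_apply (t : (M.homology ⊗[k] N.homology) ⊗[k] P.homology) :
    (assocHom M N P).homologyMap.lin (kunnethMap (M.tensor N) P
        ((kunnethMap M N).rTensor P.homology t)) =
      kunnethMap M (N.tensor P) ((kunnethMap N P).lTensor M.homology
        (TensorProduct.assoc k M.homology N.homology P.homology t)) :=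
  LinearMap.congr_fun (kunnethMap_assoc M N P) t

variable [IsSemisimpleRing k]

theorem kunnethMap_comp_homologyCoaction (f : Hom M (N.tensor P)) :
    kunnethMap N P ∘ₗ homologyCoaction f = f.homologyMap.lin :=
  LinearMap.ext (kunnethMap_homologyCoaction f)

theorem homologyCoaction_natural {M' N' : DGModule k} {f : Hom M M'} {g : Hom N N'}
    {a : Hom M (N.tensor P)} {b : Hom M' (N'.tensor P)}
    (h : ∀ x, g.lin.rTensor P (a.lin x) = b.lin (f.lin x)) (x : M.homology) :
    g.homologyMap.lin.rTensor P.homology (homologyCoaction a x) =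
      homologyCoaction b (f.homologyMap.lin x) := by
  apply (kunnethMap_bijective N' P).1
  rw [kunnethMap_rTensor, kunnethMap_homologyCoaction, kunnethMap_homologyCoaction,
    ← Hom.homologyMap_comp, ← Hom.homologyMap_comp]
  exact LinearMap.congr_fun (congrArg Hom.lin (Hom.homologyMap_congr
    (f := (g.tensor (Hom.id P)).comp a) (g := b.comp f) h)) x

theorem kunnethMap_twist_homologyCoaction (a : Hom M (N.tensor P)) (x : M.homology) :
    kunnethMap P N (twist N.homology P.homology (homologyCoaction a x)) =
      ((twistHom N P).comp a).homologyMap.lin x := by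
  rw [kunnethMap_twist, kunnethMap_homologyCoaction, ← Hom.homologyMap_comp]

theorem kunnethMap_lTensor_injective (M N P : DGModule k) : Function.Injective
    (kunnethMap M (N.tensor P) ∘ₗ (kunnethMap N P).lTensor M.homology) :=
  (kunnethMap_bijective M (N.tensor P)).1.comp
    (TensorProduct.congr (LinearEquiv.refl k M.homology) (kunneth N P)).injective

/-- The equalizer equation of chain maps induces one in homology, read through the Künneth
isomorphisms. The map `l` is kept general because the left coaction on homology is built with the
twist and is not literally a `homologyCoaction`. -/
theorem homologyCoaction_equalizer {W : DGModule k} {a : Hom M (M.tensor P)}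
    {b : Hom N (P.tensor N)} {ι : Hom W (M.tensor N)}
    (h : ∀ w, TensorProduct.assoc k M P N (a.lin.rTensor N (ι.lin w)) =
      b.lin.lTensor M (ι.lin w))
    (l : N.homology →ₗ[k] P.homology ⊗[k] N.homology)
    (hl : kunnethMap P N ∘ₗ l = b.homologyMap.lin) (x : W.homology) :
    TensorProduct.assoc k M.homology P.homology N.homology ((homologyCoaction a).rTensor N.homology
        ((kunneth M N).symm (ι.homologyMap.lin x))) =
      l.lTensor M.homology ((kunneth M N).symm (ι.homologyMap.lin x)) := by
  apply kunnethMap_lTensor_injective M P N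
  rw [LinearMap.comp_apply, LinearMap.comp_apply, ← kunnethMap_assoc_apply,
    ← LinearMap.comp_apply (LinearMap.rTensor _ _),
    ← LinearMap.rTensor_comp, kunnethMap_comp_homologyCoaction, kunnethMap_rTensor,
    ← LinearMap.comp_apply (LinearMap.lTensor _ _), ← LinearMap.lTensor_comp,
    hl, kunnethMap_lTensor, kunnethMap_kunneth_symm, ← Hom.homologyMap_comp,
    ← Hom.homologyMap_comp, ← Hom.homologyMap_comp]
  exact LinearMap.congr_fun (congrArg Hom.lin (Hom.homologyMap_congr
    (f := ((assocHom M P N).comp (a.tensor (Hom.id N))).comp ι)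
    (g := ((Hom.id M).tensor b).comp ι) h)) x

end DGModule

variable [IsSemisimpleRing k]

theorem DGCoalgebra.IsCocommutative.homology {C : DGCoalgebra k} (hC : C.IsCocommutative) :
    C.homology.IsCocommutative := by
  intro x
  apply (kunnethMap_bijective C.toDGModule C.toDGModule).1
  change kunnethMap _ _ (twist _ _ (homologyCoaction C.comulHom x)) =
    kunnethMap _ _ (homologyCoaction C.comulHom x)
  rw [kunnethMap_twist, kunnethMap_homologyCoaction, ← Hom.homologyMap_comp]
  exact LinearMap.congr_fun (congrArg Hom.lin (Hom.homologyMap_congr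
    (f := (twistHom C.toDGModule C.toDGModule).comp C.comulHom) (g := C.comulHom) hC)) x

namespace DGComodule

variable {C : DGCoalgebra k}

/-- The map of `H_*(C)`-comodules induced by a map of `C`-comodules. -/
noncomputable def Hom.homology {X Y : DGComodule C} (f : Hom X Y) :
    GrHom X.homology Y.homology where
  lin := f.homologyMap.lin
  map_mem := f.homologyMap.map_mem
  map_coact := homologyCoaction_natural f.map_coact

/-- The Künneth isomorphism as a map of comodules from the cofree comodule on `H_*(M)` to the
homology of the cofree comodule on `M`. -/
noncomputable def kunnethCofree (M : DGModule k) (C : DGCoalgebra k) :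
    GrHom (cofree M.homology C.homology) (cofree M C).homology where
  lin := kunnethMap M C.toDGModule
  map_mem := kunnethMap_mem
  map_coact t := by
    apply (kunnethMap_bijective (M.tensor C.toDGModule) C.toDGModule).1
    -- After the associativity isomorphism, both sides are the map induced in homology by `id ⊗ Δ`.
    have hinj : Function.Injective
        (assocHom M C.toDGModule C.toDGModule).homologyMap.lin :=
      (Hom.homologyMap_bijective _ (TensorProduct.assoc k M C C).bijective).1
    apply hinj
    change (assocHom M C.toDGModule C.toDGModule).homologyMap.lin (kunnethMap _ _
      ((kunnethMap M C.toDGModule).rTensor C.toDGModule.homology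
        ((TensorProduct.assoc k _ _ _).symm
          ((homologyCoaction C.comulHom).lTensor M.homology t)))) =
      (assocHom M C.toDGModule C.toDGModule).homologyMap.lin (kunnethMap _ _
        (homologyCoaction (cofree M C).coactHom (kunnethMap M C.toDGModule t)))
    rw [kunnethMap_assoc_apply, LinearEquiv.apply_symm_apply, kunnethMap_homologyCoaction,
      ← LinearMap.comp_apply (LinearMap.lTensor _ _), ← LinearMap.lTensor_comp,
      kunnethMap_comp_homologyCoaction, kunnethMap_lTensor, ← Hom.homologyMap_comp]
    refine LinearMap.congr_fun (congrArg DGModule.Hom.lin (Hom.homologyMap_congr fun x => ?_)) _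
    exact ((TensorProduct.assoc k M C C).apply_symm_apply _).symm

theorem isGrInjective_homology_cofree (M : DGModule k) (C : DGCoalgebra k) :
    (cofree M C).homology.IsGrInjective :=
  (isGrInjective_cofree M.homology C.homology).of_bijective (kunnethCofree M C)
    (kunnethMap_bijective M C.toDGModule)

/-! ### The homology of the coaction sequence -/

/-- The retraction `id ⊗ ε` of the coaction is a chain map and passes to homology. -/
theorem homology_coactMap_injective (Y : DGComodule C) :
    Function.Injective Y.coactMap.homology.lin := by
  refine Function.LeftInverse.injective
    (g := (DGCoalgebra.counitHom Y.toDGModule C).homologyMap.lin) fun x => ?_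
  refine (Hom.homologyMap_comp (DGCoalgebra.counitHom Y.toDGModule C) Y.coactHom x).symm.trans ?_
  have h : ((DGCoalgebra.counitHom Y.toDGModule C).comp Y.coactHom).homologyMap =
    (DGModule.Hom.id Y.toDGModule).homologyMap := Hom.homologyMap_congr (counitHom_coact Y)
  rw [h, Hom.homologyMap_id]

theorem homology_coactMap_coactProj_exact (Y : DGComodule C) :
    Function.Exact Y.coactMap.homology.lin Y.coactProj.homology.lin :=
  Y.coact_shortExact.exact_homologyMap

/-- The map after the connecting homomorphism is injective, so the connecting homomorphism is zero
and the long exact sequence breaks into short ones. -/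
theorem homology_coactProj_surjective (Y : DGComodule C) :
    Function.Surjective Y.coactProj.homology.lin := by
  intro x
  refine (Y.coact_shortExact.exact_homologyMap_connecting x).1 ?_
  apply Y.homology_coactMap_injective
  refine Eq.trans ?_ (map_zero _).symm
  exact Y.coact_shortExact.exact_connecting_homologyMap.apply_apply_eq_zero x

/-! ### The homology of a cotensor product -/

/-- The inclusion of the cotensor product in the tensor product. -/
noncomputable def cotensorIncl (X Z : DGComodule C) :
    DGModule.Hom (X.cotensor Z) (X.toDGModule.tensor Z.toDGModule) :=
  ⟨Submodule.subtype _, fun _ _ h => h, fun _ => rfl⟩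

theorem kunnethMap_leftCoact (Z : DGComodule C) :
    kunnethMap C.toDGModule Z.toDGModule ∘ₗ Z.homology.leftCoactHom.lin =
      Z.leftCoactHom.homologyMap.lin := by
  refine LinearMap.ext fun z => ?_
  exact kunnethMap_twist_homologyCoaction Z.coactHom z

/-- The comparison map `H_*(X □_C Z) ⟶ H_*(X) □_{H_*(C)} H_*(Z)`. -/
noncomputable def homologyCotensor (X Z : DGComodule C) :
    (X.cotensor Z).homology →ₗ[k] X.homology.cotensor Z.homology :=
  ((kunneth X.toDGModule Z.toDGModule).symm.toLinearMap ∘ₗ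
    (cotensorIncl X Z).homologyMap.lin).codRestrict _
      (homologyCoaction_equalizer (a := X.coactHom) (b := Z.leftCoactHom) (ι := cotensorIncl X Z)
        cotensor_eq Z.homology.leftCoactHom.lin (kunnethMap_leftCoact Z))

theorem kunnethMap_homologyCotensor (X Z : DGComodule C) (x : (X.cotensor Z).homology) :
    kunnethMap X.toDGModule Z.toDGModule (homologyCotensor X Z x).1 =
      (cotensorIncl X Z).homologyMap.lin x := kunnethMap_kunneth_symm _

theorem isGraded_homologyCotensor (X Z : DGComodule C) : IsGraded (homologyCotensor X Z) :=
  fun n x hx => kunneth_symm_mem n _ ((cotensorIncl X Z).homologyMap.map_mem n x hx)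

theorem homologyCotensor_natural (X : DGComodule C) {Z Z' : DGComodule C} (f : Hom Z Z')
    (x : (X.cotensor Z).homology) :
    homologyCotensor X Z' ((X.cotensorMap f).homologyMap.lin x) =
      X.homology.grMap f.homology (homologyCotensor X Z x) := by
  refine Subtype.ext ((kunnethMap_bijective X.toDGModule Z'.toDGModule).1 ?_)
  rw [kunnethMap_homologyCotensor, grMap_coe]
  refine Eq.trans ?_ (kunnethMap_lTensor f.toHom (homologyCotensor X Z x).1).symm
  rw [kunnethMap_homologyCotensor, ← Hom.homologyMap_comp, ← Hom.homologyMap_comp]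
  rfl

theorem counitHom_homology (M : DGModule k) (t : M.homology ⊗[k] C.toDGModule.homology) :
    (DGCoalgebra.counitHom M C).homologyMap.lin (kunnethMap M C.toDGModule t) =
      (DGCoalgebra.counitHom M.homology C.homology).lin t := by
  have : (DGCoalgebra.counitHom M C).homologyMap.lin ∘ₗ kunnethMap M C.toDGModule =
      (DGCoalgebra.counitHom M.homology C.homology).lin := by
    refine homology_tensor_ext fun z w => ?_
    rw [LinearMap.comp_apply, kunnethMap_cls, Hom.homologyMap_cls]
    refine Eq.trans ?_ (DGCoalgebra.counitHom_tmul M.homology C.homology _ _).symm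
    change _ = Coalgebra.counit (R := k) w.1 • M.cls z
    rw [← map_smul]
    exact congrArg M.cls (Subtype.ext (DGCoalgebra.counitHom_tmul M C z.1 w.1))
  exact LinearMap.congr_fun this t

/-- Both sides are identified with `H_*(X) ⊗ H_*(M)`: the source by `cotensorCofree` over `C` and
Künneth, the target by `cotensorCofree` over `H_*(C)`, transported along `kunnethCofree`. The
comparison map is compatible with these identifications. -/
theorem homologyCotensor_cofree_bijective (hC : C.IsCocommutative) (X : DGComodule C)
    (M : DGModule k) : Function.Bijective (homologyCotensor X (cofree M C)) := by
  let Ψ : X.homology.cotensor (cofree M C).homology →ₗ[k] X.homology ⊗[k] M.homology :=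
    (DGCoalgebra.counitHom M C).homologyMap.lin.lTensor X.homology ∘ₗ Submodule.subtype _
  have h1 : kunnethMap X.toDGModule M ∘ₗ Ψ ∘ₗ homologyCotensor X (cofree M C) =
      (X.cotensorCofree M).homologyMap.lin := by
    refine LinearMap.ext fun x => ?_
    refine (kunnethMap_lTensor (DGCoalgebra.counitHom M C)
      (homologyCotensor X (cofree M C) x).1).trans ?_
    refine (congrArg _ (kunnethMap_homologyCotensor X (cofree M C) x)).trans ?_
    exact (Hom.homologyMap_comp ((DGModule.Hom.id X.toDGModule).tensor
      (DGCoalgebra.counitHom M C)) (cotensorIncl X (cofree M C)) x).symm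
  have h2 : Ψ ∘ₗ X.homology.grMap (kunnethCofree M C) =
      (X.homology.cotensorCofree M.homology).lin := by
    refine LinearMap.ext fun w => ?_
    change (DGCoalgebra.counitHom M C).homologyMap.lin.lTensor X.homology
      ((kunnethMap M C.toDGModule).lTensor X.homology w.1) =
        (DGCoalgebra.counitHom M.homology C.homology).lin.lTensor X.homology w.1
    rw [← LinearMap.comp_apply, ← LinearMap.lTensor_comp]
    congr 2
    exact LinearMap.ext (counitHom_homology M)
  have hΨ : Function.Bijective Ψ := by
    refine (Function.Bijective.of_comp_iff Ψ (grMap_bijective X.homology (kunnethCofree M C)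
      (kunnethMap_bijective M C.toDGModule))).1 ?_
    have := cotensorCofree_bijective hC.homology X.homology M.homology
    rw [← h2] at this
    exact this
  have h3 : Function.Bijective (kunnethMap X.toDGModule M ∘ₗ Ψ) :=
    (kunnethMap_bijective X.toDGModule M).comp hΨ
  refine (Function.Bijective.of_comp_iff' h3 _).1 ?_
  have := Hom.homologyMap_bijective _ (cotensorCofree_bijective hC X M)
  rw [← h1] at this
  exact this

end DGComodule

end HomologyComodule

/-! ### Independence of the resolution, and CoTor. -/

section Comparison

variable {k : Type u} [CommRing k]

open DGModule

namespace DGComodule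

variable {C : DGCoalgebra k}

/-- The map `(X □_C Y)_p ⟶ (X □_C Y')_p` induced by a map of graded comodules. -/
noncomputable def grMapGr (X : DGComodule C) {Y Y' : DGComodule C} (f : GrHom Y Y') (p : ℕ) :
    (X.cotensor Y).gr p →ₗ[k] (X.cotensor Y').gr p :=
  (X.grMap f).restrict (isGraded_grMap X f p)

theorem grMapGr_coe (X : DGComodule C) {Y Y' : DGComodule C} (f : GrHom Y Y') (p : ℕ)
    (w : (X.cotensor Y).gr p) : (X.grMapGr f p w).1.1 = f.lin.lTensor X w.1.1 := rfl

theorem grMapGr_ext {X Y : DGComodule C} {p : ℕ} {w w' : (X.cotensor Y).gr p}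
    (h : w.1.1 = w'.1.1) : w = w' := Subtype.ext (Subtype.ext h)

theorem grMapGr_comm (X : DGComodule C) {Y₁ Y₂ Y₃ Y₄ : DGComodule C} {f : GrHom Y₁ Y₂}
    {g : GrHom Y₂ Y₄} {f' : GrHom Y₁ Y₃} {g' : GrHom Y₃ Y₄}
    (h : ∀ x, g.lin (f.lin x) = g'.lin (f'.lin x)) (p : ℕ) (w : (X.cotensor Y₁).gr p) :
    X.grMapGr g p (X.grMapGr f p w) = X.grMapGr g' p (X.grMapGr f' p w) := by
  refine grMapGr_ext ?_
  rw [grMapGr_coe, grMapGr_coe, grMapGr_coe, grMapGr_coe, ← LinearMap.comp_apply,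
    ← LinearMap.lTensor_comp, ← LinearMap.comp_apply, ← LinearMap.lTensor_comp]
  congr 2
  exact LinearMap.ext h

/-- Additivity of `X □_C -` carries stable identities over to cotensor products. -/
theorem grMapGr_sub_eq (X : DGComodule C) {A B W : DGComodule C} {f : GrHom A B} {g : GrHom B A}
    {a : GrHom A W} {b : GrHom W A} (h : ∀ x, g.lin (f.lin x) - x = b.lin (a.lin x)) (p : ℕ)
    (w : (X.cotensor A).gr p) :
    X.grMapGr g p (X.grMapGr f p w) - w = X.grMapGr b p (X.grMapGr a p w) := by
  refine grMapGr_ext ?_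
  have h1 : b.lin ∘ₗ a.lin = g.lin ∘ₗ f.lin - LinearMap.id := LinearMap.ext fun x => (h x).symm
  change g.lin.lTensor X (f.lin.lTensor X w.1.1) - w.1.1 = b.lin.lTensor X (a.lin.lTensor X w.1.1)
  rw [← LinearMap.comp_apply (b.lin.lTensor X), ← LinearMap.lTensor_comp, h1,
    LinearMap.lTensor_sub, LinearMap.lTensor_id, LinearMap.lTensor_comp]
  rfl

/-- A resolution `0 ⟶ A⁰ ⟶ J⁰ ⟶ J¹ ⟶ ⋯` of graded comodules by injective ones, cut in short exact
sequences `0 ⟶ Aⁿ ⟶ Jⁿ ⟶ Aⁿ⁺¹ ⟶ 0`. -/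
structure GrResolution (C : DGCoalgebra k) where
  /-- the cosyzygies -/
  syz : ℕ → DGComodule C
  /-- the terms -/
  obj : ℕ → DGComodule C
  /-- the inclusion of the cosyzygies -/
  incl : ∀ n, GrHom (syz n) (obj n)
  /-- the projections to the next cosyzygy -/
  proj : ∀ n, GrHom (obj n) (syz (n + 1))
  isGrInjective : ∀ n, (obj n).IsGrInjective
  incl_injective : ∀ n, Function.Injective (incl n).lin
  exact : ∀ n, Function.Exact (incl n).lin (proj n).lin
  proj_surjective : ∀ n, Function.Surjective (proj n).lin

/-- Maps of graded comodules vanishing on a subcomodule descend to the quotient. -/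
theorem GrHom.exists_descend {A J Q Z : DGComodule C} {i : GrHom A J} {π : GrHom J Q}
    (hex : Function.Exact i.lin π.lin) (hπ : Function.Surjective π.lin) (h : GrHom J Z)
    (h0 : ∀ a, h.lin (i.lin a) = 0) : ∃ f : GrHom Q Z, ∀ x, f.lin (π.lin x) = h.lin x := by
  have hker : LinearMap.ker π.lin ≤ LinearMap.ker h.lin := by
    intro x hx
    obtain ⟨a, rfl⟩ := (hex x).1 hx
    exact h0 a
  let f : Q →ₗ[k] Z := (LinearMap.ker π.lin).liftQ h.lin hker ∘ₗ
    (π.lin.quotKerEquivOfSurjective hπ).symm.toLinearMap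
  have hf : ∀ x, f (π.lin x) = h.lin x := by
    intro x
    have : (π.lin.quotKerEquivOfSurjective hπ).symm (π.lin x) = Submodule.Quotient.mk x := by
      rw [LinearEquiv.symm_apply_eq]
      rfl
    simp only [f, LinearMap.comp_apply, LinearEquiv.coe_coe, this]
    rfl
  refine ⟨⟨f, fun n y hy => ?_, fun y => ?_⟩, hf⟩
  · obtain ⟨x, hx, rfl⟩ := π.map_mem.exists_mem hy (hπ y)
    rw [hf]
    exact h.map_mem n x hx
  · obtain ⟨x, rfl⟩ := hπ y
    have : f ∘ₗ π.lin = h.lin := LinearMap.ext hf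
    rw [← π.map_coact, ← LinearMap.comp_apply, ← LinearMap.rTensor_comp, this, h.map_coact, hf]

namespace GrResolution

variable (R R' : GrResolution C)

/-- One step of the comparison of resolutions: injectivity extends `f` to the terms, and the
extension descends to the cokernels. -/
theorem exists_extend {n n' : ℕ} (f : GrHom (R.syz n) (R'.syz n')) :
    ∃ (F : GrHom (R.obj n) (R'.obj n')) (f' : GrHom (R.syz (n + 1)) (R'.syz (n' + 1))),
      (∀ x, F.lin ((R.incl n).lin x) = (R'.incl n').lin (f.lin x)) ∧
      ∀ x, f'.lin ((R.proj n).lin x) = (R'.proj n').lin (F.lin x) := by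
  obtain ⟨F, hF⟩ := R'.isGrInjective n' _ _ (R.incl n) (R.incl_injective n) ((R'.incl n').comp f)
  obtain ⟨f', hf'⟩ := GrHom.exists_descend (R.exact n) (R.proj_surjective n)
    ((R'.proj n').comp F) (fun a => by
      change (R'.proj n').lin (F.lin ((R.incl n).lin a)) = 0
      rw [hF]
      exact (R'.exact n').apply_apply_eq_zero _)
  exact ⟨F, f', hF, hf'⟩

/-- An endomorphism of a graded comodule is stably the identity if it differs from it by a map
factoring through an injective comodule. -/
def IsStablyId {A B : DGComodule C} (f : GrHom A B) (g : GrHom B A) : Prop :=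
  ∃ (W : DGComodule C) (_ : W.IsGrInjective) (a : GrHom A W) (b : GrHom W A),
    ∀ x, g.lin (f.lin x) - x = b.lin (a.lin x)

-- Extend `a` to `a'` on the term `J` of `R`. Then `G F - 1 - incl b a'` vanishes on the cosyzygy
-- and descends to `v`; projecting removes the summand through `incl`. The error at the next stage
-- thus factors through `J` itself, which both continues the induction and becomes a coboundary in
-- cohomology.
variable {R R'} in
theorem exists_factor {n n' : ℕ} {f : GrHom (R.syz n) (R'.syz n')} {g : GrHom (R'.syz n') (R.syz n)}
    {F : GrHom (R.obj n) (R'.obj n')} {G : GrHom (R'.obj n') (R.obj n)}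
    {f' : GrHom (R.syz (n + 1)) (R'.syz (n' + 1))} {g' : GrHom (R'.syz (n' + 1)) (R.syz (n + 1))}
    (hF : ∀ x, F.lin ((R.incl n).lin x) = (R'.incl n').lin (f.lin x))
    (hG : ∀ x, G.lin ((R'.incl n').lin x) = (R.incl n).lin (g.lin x))
    (hf : ∀ x, f'.lin ((R.proj n).lin x) = (R'.proj n').lin (F.lin x))
    (hg : ∀ x, g'.lin ((R'.proj n').lin x) = (R.proj n).lin (G.lin x))
    (h : IsStablyId f g) :
    ∃ v : GrHom (R.syz (n + 1)) (R.obj n), ∀ x, g'.lin (f'.lin x) - x = (R.proj n).lin (v.lin x) := by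
  obtain ⟨W, hW, a, b, hab⟩ := h
  obtain ⟨a', ha'⟩ := hW _ _ (R.incl n) (R.incl_injective n) a
  obtain ⟨v, hv⟩ := GrHom.exists_descend (R.exact n) (R.proj_surjective n)
    (((G.comp F).sub (GrHom.id _)).sub ((R.incl n).comp (b.comp a'))) (fun x => by
      change G.lin (F.lin ((R.incl n).lin x)) - (R.incl n).lin x -
        (R.incl n).lin (b.lin (a'.lin ((R.incl n).lin x))) = 0
      rw [hF, hG, ha', ← hab, map_sub, sub_self])
  refine ⟨v, fun x => ?_⟩
  obtain ⟨y, rfl⟩ := R.proj_surjective n x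
  have hv' : v.lin ((R.proj n).lin y) = G.lin (F.lin y) - y -
    (R.incl n).lin (b.lin (a'.lin y)) := hv y
  rw [hv', hf, hg, map_sub, map_sub, (R.exact n).apply_apply_eq_zero, sub_zero]

variable {R R'} in
/-- The cosyzygies of two resolutions of the same comodule are stably equivalent. -/
theorem exists_stableEquiv (h0 : R.syz 0 = R'.syz 0) (n : ℕ) :
    ∃ (f : GrHom (R.syz n) (R'.syz n)) (g : GrHom (R'.syz n) (R.syz n)),
      IsStablyId f g ∧ IsStablyId g f := by
  induction n with
  | zero =>
    -- Generalising to variables `A` and `B` lets the equality be substituted. For identities the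
    -- error is zero and factors through any injective comodule.
    have key : ∀ {A B : DGComodule C}, A = B → ∀ W : DGComodule C, W.IsGrInjective →
        ∃ (f : GrHom A B) (g : GrHom B A), IsStablyId f g ∧ IsStablyId g f := by
      rintro A _ rfl W hW
      have hz : ∀ (X Y : DGComodule C) (x : X),
          (0 : X →ₗ[k] Y).rTensor C (X.coact x) = Y.coact ((0 : X →ₗ[k] Y) x) := by
        intro X Y x
        rw [LinearMap.rTensor_zero, LinearMap.zero_apply, LinearMap.zero_apply, map_zero]
      have h : IsStablyId (GrHom.id A) (GrHom.id A) :=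
        ⟨W, hW, ⟨0, fun _ _ _ => zero_mem _, hz A W⟩, ⟨0, fun _ _ _ => zero_mem _, hz W A⟩,
          fun x => sub_self x⟩
      exact ⟨_, _, h, h⟩
    exact key h0 (R.obj 0) (R.isGrInjective 0)
  | succ n ih =>
    obtain ⟨f, g, hfg, hgf⟩ := ih
    obtain ⟨F, f', hF, hf⟩ := R.exists_extend R' f
    obtain ⟨G, g', hG, hg⟩ := R'.exists_extend R g
    obtain ⟨v, hv⟩ := exists_factor hF hG hf hg hfg
    obtain ⟨v', hv'⟩ := exists_factor hG hF hg hf hgf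
    exact ⟨f', g', ⟨_, R.isGrInjective n, v, R.proj n, hv⟩,
      ⟨_, R'.isGrInjective n, v', R'.proj n, hv'⟩⟩

/-- The image of `(X □_C Jⁿ⁻¹)_p` in `(X □_C Aⁿ)_p`. -/
noncomputable def bdy (X : DGComodule C) (p : ℕ) :
    ∀ n, Submodule k ((X.cotensor (R.syz n)).gr p)
  | 0 => ⊥
  | n + 1 => LinearMap.range (X.grMapGr (R.proj n) p)

/-- The cohomology of `(X □_C J)_p`. -/
abbrev Cohomology (X : DGComodule C) (p n : ℕ) : Type u :=
  (X.cotensor (R.syz n)).gr p ⧸ R.bdy X p n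

/-- The cohomology of `X □_C J` does not depend on the resolution. -/
theorem nonempty_cohomology_equiv (h0 : R.syz 0 = R'.syz 0) (X : DGComodule C) (p n : ℕ) :
    Nonempty (R.Cohomology X p n ≃ₗ[k] R'.Cohomology X p n) := by
  rcases n with _ | n
  · have key : ∀ {A B : DGComodule C}, A = B → Nonempty
        (((X.cotensor A).gr p ⧸ (⊥ : Submodule k ((X.cotensor A).gr p))) ≃ₗ[k]
          ((X.cotensor B).gr p ⧸ (⊥ : Submodule k ((X.cotensor B).gr p)))) := by
      rintro A _ rfl
      exact ⟨LinearEquiv.refl _ _⟩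
    exact key h0
  · obtain ⟨f, g, hfg, hgf⟩ := exists_stableEquiv h0 n
    obtain ⟨F, f', hF, hf⟩ := R.exists_extend R' f
    obtain ⟨G, g', hG, hg⟩ := R'.exists_extend R g
    obtain ⟨v, hv⟩ := exists_factor hF hG hf hg hfg
    obtain ⟨v', hv'⟩ := exists_factor hG hF hg hf hgf
    have hfb : R.bdy X p (n + 1) ≤ (R'.bdy X p (n + 1)).comap (X.grMapGr f' p) := by
      rintro _ ⟨y, rfl⟩
      exact ⟨X.grMapGr F p y, (X.grMapGr_comm hf p y).symm⟩
    have hgb : R'.bdy X p (n + 1) ≤ (R.bdy X p (n + 1)).comap (X.grMapGr g' p) := by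
      rintro _ ⟨y, rfl⟩
      exact ⟨X.grMapGr G p y, (X.grMapGr_comm hg p y).symm⟩
    refine ⟨LinearEquiv.ofLinearMap (Submodule.mapQ _ _ (X.grMapGr f' p) hfb)
      (Submodule.mapQ _ _ (X.grMapGr g' p) hgb) (LinearMap.ext fun y => ?_)
      (LinearMap.ext fun y => ?_)⟩
    · obtain ⟨y, rfl⟩ := Submodule.mkQ_surjective _ y
      refine (Submodule.Quotient.eq (R'.bdy X p (n + 1))).2 ?_
      -- The composite differs from the identity by a map through the projection from the previous
      -- term, hence by a coboundary.
      exact ⟨X.grMapGr v' p y, (X.grMapGr_sub_eq hv' p y).symm⟩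
    · obtain ⟨y, rfl⟩ := Submodule.mkQ_surjective _ y
      refine (Submodule.Quotient.eq (R.bdy X p (n + 1))).2 ?_
      exact ⟨X.grMapGr v p y, (X.grMapGr_sub_eq hv p y).symm⟩

section Semisimple

variable [IsSemisimpleRing k]

theorem grMapGr_incl_injective (X : DGComodule C) (p n : ℕ) :
    Function.Injective (X.grMapGr (R.incl n) p) :=
  injective_restrict (isGraded_grMap X _) (grMap_injective X _ (R.incl_injective n)) p

theorem grMapGr_exact (X : DGComodule C) (p n : ℕ) :
    Function.Exact (X.grMapGr (R.incl n) p) (X.grMapGr (R.proj n) p) :=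
  (isGraded_grMap X _).exact_restrict (isGraded_grMap X _)
    (grMap_exact X _ _ (R.incl_injective n) (R.exact n)) p

/-- The cocycles of `(X □_C J)_p`. -/
theorem incl_proj_eq_zero_iff (X : DGComodule C) (p n : ℕ) (x : (X.cotensor (R.obj n)).gr p) :
    X.grMapGr (R.incl (n + 1)) p (X.grMapGr (R.proj n) p x) = 0 ↔
      ∃ w, X.grMapGr (R.incl n) p w = x := by
  rw [map_eq_zero_iff _ (R.grMapGr_incl_injective X p (n + 1))]
  exact R.grMapGr_exact X p n x

/-- The coboundaries of `(X □_C J)_p`. -/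
theorem mem_bdy_succ_iff (X : DGComodule C) (p n : ℕ) (w : (X.cotensor (R.syz (n + 1))).gr p) :
    w ∈ R.bdy X p (n + 1) ↔ ∃ y, X.grMapGr (R.incl (n + 1)) p (X.grMapGr (R.proj n) p y) =
      X.grMapGr (R.incl (n + 1)) p w :=
  exists_congr fun _ => (R.grMapGr_incl_injective X p (n + 1)).eq_iff.symm

theorem mem_bdy_zero_iff (X : DGComodule C) (p : ℕ) (w : (X.cotensor (R.syz 0)).gr p) :
    w ∈ R.bdy X p 0 ↔ X.grMapGr (R.incl 0) p w = 0 := by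
  rw [map_eq_zero_iff _ (R.grMapGr_incl_injective X p 0)]
  exact Submodule.mem_bot k

end Semisimple

end GrResolution

/-- The resolution of graded comodules underlying the standard injective resolution. -/
noncomputable def standardGrResolution [IsSemisimpleRing k] (Y : DGComodule C) :
    GrResolution C where
  syz := cosyzygy Y
  obj n := cofree (cosyzygy Y n).toDGModule.disk C
  incl n := (cosyzygy Y n).embed.toGr
  proj n := (cokerMap (cosyzygy Y n).embed).toGr
  -- The disks matter for injectivity among dg-comodules; as graded comodules, all cofree ones are
  -- injective.
  isGrInjective _ := isGrInjective_cofree _ _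
  incl_injective _ := embed_injective _
  exact _ := fun _ => Submodule.Quotient.mk_eq_zero _
  proj_surjective _ := Submodule.mkQ_surjective _

theorem cotensorComplex_d (X : DGComodule C) {Y : DGComodule C} (I : InjectiveResolution Y)
    (p n : ℕ) : (cotensorComplex X I p).d n (n + 1) = ModuleCat.ofHom
      ((X.cotensorMap (I.diff n)).lin.restrict ((X.cotensorMap (I.diff n)).map_mem p)) :=
  CochainComplex.of_d (fun q => ModuleCat.of k ((X.cotensor (I.obj q)).gr p))
    (fun q => ModuleCat.ofHom
      ((X.cotensorMap (I.diff q)).lin.restrict ((X.cotensorMap (I.diff q)).map_mem p))) n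

/-- By left exactness the cocycles in position `q` are the cotensor product with the `q`-th
cosyzygy, which serves as `W` in `nonempty_homology_iso`. -/
theorem nonempty_coTor_iso [IsSemisimpleRing k] (X Y : DGComodule C) (q p : ℕ) :
    Nonempty (CoTor X Y q p ≅ ModuleCat.of k (Y.standardGrResolution.Cohomology X p q)) := by
  let R := Y.standardGrResolution
  let K := cotensorComplex X Y.injectiveResolution p
  have hd : ∀ n, K.d n (n + 1) = ModuleCat.ofHom (X.grMapGr (R.incl (n + 1)) p ∘ₗ
      X.grMapGr (R.proj n) p) := by
    intro n
    refine (cotensorComplex_d X Y.injectiveResolution p n).trans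
      (congrArg ModuleCat.ofHom (LinearMap.ext fun w => ?_))
    refine grMapGr_ext ?_
    change (standardDiff Y n).lin.lTensor X w.1.1 =
      (R.incl (n + 1)).lin.lTensor X ((R.proj n).lin.lTensor X w.1.1)
    exact LinearMap.lTensor_comp_apply X (R.incl (n + 1)).lin (R.proj n).lin w.1.1
  have hd' : ∀ n x, (K.d n (n + 1)).hom x = X.grMapGr (R.incl (n + 1)) p
      (X.grMapGr (R.proj n) p x) := fun n x => by rw [hd]; rfl
  refine nonempty_homology_iso K q (W := (X.cotensor (R.syz q)).gr p)
    (X.grMapGr (R.incl q) p) (Submodule.mkQ _) (fun x => ?_) (Submodule.mkQ_surjective _)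
    (fun w => ?_)
  · refine Iff.trans ?_ (R.incl_proj_eq_zero_iff X p q x)
    constructor
    · intro h
      exact (hd' q x).symm.trans (h (q + 1))
    · intro h l
      by_cases hl : q + 1 = l
      · subst hl
        exact (hd' q x).trans h
      · rw [K.shape _ _ hl]
        rfl
  · rw [Submodule.mkQ_apply, Submodule.Quotient.mk_eq_zero]
    rcases q with _ | q
    · refine (R.mem_bdy_zero_iff X p w).trans ⟨fun h => ⟨0, 0, ?_⟩, ?_⟩
      · rw [map_zero]
        exact h.symm
      · rintro ⟨i, y, hy⟩
        rw [K.shape _ _ (by simp)] at hy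
        exact hy.symm
    · refine (R.mem_bdy_succ_iff X p q w).trans ⟨?_, ?_⟩
      · rintro ⟨y, hy⟩
        exact ⟨q, y, (hd' q y).trans hy⟩
      · rintro ⟨i, y, hy⟩
        by_cases hi : i = q
        · subst hi
          exact ⟨y, (hd' i y).symm.trans hy⟩
        · rw [K.shape _ _ (by simpa using hi)] at hy
          refine ⟨0, ?_⟩
          rw [map_zero, map_zero]
          exact hy

end DGComodule

end Comparison

/-! ### The Eilenberg–Moore exact couple and its second page. -/

section EilenbergMooreCouple

variable {k : Type u} [CommRing k] [IsSemisimpleRing k]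

open DGModule

/-- The second page of the spectral sequence of an exact couple. -/
noncomputable def ExactCouple.pageTwoIso (c : ExactCouple k) (p q : ℕ) :
    (c.spectralSequence.page 2 le_rfl).X (p, q) ≅ ModuleCat.of k (c.Page 1 p q) :=
  -- `(2 - 1).toNat` evaluates to `1`, so the two modules agree by definition.
  Iso.refl (ModuleCat.of k (c.Page 1 p q))

namespace DGComodule

variable {C : DGCoalgebra k}

/-- Left exactness is automatic; fibrancy or coflatness of `X` is needed only for surjectivity. -/
theorem cotensor_shortExact (hC : C.IsSimplyConnected) (hC' : C.IsCocommutative)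
    {X : DGComodule C} (hX : X.IsFibrant ∨ X.IsCoflat) (Y : DGComodule C) :
    ShortExact (X.cotensorMap Y.coactMap) (X.cotensorMap Y.coactProj) where
  injective := grMap_injective X Y.coactMap.toGr Y.coactMap_injective
  exact := grMap_exact X Y.coactMap.toGr Y.coactProj.toGr Y.coactMap_injective
    Y.coactMap_coactProj_exact
  surjective := by
    rcases hX with hX | hX
    · obtain ⟨r, hr⟩ := hX.exists_retraction hC
      exact grMap_surjective hC' r hr Y.coactProj.toGr Y.coactProj_surjective
    · exact (hX _ _ _ Y.coactMap Y.coactProj Y.coactMap_injective Y.coactMap_coactProj_exact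
        Y.coactProj_surjective).2.2

/-- The projection from the cofree comodule on an iterated cokernel to the next one. -/
noncomputable def coactSyzygyProj (Y : DGComodule C) (q : ℕ) :
    Hom (cofree (coactSyzygy Y q).toDGModule C) (coactSyzygy Y (q + 1)) :=
  (coactSyzygy Y q).coactProj

theorem cotensor_coactSyzygy_shortExact (hC : C.IsSimplyConnected) (hC' : C.IsCocommutative)
    {X : DGComodule C} (hX : X.IsFibrant ∨ X.IsCoflat) (Y : DGComodule C) (q : ℕ) :
    ShortExact (X.cotensorMap (coactSyzygy Y q).coactMap)
      (X.cotensorMap (coactSyzygyProj Y q)) :=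
  cotensor_shortExact hC hC' hX (coactSyzygy Y q)

/-- The map `H_p(X □_C Z) ⟶ H_p(X □_C Z')` induced by a map of comodules. -/
noncomputable def homologyCotensorMapGr (X : DGComodule C) {Z Z' : DGComodule C} (f : Hom Z Z')
    (p : ℕ) : (X.cotensor Z).homology.gr p →ₗ[k] (X.cotensor Z').homology.gr p :=
  (X.cotensorMap f).homologyMap.lin.restrict ((X.cotensorMap f).homologyMap.map_mem p)

/-- The exact couple given by the long exact homology sequences of
`0 ⟶ X □_C Yq ⟶ X ⊗ Yq ⟶ X □_C Yq₊₁ ⟶ 0`, where `0 ⟶ Yq ⟶ Yq ⊗ C ⟶ Yq₊₁ ⟶ 0`. -/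
noncomputable def exactCouple (hC : C.IsSimplyConnected) (hC' : C.IsCocommutative)
    {X : DGComodule C} (hX : X.IsFibrant ∨ X.IsCoflat) (Y : DGComodule C) : ExactCouple k where
  D p q := (X.cotensor (coactSyzygy Y q)).homology.gr p
  E p q := (X.cotensor (cofree (coactSyzygy Y q).toDGModule C)).homology.gr p
  -- The connecting map goes from `H_{p+1}(X □_C Y_{q+1})` to `H_p(X □_C Y_q)`, so its iterates end
  -- in the homology of `X □_C Y`.
  i p q := (cotensor_coactSyzygy_shortExact hC hC' hX Y q).connectingGr p
  j p q := X.homologyCotensorMapGr (coactSyzygy Y q).coactMap p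
  κ p q := X.homologyCotensorMapGr (coactSyzygyProj Y q) p
  exact_i_j p q :=
    (cotensor_coactSyzygy_shortExact hC hC' hX Y q).exact_connectingGr_homologyMap p
  exact_j_κ p q := IsGraded.exact_restrict (X.cotensorMap _).homologyMap.map_mem
    (X.cotensorMap _).homologyMap.map_mem
    (cotensor_coactSyzygy_shortExact hC hC' hX Y q).exact_homologyMap p
  exact_κ_i p q :=
    (cotensor_coactSyzygy_shortExact hC hC' hX Y q).exact_homologyMap_connectingGr p
  eq_zero _ q h x := Subtype.ext
    (cotensor_homology_eq_zero X _ (coactSyzygy_gr_eq_bot hC Y q) h x.1 x.2)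

/-- The abutment of the exact couple. -/
noncomputable def exactCoupleAbutment (hC : C.IsSimplyConnected) (hC' : C.IsCocommutative)
    {X : DGComodule C} (hX : X.IsFibrant ∨ X.IsCoflat) (Y : DGComodule C) (n : ℕ) :
    (exactCouple hC hC' hX Y).D n 0 ≃ₗ[k] (X.cotensor Y).homology.gr n :=
  LinearEquiv.refl k ((X.cotensor (coactSyzygy Y 0)).homology.gr n)

/-- The homology of the cobar resolution, a resolution of the graded `H_*(C)`-comodule `H_*(Y)`. -/
noncomputable def homologyGrResolution (Y : DGComodule C) : GrResolution C.homology where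
  syz q := (coactSyzygy Y q).homology
  obj q := (cofree (coactSyzygy Y q).toDGModule C).homology
  incl q := (coactSyzygy Y q).coactMap.homology
  proj q := (coactSyzygyProj Y q).homology
  isGrInjective _ := isGrInjective_homology_cofree _ _
  incl_injective _ := homology_coactMap_injective _
  exact _ := homology_coactMap_coactProj_exact _
  proj_surjective _ := homology_coactProj_surjective _

/-- The comparison map `H_p(X □_C Z) ⟶ (H_*(X) □_{H_*(C)} H_*(Z))_p`. -/
noncomputable def homologyCotensorGr (X Z : DGComodule C) (p : ℕ) :
    (X.cotensor Z).homology.gr p →ₗ[k] (X.homology.cotensor Z.homology).gr p :=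
  (homologyCotensor X Z).restrict (isGraded_homologyCotensor X Z p)

theorem homologyCotensorGr_natural (X : DGComodule C) {Z Z' : DGComodule C} (f : Hom Z Z') (p : ℕ)
    (x : (X.cotensor Z).homology.gr p) :
    homologyCotensorGr X Z' p (X.homologyCotensorMapGr f p x) =
      X.homology.grMapGr f.homology p (homologyCotensorGr X Z p x) :=
  Subtype.ext (homologyCotensor_natural X f x.1)

theorem homologyCotensorGr_cofree_bijective (hC : C.IsCocommutative) (X : DGComodule C)
    (M : DGModule k) (p : ℕ) : Function.Bijective (homologyCotensorGr X (cofree M C) p) := by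
  have h := homologyCotensor_cofree_bijective hC X M
  have hg := isGraded_homologyCotensor X (cofree M C)
  exact ⟨injective_restrict hg h.1 p, hg.surjective_restrict h.2 p⟩

/-- The second page of the exact couple is `CoTor`. -/
theorem nonempty_page_equiv_cohomology (hC : C.IsSimplyConnected) (hC' : C.IsCocommutative)
    {X : DGComodule C} (hX : X.IsFibrant ∨ X.IsCoflat) (Y : DGComodule C) (p q : ℕ) :
    Nonempty ((exactCouple hC hC' hX Y).Page 1 p q ≃ₗ[k]
      Y.homologyGrResolution.Cohomology X.homology p q) := by
  let c := exactCouple hC hC' hX Y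
  let R := Y.homologyGrResolution
  -- By naturality, `θ` turns the first differential `j ∘ κ` into the differential `incl ∘ proj` of
  -- `H_*(X) □ R`.
  let θ : ∀ q, c.E p q ≃ₗ[k] (X.homology.cotensor (R.obj q)).gr p := fun q =>
    LinearEquiv.ofBijective (homologyCotensorGr X (cofree (coactSyzygy Y q).toDGModule C) p)
      (homologyCotensorGr_cofree_bijective hC' X _ p)
  have hθ : ∀ q x, θ (q + 1) (c.j p (q + 1) (c.κ p q x)) =
      X.homology.grMapGr (R.incl (q + 1)) p (X.homology.grMapGr (R.proj q) p (θ q x)) :=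
    fun q x => (homologyCotensorGr_natural X (coactSyzygy Y (q + 1)).coactMap p _).trans
      (congrArg _ (homologyCotensorGr_natural X (coactSyzygyProj Y q) p x))
  have hθ' : ∀ q x, c.j p (q + 1) (c.κ p q x) = (θ (q + 1)).symm (X.homology.grMapGr
      (R.incl (q + 1)) p (X.homology.grMapGr (R.proj q) p (θ q x))) := fun q x =>
    (LinearEquiv.eq_symm_apply _).2 (hθ q x)
  refine c.nonempty_page_iso ((θ q).symm.toLinearMap ∘ₗ X.homology.grMapGr (R.incl q) p)
    (Submodule.mkQ _) (fun x => ?_) (Submodule.mkQ_surjective _) (fun w => ?_)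
  · rw [c.mem_cyc_one_iff, hθ', LinearEquiv.map_eq_zero_iff]
    refine (R.incl_proj_eq_zero_iff X.homology p q (θ q x)).trans (exists_congr fun w => ?_)
    exact (LinearEquiv.symm_apply_eq (θ q)).symm
  · rw [Submodule.mkQ_apply, Submodule.Quotient.mk_eq_zero]
    rcases q with _ | q
    · rw [c.bdy_one_zero, Submodule.mem_bot]
      exact (R.mem_bdy_zero_iff X.homology p w).trans (LinearEquiv.map_eq_zero_iff (θ 0).symm).symm
    · rw [c.mem_bdy_one_iff]
      refine (R.mem_bdy_succ_iff X.homology p q w).trans ⟨?_, ?_⟩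
      · rintro ⟨y, hy⟩
        refine ⟨(θ q).symm y, ?_⟩
        rw [hθ', LinearEquiv.apply_symm_apply, hy]
        rfl
      · rintro ⟨y, hy⟩
        refine ⟨θ q y, ?_⟩
        rw [← hθ, hy]
        exact LinearEquiv.apply_symm_apply _ _

end DGComodule

end EilenbergMooreCouple

end EilenbergMoore

theorem theorem4 {k : Type u} [CommRing k] [IsSemisimpleRing k] (C : DGCoalgebra k)
    (hC : C.IsSimplyConnected) (hC' : C.IsCocommutative) (X Y : DGComodule C)
    (hX : X.IsFibrant ∨ X.IsCoflat) :
    ∃ E : EMSpectralSequence k,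
      (∀ p q : ℕ, Nonempty ((E.page 2 le_rfl).X (p, q) ≅ DGComodule.CoTor X.homology Y.homology q p)) ∧
      E.ConvergesTo (X.cotensor Y).homology := by
  let c := DGComodule.exactCouple hC hC' hX Y
  refine ⟨c.spectralSequence, fun p q => ?_,
    c.spectralSequence_convergesTo _ (DGComodule.exactCoupleAbutment hC hC' hX Y)⟩
  obtain ⟨e₁⟩ := DGComodule.nonempty_page_equiv_cohomology hC hC' hX Y p q
  -- Both resolutions start with `H_*(Y)` by definition, hence the `rfl`.
  obtain ⟨e₂⟩ := Y.homologyGrResolution.nonempty_cohomology_equiv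
    Y.homology.standardGrResolution rfl X.homology p q
  obtain ⟨e₃⟩ := DGComodule.nonempty_coTor_iso X.homology Y.homology q p
  exact ⟨c.pageTwoIso p q ≪≫ (e₁.trans e₂).toModuleIso ≪≫ e₃.symm⟩
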